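/- **Proposition 3.2.** Let $M$ be a compact connected (Hausdorff) projective manifold of dimension $n\ge 0$, that is, a manifold with an atlas of charts valued in $\mathbb{RP}^n$ whose changes of charts are locally restrictions of elements of $PGL(n+1,\mathbb{R})$, and let $\mathrm{Aut}(M)$ be its group of projective automorphisms. Let $B(M)$ be the associated Benzécri radiant affine manifold of dimension $n+1$: over the domain $U$ of a chart $e:U\to\mathbb{RP}^n$ it is the cone $\{v\in\mathbb{R}^{n+1}\setminus\{0\} : [v]\in e(U)\}$ divided by the homotheties $v\mapsto \pm 2^k v$, $k\in\mathbb{Z}$, and over the intersection of two chart domains the cones are glued by the linear maps of determinant $\pm1$ which induce the change of charts. (Equivalently, $B(M)$ is the quotient of $\tilde M\times\mathbb{R}_{+}^{*}$, with developing map $(x,t)\mapsto tD'(x)$, where $\tilde M$ is the universal cover and $D':\tilde M\to S^n\subset\mathbb{R}^{n+1}$ lifts the developing map of $M$, by the group generated by the homothety of ratio $2$ and by $\pi_1(M)$ acting through the lift of the holonomy to linear maps of determinant $\pm1$.) Let $p:B(M)\to M$ be the projection and $\mathrm{Aut}(B(M))$ the group of affine automorphisms of $B(M)$. Both automorphism groups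 carry the compact-open topology, and the index $0$ denotes the identity component. 1. There is a homeomorphism $B(M)\cong M\times S^1$ which carries $p$ to the projection on the first factor. 2. There is a surjective group morphism $P:\mathrm{Aut}(B(M))_0\to \mathrm{Aut}(M)_0$ such that $p(F(b))=P(F)(p(b))$ for all $F\in \mathrm{Aut}(B(M))_0$ and $b\in B(M)$. 3. $\mathrm{Aut}(M)$ and $\mathrm{Aut}(B(M))$ are Lie groups of finite dimension, and $\dim \mathrm{Aut}(M)+1\le \dim \mathrm{Aut}(B(M))$. -/

import Mathlib

open Set Filter Topology Manifold
open scoped LinearAlgebra.Projectivization ContDiff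

noncomputable section

namespace Benzecri

/-! ### Manifolds modelled on a transformation group -/

/-- The pseudogroup generated by a group `G` of transformations of a space `X`: the homeomorphisms
between open subsets of `X` which coincide with an element of `G` near every point of their
source. A charted space over `X` with this groupoid is an `(X, G)`-manifold. -/
def modelGroupoid {X : Type*} [TopologicalSpace X] (G : Subgroup (Equiv.Perm X)) :
    StructureGroupoid X where
  members := {e | ∀ x ∈ e.source, ∃ g ∈ G, ∀ᶠ y in 𝓝 x, e y = g y}
  trans' := by
    intro e e' he he' x hx
    rw [OpenPartialHomeomorph.trans_source] at hx
    obtain ⟨g, hg, h⟩ := he x hx.1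
    obtain ⟨g', hg', h'⟩ := he' (e x) hx.2
    refine ⟨g' * g, G.mul_mem hg' hg, ?_⟩
    filter_upwards [h, (e.continuousAt hx.1).eventually h'] with y hy hy'
    change e' (e y) = g' (g y)
    rw [hy', hy]
  symm' := by
    intro e he x hx
    obtain ⟨g, hg, h⟩ := he (e.symm x) (e.map_target hx)
    refine ⟨g⁻¹, G.inv_mem hg, ?_⟩
    filter_upwards [(e.symm.continuousAt hx).eventually h, e.open_target.mem_nhds hx] with y hy hy'
    rw [e.right_inv hy'] at hy
    rw [Equiv.Perm.eq_inv_iff_eq, ← hy]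
  id_mem' := fun x _ => ⟨1, G.one_mem, Eventually.of_forall fun y => rfl⟩
  locality' := by
    intro e he x hx
    obtain ⟨s, hs, hxs, h⟩ := he x hx
    refine h x ?_
    rw [e.restr_source' s hs]
    exact ⟨hx, hxs⟩
  mem_of_eqOnSource' := by
    intro e e' he hee' x hx
    obtain ⟨g, hg, h⟩ := he x (hee'.1 ▸ hx)
    refine ⟨g, hg, ?_⟩
    filter_upwards [h, e'.open_source.mem_nhds hx] with y hy hy'
    rw [hee'.2 hy', hy]

/-- The automorphism group of a manifold with structure groupoid `𝒢`: the group of all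
homeomorphisms of `M` which, read in charts, belong to `𝒢`. -/
def autGroup {X : Type*} [TopologicalSpace X] (𝒢 : StructureGroupoid X) (M : Type*)
    [TopologicalSpace M] [ChartedSpace X M] [HasGroupoid M 𝒢] : Subgroup (M ≃ₜ M) where
  carrier := {f | ∃ φ : Structomorph 𝒢 M M, φ.toHomeomorph = f}
  one_mem' := ⟨Structomorph.refl M, rfl⟩
  mul_mem' := by
    rintro _ _ ⟨φ, rfl⟩ ⟨ψ, rfl⟩
    exact ⟨ψ.trans φ, rfl⟩
  inv_mem' := by
    rintro _ ⟨φ, rfl⟩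
    exact ⟨φ.symm, rfl⟩

/-! ### The compact-open topology on groups of homeomorphisms -/

/-- The compact-open topology on the group of homeomorphisms of a space. -/
instance homeoTopology (M : Type*) [TopologicalSpace M] : TopologicalSpace (M ≃ₜ M) :=
  TopologicalSpace.induced (fun f => (f : C(M, M))) inferInstance

instance homeo_isTopologicalGroup (M : Type*) [TopologicalSpace M] [CompactSpace M] [T2Space M] :
    IsTopologicalGroup (M ≃ₜ M) where
  continuous_mul := by
    rw [continuous_induced_rng]
    have h : Continuous fun f : M ≃ₜ M => (f : C(M, M)) := continuous_induced_dom
    exact ContinuousMap.continuous_comp'.comp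
      ((h.comp continuous_snd).prodMk (h.comp continuous_fst))
  continuous_inv := by
    rw [continuous_induced_rng, ContinuousMap.continuous_compactOpen]
    intro K hK U hU
    have h : IsOpen {f : M ≃ₜ M | MapsTo ((f : C(M, M))) Uᶜ Kᶜ} :=
      (ContinuousMap.isOpen_setOfPred_mapsTo hU.isClosed_compl.isCompact
        hK.isClosed.isOpen_compl).preimage continuous_induced_dom
    convert h using 1
    ext f
    simp only [Set.mem_ofPred_eq]
    constructor
    · intro hf x hx hfx
      apply hx
      have := hf hfx
      simpa using this
    · intro hf y hy
      by_contra hc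
      refine hf hc ?_
      simpa using hy

/-- `G` is a Lie group of dimension `d`: its topology underlies a smooth manifold structure
modelled on `ℝᵈ` for which the multiplication and the inversion are smooth. -/
def IsLieGroupOfDim (G : Type*) [Group G] [TopologicalSpace G] (d : ℕ) : Prop :=
  ∃ _ : ChartedSpace (EuclideanSpace ℝ (Fin d)) G, LieGroup (𝓡 d) ∞ G

/-! ### The projective, affine and linear models -/

/-- The vector space `ℝⁿ⁺¹`. -/
abbrev E (n : ℕ) : Type := EuclideanSpace ℝ (Fin (n + 1))

/-- The real projective space of dimension `n`. -/
abbrev RP (n : ℕ) : Type := ℙ ℝ (E n)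

/-- The quotient topology on projective space. -/
instance (n : ℕ) : TopologicalSpace (RP n) :=
  inferInstanceAs (TopologicalSpace (Quotient (projectivizationSetoid ℝ (E n))))

/-- The pseudogroup of projective transformations: a projective manifold of dimension `n` is a
charted space over `RP n` with this groupoid. -/
def projectiveGroupoid (n : ℕ) : StructureGroupoid (RP n) :=
  modelGroupoid (MulAction.toPermHom (E n ≃ₗ[ℝ] E n) (RP n)).range

/-- The group of affine transformations of `ℝⁿ⁺¹`. -/
def affineTransformations (n : ℕ) : Subgroup (Equiv.Perm (E n)) where
  carrier := {σ | ∃ a : E n ≃ᵃ[ℝ] E n, a.toEquiv = σ}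
  one_mem' := ⟨1, rfl⟩
  mul_mem' := by
    rintro _ _ ⟨a, rfl⟩ ⟨b, rfl⟩
    exact ⟨a * b, rfl⟩
  inv_mem' := by
    rintro _ ⟨a, rfl⟩
    exact ⟨a⁻¹, rfl⟩

/-- The pseudogroup of affine transformations: an affine manifold of dimension `n + 1` is a
charted space over `ℝⁿ⁺¹` with this groupoid. -/
def affineGroupoid (n : ℕ) : StructureGroupoid (E n) :=
  modelGroupoid (affineTransformations n)

/-- The pseudogroup of linear transformations; a charted space over `ℝⁿ⁺¹` with this groupoid is
a radiant affine manifold. -/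
def linearGroupoid (n : ℕ) : StructureGroupoid (E n) :=
  modelGroupoid (MulAction.toPermHom (E n ≃ₗ[ℝ] E n) (E n)).range

theorem linearGroupoid_le (n : ℕ) : linearGroupoid n ≤ affineGroupoid n := by
  intro e he x hx
  obtain ⟨g, ⟨A, rfl⟩, h⟩ := he x hx
  exact ⟨_, ⟨A.toAffineEquiv, rfl⟩, h⟩

/-! ### The Benzécri manifold

The universal cover of `B(M)` is `M̃ × ℝ₊`, developed on `ℝⁿ⁺¹ - {0}` by `(x, t) ↦ t D'(x)`, where
`D'` is a lift to the sphere of rays of the developing map of `M`; the deck group is generated by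
the lift of the holonomy to the linear maps of determinant `± 1`, and by the homothety of
ratio `2`. Below, this quotient is described over the charts of `M`: over the domain of a chart
`e : U → RP n`, the manifold `B(M)` is the cone of nonzero vectors whose line belongs to `e(U)`,
modulo the homotheties of ratio `± 2 ^ k`; over the intersection of two domains, the cones are
identified by the linear maps of determinant `± 1` which induce the change of charts. -/

section Construction

variable (n : ℕ) (M : Type*) [TopologicalSpace M] [ChartedSpace (RP n) M]

/-- The nonzero vectors whose line belongs to the target of the chart `e`. -/
abbrev Cone {n : ℕ} {M : Type*} [TopologicalSpace M] (e : OpenPartialHomeomorph M (RP n)) :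
    Type :=
  {v : {v : E n // v ≠ 0} // Projectivization.mk' ℝ v ∈ e.target}

/-- The disjoint union of the cones over all charts. -/
abbrev PreB : Type _ := Σ e : atlas (RP n) M, Cone e.1

variable {n M}

/-- The chart in which a point of a cone lives. -/
abbrev PreB.chart (p : PreB n M) : OpenPartialHomeomorph M (RP n) := p.1.1

/-- The vector in `ℝⁿ⁺¹` given by a point of a cone. -/
abbrev PreB.vec (p : PreB n M) : E n := p.2.1.1

/-- The point of `M` over which a point of a cone lives. -/
def PreB.pt (p : PreB n M) : M := p.chart.symm (Projectivization.mk' ℝ p.2.1)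

variable (n M)

/-- Two points of the cones over charts `e` and `e'` define the same point of `B(M)` if they lie
over the same point `m` of `M` and correspond to each other under `2 ^ k • A`, where `A` is a
linear map of determinant `± 1` which induces the change of charts from `e` to `e'` near `m`. -/
def gluing : Setoid (PreB n M) where
  r p q := p.pt = q.pt ∧ ∃ A : E n ≃ₗ[ℝ] E n, |LinearMap.det (A : E n →ₗ[ℝ] E n)| = 1 ∧
    (∀ᶠ x in 𝓝 p.pt, q.chart x = A • p.chart x) ∧ ∃ k : ℤ, q.vec = (2 : ℝ) ^ k • A p.vec
  iseqv := by
    refine ⟨fun p => ⟨rfl, LinearEquiv.refl ℝ _, by simp, ?_, 0, by simp⟩, ?_, ?_⟩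
    · exact Eventually.of_forall fun x => (one_smul (E n ≃ₗ[ℝ] E n) _).symm
    · rintro p q ⟨hpt, A, hA, h, k, hk⟩
      refine ⟨hpt.symm, A.symm, ?_, ?_, -k, ?_⟩
      · have : LinearMap.det (A : E n →ₗ[ℝ] E n) * LinearMap.det (A.symm : E n →ₗ[ℝ] E n) = 1 := by
          rw [← LinearMap.det_comp]; simp
        have h2 := congrArg abs this
        rw [abs_mul, hA] at h2
        simpa using h2
      · rw [← hpt]
        filter_upwards [h] with x hx
        rw [hx]
        exact (inv_smul_smul A _).symm
      · rw [hk, map_smul, smul_smul, ← zpow_add₀ two_ne_zero]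
        simp
    · rintro p q r ⟨hpt, A, hA, h, k, hk⟩ ⟨hpt', A', hA', h', k', hk'⟩
      refine ⟨hpt.trans hpt', A.trans A', ?_, ?_, k' + k, ?_⟩
      · rw [LinearEquiv.coe_trans, LinearMap.det_comp, abs_mul, hA, hA', one_mul]
      · rw [← hpt] at h'
        filter_upwards [h, h'] with x hx hx'
        rw [hx', hx]
        exact (mul_smul A' A _).symm
      · rw [hk', hk, map_smul, smul_smul, ← zpow_add₀ two_ne_zero]
        rfl

/-- The Benzécri manifold `B(M)` of a projective manifold, with the quotient topology. -/
def B : Type _ := Quotient (gluing n M)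

instance : TopologicalSpace (B n M) := inferInstanceAs (TopologicalSpace (Quotient (gluing n M)))

variable {n M}

/-- The point of `B(M)` defined by a point of a cone. -/
def B.mk (p : PreB n M) : B n M := Quotient.mk (gluing n M) p

/-- The projection `B(M) → M`. -/
def B.proj (b : B n M) : M := Quotient.lift PreB.pt (fun _ _ (h : (gluing n M).r _ _) => h.1) b

/-! #### The charts of the Benzécri manifold -/

theorem abs_two_zpow_ne {c : ℝ} {k : ℤ} (h : |c| = (2 : ℝ) ^ k) (h1 : 1 / 2 < |c|)
    (h2 : |c| < 2) : |c| = 1 := by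
  rw [h] at h1 h2 ⊢
  have a : k < 1 := by
    have : (2 : ℝ) ^ k < 2 ^ (1 : ℤ) := by simpa using h2
    exact (zpow_lt_zpow_iff_right₀ one_lt_two).1 this
  have b : -1 < k := by
    have : (2 : ℝ) ^ (-1 : ℤ) < 2 ^ k := by simpa using h1
    exact (zpow_lt_zpow_iff_right₀ one_lt_two).1 this
  have : k = 0 := by omega
  simp [this]

/-- A linear map which preserves the lines of all vectors near `v` is a homothety. -/
theorem eq_smul_of_eventually {V : Type*} [NormedAddCommGroup V] [NormedSpace ℝ V]
    (A : V →ₗ[ℝ] V) {v : V} (hv : v ≠ 0) (h : ∀ᶠ w in 𝓝 v, ∃ c : ℝ, A w = c • w) :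
    ∃ c : ℝ, ∀ w, A w = c • w := by
  obtain ⟨a, ha⟩ := h.self_of_nhds
  refine ⟨a, fun u => ?_⟩
  by_cases hu : ∃ t : ℝ, u = t • v
  · obtain ⟨t, rfl⟩ := hu
    rw [map_smul, ha, smul_comm]
  have hli : ∀ s t : ℝ, s • u + t • v = 0 → s = 0 ∧ t = 0 := by
    intro s t hst
    have hs : s = 0 := by
      by_contra hs
      apply hu
      refine ⟨-(s⁻¹ * t), ?_⟩
      have : s⁻¹ • (s • u + t • v) = 0 := by rw [hst, smul_zero]
      rw [smul_add, smul_smul, inv_mul_cancel₀ hs, one_smul, smul_smul] at this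
      rw [neg_smul]
      exact eq_neg_of_add_eq_zero_left this
    subst hs
    simp only [zero_smul, zero_add, smul_eq_zero, hv, or_false] at hst
    exact ⟨rfl, hst⟩
  have hc : Tendsto (fun ε : ℝ => v + ε • u) (𝓝 0) (𝓝 v) := by
    have : Continuous fun ε : ℝ => v + ε • u := by fun_prop
    simpa using this.tendsto 0
  obtain ⟨δ, hδ, hb⟩ := Metric.eventually_nhds_iff.1 (hc.eventually h)
  obtain ⟨b, hb1⟩ := hb (y := δ / 2) (by
    rw [Real.dist_eq, sub_zero, abs_of_pos (by positivity)]; linarith)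
  obtain ⟨b', hb2⟩ := hb (y := δ / 4) (by
    rw [Real.dist_eq, sub_zero, abs_of_pos (by positivity)]; linarith)
  rw [map_add, map_smul, ha] at hb1 hb2
  have e1 : (δ / 4 * b' - δ / 4 * b) • u + ((b' - a) - (b - a) / 2) • v = 0 := by
    have h2 : a • v + (δ / 4) • A u - (2⁻¹ : ℝ) • (a • v + (δ / 2) • A u)
        = b' • (v + (δ / 4) • u) - (2⁻¹ : ℝ) • (b • (v + (δ / 2) • u)) := by rw [hb1, hb2]
    have h3 : a • v + (δ / 4) • A u - (2⁻¹ : ℝ) • (a • v + (δ / 2) • A u) = (a / 2) • v := by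
      module
    rw [h3] at h2
    have h4 : b' • (v + (δ / 4) • u) - (2⁻¹ : ℝ) • (b • (v + (δ / 2) • u)) - (a / 2) • v = 0 := by
      rw [← h2, sub_self]
    rw [← h4]
    module
  obtain ⟨h5, h6⟩ := hli _ _ e1
  have h7 : b' = b := by
    have : δ / 4 * (b' - b) = 0 := by linarith
    rcases mul_eq_zero.1 this with h | h
    · linarith
    · linarith
  have h8 : b = a := by subst h7; linarith
  subst h8
  have h9 : (δ / 2) • A u = (δ / 2) • (b • u) := by
    rw [smul_add, add_right_inj] at hb1
    rw [hb1, smul_comm]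
  exact smul_right_injective V (by positivity : δ / 2 ≠ 0) h9

theorem continuous_mk' : Continuous (Projectivization.mk' ℝ : {v : E n // v ≠ 0} → RP n) :=
  continuous_quotient_mk'

theorem mk'_eq_iff (v w : {v : E n // v ≠ 0}) :
    Projectivization.mk' ℝ v = Projectivization.mk' ℝ w ↔ ∃ c : ℝ, c • w.1 = v.1 :=
  Projectivization.mk_eq_mk_iff' ℝ v.1 w.1 v.2 w.2

theorem smul_mk' (A : E n ≃ₗ[ℝ] E n) (v : {v : E n // v ≠ 0}) :
    A • Projectivization.mk' ℝ v
      = Projectivization.mk' ℝ ⟨A v.1, (map_ne_zero_iff A A.injective).2 v.2⟩ := rfl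

theorem PreB.chart_pt (p : PreB n M) : p.chart p.pt = Projectivization.mk' ℝ p.2.1 :=
  p.chart.right_inv p.2.2

theorem PreB.pt_mem (p : PreB n M) : p.pt ∈ p.chart.source :=
  p.chart.map_target p.2.2

theorem continuous_pt (e : atlas (RP n) M) :
    Continuous fun w : Cone e.1 => PreB.pt (⟨e, w⟩ : PreB n M) := by
  have h : Continuous fun w : Cone e.1 => Projectivization.mk' ℝ w.1 :=
    continuous_mk'.comp continuous_subtype_val
  exact e.1.continuousOn_symm.comp_continuous h fun w => w.2

/-- A linear map of determinant `± 1` inducing the identity near a point is `± 1`. -/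
theorem eq_or_neg_of_eventually {n : ℕ} {M : Type*} [TopologicalSpace M]
    {e : OpenPartialHomeomorph M (RP n)} {m : M} (hm : m ∈ e.source)
    {A : E n ≃ₗ[ℝ] E n} (hA : |LinearMap.det (A : E n →ₗ[ℝ] E n)| = 1)
    (h : ∀ᶠ x in 𝓝 m, e x = A • e x) : ∃ c : ℝ, |c| = 1 ∧ ∀ v, A v = c • v := by
  obtain ⟨v, hv⟩ : ∃ v : {v : E n // v ≠ 0}, Projectivization.mk' ℝ v = e m :=
    ⟨⟨(e m).rep, (e m).rep_nonzero⟩, (e m).mk_rep⟩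
  have h1 : ∀ᶠ y in 𝓝 (e m), y = A • y := by
    have h2 := (e.symm.continuousAt (e.map_source hm))
    rw [ContinuousAt, e.left_inv hm] at h2
    filter_upwards [h2.eventually h, e.open_target.mem_nhds (e.map_source hm)] with y hy hy'
    rwa [e.right_inv hy'] at hy
  rw [← hv] at h1
  have h3 : ∀ᶠ w : {v : E n // v ≠ 0} in 𝓝 v, ∃ c : ℝ, A w.1 = c • w.1 := by
    filter_upwards [(continuous_mk'.tendsto v).eventually h1] with w hw
    rw [smul_mk', eq_comm, mk'_eq_iff] at hw
    obtain ⟨c, hc⟩ := hw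
    exact ⟨c, hc.symm⟩
  have h4 : ∀ᶠ w in 𝓝 v.1, ∃ c : ℝ, A w = c • w := by
    have ho : IsOpen {v : E n | v ≠ 0} := isOpen_ne
    have := ho.isOpenEmbedding_subtypeVal.map_nhds_eq v
    rw [← this]
    exact h3
  obtain ⟨c, hc⟩ := eq_smul_of_eventually (A : E n →ₗ[ℝ] E n) v.2 h4
  refine ⟨c, ?_, hc⟩
  have h5 : (A : E n →ₗ[ℝ] E n) = c • LinearMap.id := by
    ext1 w
    exact hc w
  rw [h5, LinearMap.det_smul, LinearMap.det_id, mul_one, abs_pow] at hA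
  simpa using (pow_eq_one_iff_of_nonneg (abs_nonneg c) (by simp)).1 hA

/-- Two points of the same cone with the same image in `B(M)` differ by a factor `± 2 ^ k`. -/
theorem exists_of_mk_eq {e : atlas (RP n) M} {v w : Cone e.1}
    (h : B.mk (⟨e, v⟩ : PreB n M) = B.mk ⟨e, w⟩) :
    ∃ c : ℝ, ∃ k : ℤ, |c| = 2 ^ k ∧ w.1.1 = c • v.1.1 := by
  obtain ⟨-, A, hA, h1, k, hk⟩ := Quotient.exact h
  obtain ⟨c, hc, h2⟩ := eq_or_neg_of_eventually (PreB.pt_mem ⟨e, v⟩) hA h1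
  refine ⟨2 ^ k * c, k, ?_, ?_⟩
  · rw [abs_mul, hc, mul_one, abs_of_pos (by positivity)]
  · rw [mul_smul, ← h2]
    exact hk

/-- The gluing of two cones is a restriction of a linear map near every point. -/
theorem eventually_gluing {e e' : atlas (RP n) M} {v : Cone e.1} {v' : Cone e'.1}
    (h : B.mk (⟨e, v⟩ : PreB n M) = B.mk ⟨e', v'⟩) :
    ∃ A : E n ≃ₗ[ℝ] E n, v'.1.1 = A v.1.1 ∧ ∀ᶠ w : Cone e.1 in 𝓝 v, ∃ w' : Cone e'.1,
      w'.1.1 = A w.1.1 ∧ B.mk (⟨e, w⟩ : PreB n M) = B.mk ⟨e', w'⟩ := by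
  obtain ⟨hpt, A, hA, h1, k, hk⟩ := Quotient.exact h
  have h2k : (2 : ℝ) ^ k ≠ 0 := by positivity
  refine ⟨A.trans (LinearEquiv.smulOfNeZero ℝ _ _ h2k), hk, ?_⟩
  have hs : ∀ᶠ x in 𝓝 (PreB.pt (⟨e, v⟩ : PreB n M)), x ∈ e'.1.source := by
    rw [hpt]
    exact e'.1.open_source.mem_nhds (PreB.pt_mem ⟨e', v'⟩)
  filter_upwards [((continuous_pt e).tendsto v).eventually
    (h1.eventually_nhds.and hs)] with w hw
  obtain ⟨hw1, hw2⟩ := hw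
  have hne : (2 : ℝ) ^ k • A w.1.1 ≠ 0 :=
    smul_ne_zero h2k ((map_ne_zero_iff A A.injective).2 w.1.2)
  have hline : Projectivization.mk' ℝ ⟨(2 : ℝ) ^ k • A w.1.1, hne⟩
      = e'.1 (PreB.pt (⟨e, w⟩ : PreB n M)) := by
    rw [show e'.1 (PreB.pt (⟨e, w⟩ : PreB n M)) = A • e.1 (PreB.pt (⟨e, w⟩ : PreB n M)) from hw1.self_of_nhds,
      PreB.chart_pt ⟨e, w⟩, smul_mk', mk'_eq_iff]
    exact ⟨_, rfl⟩
  refine ⟨⟨⟨_, hne⟩, ?_⟩, rfl, ?_⟩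
  · rw [hline]
    exact e'.1.map_source hw2
  · refine Quotient.sound ⟨?_, A, hA, hw1, k, rfl⟩
    change _ = e'.1.symm _
    rw [hline, e'.1.left_inv hw2]

theorem continuous_mk : Continuous (B.mk : PreB n M → B n M) := continuous_quotient_mk'

theorem continuous_coneMk (e : atlas (RP n) M) :
    Continuous fun w : Cone e.1 => B.mk (⟨e, w⟩ : PreB n M) :=
  continuous_mk.comp continuous_sigmaMk

theorem isOpenMap_coneMk (e : atlas (RP n) M) :
    IsOpenMap fun w : Cone e.1 => B.mk (⟨e, w⟩ : PreB n M) := by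
  intro U hU
  have hq : IsQuotientMap (B.mk : PreB n M → B n M) := isQuotientMap_quotient_mk'
  rw [← hq.isOpen_preimage, isOpen_sigma_iff]
  intro e'
  rw [isOpen_iff_mem_nhds]
  rintro v' ⟨v, hv, hvv'⟩
  obtain ⟨A, hA, h⟩ := eventually_gluing hvv'.symm
  have hcA : Continuous A := (A : E n →ₗ[ℝ] E n).continuous_of_finiteDimensional
  -- the vectors of `U` form an open subset of the vector space
  have hemb : IsOpenEmbedding fun w : {v : E n // v ≠ 0} => w.1 :=
    (isOpen_ne : IsOpen {v : E n | v ≠ 0}).isOpenEmbedding_subtypeVal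
  have hemb2 : IsOpenEmbedding fun w : Cone e.1 => w.1 :=
    (e.1.open_target.preimage continuous_mk').isOpenEmbedding_subtypeVal
  have hU' : IsOpen ((fun w : Cone e.1 => w.1.1) '' U) :=
    (hemb.comp hemb2).isOpenMap U hU
  have hev : ∀ᶠ w : Cone e'.1 in 𝓝 v', A w.1.1 ∈ (fun w : Cone e.1 => w.1.1) '' U := by
    have hc : Continuous fun w : Cone e'.1 => A w.1.1 :=
      hcA.comp (continuous_subtype_val.comp continuous_subtype_val)
    refine hc.continuousAt.eventually (hU'.mem_nhds ?_)
    exact ⟨v, hv, hA⟩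
  filter_upwards [h, hev] with w hw hw'
  obtain ⟨x, hx, hxw⟩ := hw
  obtain ⟨y, hy, hyw⟩ := hw'
  have : x = y := Subtype.ext (Subtype.ext (hx.trans hyw.symm))
  subst this
  exact ⟨x, hy, hxw.symm⟩

/-- The vectors of the cone of `p` which are close to the vector of `p`. -/
abbrev ConeBall (p : PreB n M) : Type :=
  {w : Cone p.chart // ‖w.1.1 - p.vec‖ < ‖p.vec‖ / 4}

instance (p : PreB n M) : Nonempty (ConeBall p) :=
  ⟨⟨p.2, by rw [sub_self, norm_zero]; have := norm_pos_iff.2 p.2.1.2; positivity⟩⟩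

/-- The inclusion of `ConeBall p` in the vector space. -/
def ballToE (p : PreB n M) (w : ConeBall p) : E n := w.1.1.1

/-- The map from `ConeBall p` to `B(M)`. -/
def ballToB (p : PreB n M) (w : ConeBall p) : B n M := B.mk ⟨p.1, w.1⟩

theorem isOpen_coneBall (p : PreB n M) :
    IsOpen {w : Cone p.chart | ‖w.1.1 - p.vec‖ < ‖p.vec‖ / 4} := by
  refine isOpen_lt ?_ continuous_const
  exact ((continuous_subtype_val.comp continuous_subtype_val).sub continuous_const).norm

theorem isOpenEmbedding_ballToE (p : PreB n M) : IsOpenEmbedding (ballToE p) := by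
  have h1 : IsOpenEmbedding fun w : {v : E n // v ≠ 0} => w.1 :=
    (isOpen_ne : IsOpen {v : E n | v ≠ 0}).isOpenEmbedding_subtypeVal
  have h2 : IsOpenEmbedding fun w : Cone p.chart => w.1 :=
    (p.chart.open_target.preimage continuous_mk').isOpenEmbedding_subtypeVal
  exact (h1.comp h2).comp (isOpen_coneBall p).isOpenEmbedding_subtypeVal

theorem eq_of_close {V : Type*} [NormedAddCommGroup V] [NormedSpace ℝ V] {p v w : V}
    (hv : ‖v - p‖ < ‖p‖ / 4) (hw : ‖w - p‖ < ‖p‖ / 4)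
    {c : ℝ} {k : ℤ} (hc : |c| = 2 ^ k) (h : w = c • v) : w = v := by
  have hp : 0 < ‖p‖ := by have := norm_nonneg (v - p); linarith
  have v1 : ‖v‖ ≤ ‖v - p‖ + ‖p‖ := by simpa using norm_add_le (v - p) p
  have v2 : ‖p‖ ≤ ‖v - p‖ + ‖v‖ := by
    have := norm_add_le (p - v) v
    rw [norm_sub_rev] at this
    simpa using this
  have w1 : ‖w‖ ≤ ‖w - p‖ + ‖p‖ := by simpa using norm_add_le (w - p) p
  have w2 : ‖p‖ ≤ ‖w - p‖ + ‖w‖ := by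
    have := norm_add_le (p - w) w
    rw [norm_sub_rev] at this
    simpa using this
  have hn : ‖w‖ = |c| * ‖v‖ := by rw [h, norm_smul, Real.norm_eq_abs]
  have hv0 : 0 < ‖v‖ := by linarith
  have h1 : |c| = 1 := by
    refine abs_two_zpow_ne hc ?_ ?_
    · by_contra hcon
      have : |c| * ‖v‖ ≤ 1 / 2 * ‖v‖ := by
        apply mul_le_mul_of_nonneg_right (not_lt.1 hcon) hv0.le
      linarith
    · by_contra hcon
      have : 2 * ‖v‖ ≤ |c| * ‖v‖ := by
        apply mul_le_mul_of_nonneg_right (not_lt.1 hcon) hv0.le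
      linarith
  rcases eq_or_eq_neg_of_abs_eq h1 with h2 | h2
  · rw [h, h2, one_smul]
  · exfalso
    have h3 : v - w = (2 : ℝ) • v := by rw [h, h2]; module
    have h4 : ‖v - w‖ = 2 * ‖v‖ := by rw [h3, norm_smul]; simp
    have h5 : ‖v - w‖ ≤ ‖v - p‖ + ‖p - w‖ := by simpa using norm_add_le (v - p) (p - w)
    rw [norm_sub_rev p w] at h5
    linarith

theorem ballToB_injective (p : PreB n M) : Function.Injective (ballToB p) := by
  intro v w h
  obtain ⟨c, k, hc, hw⟩ := exists_of_mk_eq h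
  exact (Subtype.ext (Subtype.ext (Subtype.ext (eq_of_close v.2 w.2 hc hw)))).symm

theorem isOpenEmbedding_ballToB (p : PreB n M) : IsOpenEmbedding (ballToB p) :=
  .of_continuous_injective_isOpenMap
    ((continuous_coneMk p.1).comp continuous_subtype_val) (ballToB_injective p)
    ((isOpenMap_coneMk p.1).comp (isOpen_coneBall p).isOpenMap_subtype_val)

/-- The chart of `B(M)` around the image of a point `p` of a cone: the local inverse of the
projection of the cone to `B(M)`. -/
def affineChart (p : PreB n M) : OpenPartialHomeomorph (B n M) (E n) :=
  ((isOpenEmbedding_ballToB p).toOpenPartialHomeomorph (ballToB p)).symm ≫ₕ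
    (isOpenEmbedding_ballToE p).toOpenPartialHomeomorph (ballToE p)

theorem affineChart_source (p : PreB n M) : (affineChart p).source = range (ballToB p) := by
  simp [affineChart]

theorem affineChart_ballToB (p : PreB n M) (w : ConeBall p) :
    affineChart p (ballToB p w) = w.1.1.1 := by
  have h := ((isOpenEmbedding_ballToB p).toOpenPartialHomeomorph (ballToB p)).left_inv
    (x := w) (by simp)
  rw [affineChart, OpenPartialHomeomorph.coe_trans, Function.comp_apply]
  rw [IsOpenEmbedding.toOpenPartialHomeomorph_apply] at h
  rw [h]
  rfl

instance : ChartedSpace (E n) (B n M) where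
  atlas := range affineChart
  chartAt b := affineChart (Quotient.out b)
  mem_chart_source b := by
    rw [affineChart_source]
    refine ⟨⟨(Quotient.out b).2, ?_⟩, Quotient.out_eq b⟩
    rw [sub_self, norm_zero]
    have := norm_pos_iff.2 (Quotient.out b).2.1.2
    positivity
  chart_mem_atlas b := ⟨_, rfl⟩

instance : HasGroupoid (B n M) (linearGroupoid n) where
  compatible := by
    rintro _ _ ⟨p, rfl⟩ ⟨q, rfl⟩ x hx
    rw [OpenPartialHomeomorph.trans_source] at hx
    obtain ⟨hx1, hx2⟩ := hx
    have hb := (affineChart p).map_target hx1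
    have hpx := (affineChart p).right_inv hx1
    rw [mem_preimage] at hx2
    change (affineChart p).symm x ∈ (affineChart q).source at hx2
    set b := (affineChart p).symm x with hbdef
    rw [affineChart_source] at hb hx2
    obtain ⟨v, hv⟩ := hb
    obtain ⟨v', hv'⟩ := hx2
    have hvx : v.1.1.1 = x := by rw [← hpx, ← hv, affineChart_ballToB]
    obtain ⟨A, hA, h⟩ := eventually_gluing (hv.trans hv'.symm)
    refine ⟨_, ⟨A, rfl⟩, ?_⟩
    have hcA : Continuous A := (A : E n →ₗ[ℝ] E n).continuous_of_finiteDimensional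
    have hAx : A x = v'.1.1.1 := by rw [hA, ← hvx]
    have hemb : IsOpenEmbedding fun w : Cone p.chart => w.1.1 :=
      ((isOpen_ne : IsOpen {v : E n | v ≠ 0}).isOpenEmbedding_subtypeVal).comp
        (p.chart.open_target.preimage continuous_mk').isOpenEmbedding_subtypeVal
    have h1 : ∀ᶠ y in 𝓝 x, ∃ w : Cone p.chart, w.1.1 = y ∧ ∃ w' : Cone q.chart,
        w'.1.1 = A y ∧ B.mk (⟨p.1, w⟩ : PreB n M) = B.mk ⟨q.1, w'⟩ := by
      rw [← hvx, ← hemb.map_nhds_eq v.1, eventually_map]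
      filter_upwards [h] with w hw
      exact ⟨w, rfl, hw⟩
    have h2 : ∀ᶠ y in 𝓝 x, ‖y - p.vec‖ < ‖p.vec‖ / 4 := by
      have hc : Continuous fun y : E n => ‖y - p.vec‖ := by fun_prop
      exact hc.continuousAt.eventually (gt_mem_nhds (by rw [← hvx]; exact v.2))
    have h3 : ∀ᶠ y in 𝓝 x, ‖A y - q.vec‖ < ‖q.vec‖ / 4 := by
      have hc : Continuous fun y : E n => ‖A y - q.vec‖ := (hcA.sub continuous_const).norm
      exact hc.continuousAt.eventually (gt_mem_nhds (by
        change ‖A x - q.vec‖ < _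
        rw [hAx]; exact v'.2))
    filter_upwards [h1, h2, h3, (affineChart p).open_target.mem_nhds hx1] with y hy hy2 hy3 hy4
    obtain ⟨w, rfl, w', hw', hww'⟩ := hy
    have e1 : (affineChart p).symm w.1.1 = ballToB p ⟨w, hy2⟩ := by
      have := affineChart_ballToB p ⟨w, hy2⟩
      conv_lhs => rw [← this]
      apply (affineChart p).left_inv
      rw [affineChart_source]
      exact ⟨_, rfl⟩
    have hy3' : ‖w'.1.1 - q.vec‖ < ‖q.vec‖ / 4 := by rw [hw']; exact hy3
    have e2 : ballToB p ⟨w, hy2⟩ = ballToB q ⟨w', hy3'⟩ := hww'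
    change affineChart q ((affineChart p).symm w.1.1) = A w.1.1
    rw [e1, e2, affineChart_ballToB]
    exact hw'

instance : HasGroupoid (B n M) (affineGroupoid n) :=
  hasGroupoid_of_le inferInstance (linearGroupoid_le n)

/-! #### Topological properties of the Benzécri manifold -/

theorem continuous_proj : Continuous (B.proj : B n M → M) :=
  continuous_quot_lift _ (continuous_sigma continuous_pt)

theorem mk_eq_of_eq_smul {e : atlas (RP n) M} {v w : Cone e.1} {c : ℝ} {k : ℤ}
    (hc : |c| = 2 ^ k) (h : w.1.1 = c • v.1.1) :
    B.mk (⟨e, v⟩ : PreB n M) = B.mk ⟨e, w⟩ := by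
  have h2k : (2 : ℝ) ^ k ≠ 0 := by positivity
  have hc0 : c ≠ 0 := by
    rintro rfl
    rw [abs_zero] at hc
    exact h2k hc.symm
  have hs : (c / 2 ^ k) ≠ 0 := div_ne_zero hc0 h2k
  have hline : Projectivization.mk' ℝ v.1 = Projectivization.mk' ℝ w.1 := by
    rw [eq_comm, mk'_eq_iff]
    exact ⟨c, h.symm⟩
  refine Quotient.sound ⟨?_, LinearEquiv.smulOfNeZero ℝ _ _ hs, ?_, ?_, k, ?_⟩
  · change e.1.symm _ = e.1.symm _
    rw [hline]
  · have : ((LinearEquiv.smulOfNeZero ℝ (E n) _ hs : E n ≃ₗ[ℝ] E n) : E n →ₗ[ℝ] E n)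
        = (c / 2 ^ k) • LinearMap.id := by
      ext1 w
      rfl
    rw [this, LinearMap.det_smul, LinearMap.det_id, mul_one, abs_pow, abs_div, hc,
      abs_of_pos (by positivity : (0 : ℝ) < 2 ^ k), div_self h2k, one_pow]
  · refine Eventually.of_forall fun x => ?_
    change e.1 x = _ • e.1 x
    induction e.1 x using Projectivization.ind with
    | h u hu =>
      rw [Projectivization.smul_mk, eq_comm, Projectivization.mk_eq_mk_iff']
      exact ⟨c / 2 ^ k, rfl⟩
  · change w.1.1 = (2 : ℝ) ^ k • ((c / 2 ^ k) • v.1.1)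
    rw [smul_smul, mul_div_cancel₀ _ h2k, h]

/-- The norm of a vector of a cone, up to powers of `2`. -/
def coneNorm (e : atlas (RP n) M) (w : Cone e.1) : AddCircle (1 : ℝ) :=
  ((Real.logb 2 ‖w.1.1‖ : ℝ) : AddCircle (1 : ℝ))

theorem continuous_coneNorm (e : atlas (RP n) M) : Continuous (coneNorm e) := by
  refine (AddCircle.continuous_mk' 1).comp ?_
  have h : Continuous fun w : Cone e.1 => ‖w.1.1‖ :=
    (continuous_subtype_val.comp continuous_subtype_val).norm
  exact h.logb (fun w => norm_ne_zero_iff.2 w.1.2)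

theorem coneNorm_eq {e : atlas (RP n) M} {v w : Cone e.1}
    (h : B.mk (⟨e, v⟩ : PreB n M) = B.mk ⟨e, w⟩) : coneNorm e v = coneNorm e w := by
  obtain ⟨c, k, hc, hw⟩ := exists_of_mk_eq h
  rw [coneNorm, coneNorm, hw, norm_smul, Real.norm_eq_abs, hc,
    Real.logb_mul (by positivity) (norm_ne_zero_iff.2 v.1.2), ← Real.rpow_intCast,
    Real.logb_rpow two_pos (by norm_num), AddCircle.coe_add]
  have : ((k : ℝ) : AddCircle (1 : ℝ)) = 0 := by
    rw [AddCircle.coe_eq_zero_iff]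
    exact ⟨k, by simp⟩
  rw [this, zero_add]

theorem mk_eq_of_coneNorm_eq {e : atlas (RP n) M} {v w : Cone e.1} {c : ℝ}
    (hw : w.1.1 = c • v.1.1) (h : coneNorm e v = coneNorm e w) :
    B.mk (⟨e, v⟩ : PreB n M) = B.mk ⟨e, w⟩ := by
  have hv0 := norm_pos_iff.2 v.1.2
  have hw0 := norm_pos_iff.2 w.1.2
  have hc0 : 0 < |c| := by
    rw [hw, norm_smul, Real.norm_eq_abs] at hw0
    exact pos_of_mul_pos_left hw0 hv0.le
  rw [coneNorm, coneNorm, eq_comm, ← sub_eq_zero, ← AddCircle.coe_sub,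
    AddCircle.coe_eq_zero_iff] at h
  obtain ⟨k, hk⟩ := h
  refine mk_eq_of_eq_smul (k := k) ?_ hw
  rw [hw, norm_smul, Real.norm_eq_abs, Real.logb_mul hc0.ne' hv0.ne', add_sub_cancel_right] at hk
  have : (2 : ℝ) ^ Real.logb 2 |c| = |c| := Real.rpow_logb two_pos (by norm_num) hc0
  rw [← this, ← hk]
  simp [Real.rpow_intCast]

theorem isOpenMap_B_mk : IsOpenMap (B.mk : PreB n M → B n M) :=
  isOpenMap_sigma.2 isOpenMap_coneMk

/-- Points of `B(M)` over the same point of `M` come from the same cone. -/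
theorem exists_mk_eq_of_pt_eq [HasGroupoid M (projectiveGroupoid n)] (p q : PreB n M)
    (h : p.pt = q.pt) : ∃ w : Cone p.chart, (∃ c : ℝ, w.1.1 = c • p.vec) ∧
      B.mk (⟨p.1, w⟩ : PreB n M) = B.mk q := by
  have hq : p.pt ∈ q.chart.source := by rw [h]; exact q.pt_mem
  have hg := HasGroupoid.compatible (G := projectiveGroupoid n) p.1.2 q.1.2
  obtain ⟨_, ⟨A, rfl⟩, hA⟩ := hg (p.chart p.pt) (by
    rw [OpenPartialHomeomorph.trans_source]
    refine ⟨p.chart.map_source p.pt_mem, ?_⟩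
    rw [mem_preimage]
    change p.chart.symm (p.chart p.pt) ∈ _
    rwa [p.chart.left_inv p.pt_mem])
  have hA1 : ∀ᶠ x in 𝓝 p.pt, q.chart x = A • p.chart x := by
    filter_upwards [(p.chart.continuousAt p.pt_mem).eventually hA,
      p.chart.open_source.mem_nhds p.pt_mem] with x hx hx'
    have : (p.chart.symm ≫ₕ q.chart) (p.chart x) = q.chart x := by
      rw [OpenPartialHomeomorph.coe_trans, Function.comp_apply, p.chart.left_inv hx']
    rw [← this]
    exact hx
  set d : ℝ := |LinearMap.det (A : E n →ₗ[ℝ] E n)| with hd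
  have hd0 : 0 < d := abs_pos.2 A.isUnit_det'.ne_zero
  set s : ℝ := d ^ (-(1 : ℝ) / (n + 1 : ℕ)) with hs
  have hs0 : 0 < s := Real.rpow_pos_of_pos hd0 _
  have hsd : s ^ (n + 1) * d = 1 := by
    rw [hs, ← Real.rpow_natCast, ← Real.rpow_mul hd0.le, div_mul_cancel₀ _ (by positivity),
      Real.rpow_neg hd0.le, Real.rpow_one, inv_mul_cancel₀ hd0.ne']
  set A' : E n ≃ₗ[ℝ] E n := A.trans (LinearEquiv.smulOfNeZero ℝ _ _ hs0.ne') with hA'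
  have hdet : |LinearMap.det (A' : E n →ₗ[ℝ] E n)| = 1 := by
    have : (A' : E n →ₗ[ℝ] E n) = s • (A : E n →ₗ[ℝ] E n) := by
      ext1 w
      rfl
    rw [this, LinearMap.det_smul, abs_mul, abs_pow, abs_of_pos hs0, ← hd]
    simpa using hsd
  have hA'1 : ∀ᶠ x in 𝓝 p.pt, q.chart x = A' • p.chart x := by
    filter_upwards [hA1] with x hx
    rw [hx]
    induction p.chart x using Projectivization.ind with
    | h u hu =>
      rw [Projectivization.smul_mk, Projectivization.smul_mk, eq_comm,
        Projectivization.mk_eq_mk_iff']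
      exact ⟨s, rfl⟩
  have hline : Projectivization.mk' ℝ q.2.1 = A' • Projectivization.mk' ℝ p.2.1 := by
    rw [← q.chart_pt, ← p.chart_pt, ← h]
    exact hA'1.self_of_nhds
  rw [smul_mk', mk'_eq_iff] at hline
  obtain ⟨c, hc⟩ := hline
  have hc0 : c ≠ 0 := by
    rintro rfl
    rw [zero_smul] at hc
    exact q.2.1.2 hc.symm
  have hne : c • p.vec ≠ 0 := smul_ne_zero hc0 p.2.1.2
  have hl : Projectivization.mk' ℝ (⟨c • p.vec, hne⟩ : {v : E n // v ≠ 0})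
      = Projectivization.mk' ℝ p.2.1 := by
    rw [mk'_eq_iff]
    exact ⟨c, rfl⟩
  have hpt : PreB.pt (⟨p.1, ⟨⟨c • p.vec, hne⟩, by rw [hl]; exact p.2.2⟩⟩ : PreB n M) = p.pt := by
    change p.chart.symm _ = p.chart.symm _
    rw [hl]
  refine ⟨⟨⟨c • p.vec, hne⟩, by rw [hl]; exact p.2.2⟩, ⟨c, rfl⟩, ?_⟩
  refine Quotient.sound ⟨hpt.trans h, A', hdet, ?_, 0, ?_⟩
  · rw [hpt]
    exact hA'1
  · rw [zpow_zero, one_smul]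
    change q.vec = A' (c • p.vec)
    rw [map_smul]
    exact hc.symm

instance [T2Space M] [HasGroupoid M (projectiveGroupoid n)] : T2Space (B n M) where
  t2 := by
    intro b b' hne
    obtain ⟨p, rfl⟩ := Quotient.exists_rep b
    obtain ⟨q, rfl⟩ := Quotient.exists_rep b'
    by_cases hpt : p.pt = q.pt
    · obtain ⟨w, ⟨c, hc⟩, hw⟩ := exists_mk_eq_of_pt_eq p q hpt
      change B.mk p ≠ B.mk q at hne
      rw [← hw] at hne
      obtain ⟨U, V, hU, hV, hpU, hwV, hd⟩ := t2_separation
        (show coneNorm p.1 p.2 ≠ coneNorm p.1 w from fun h => hne (mk_eq_of_coneNorm_eq hc h))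
      refine ⟨_, _, isOpenMap_coneMk p.1 _ (hU.preimage (continuous_coneNorm p.1)),
        isOpenMap_coneMk p.1 _ (hV.preimage (continuous_coneNorm p.1)),
        ⟨p.2, hpU, rfl⟩, ⟨w, hwV, hw⟩, ?_⟩
      rw [Set.disjoint_left]
      rintro _ ⟨x, hx, rfl⟩ ⟨y, hy, hxy⟩
      refine Set.disjoint_left.1 hd hx ?_
      have := coneNorm_eq hxy
      rw [mem_preimage, this] at hy
      exact hy
    · obtain ⟨U, V, hU, hV, hpU, hqV, hd⟩ := t2_separation hpt
      exact ⟨_, _, hU.preimage continuous_proj, hV.preimage continuous_proj, hpU, hqV,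
        hd.preimage _⟩

instance [CompactSpace M] [HasGroupoid M (projectiveGroupoid n)] : CompactSpace (B n M) := by
  have key : ∀ m : M, ∃ W ∈ 𝓝 m, ∃ K : Set (B n M), IsCompact K ∧ B.proj ⁻¹' W ⊆ K := by
    intro m
    let e : atlas (RP n) M := ⟨chartAt (RP n) m, chart_mem_atlas _ _⟩
    have hm : m ∈ e.1.source := mem_chart_source _ _
    obtain ⟨v, hv⟩ : ∃ v : {v : E n // v ≠ 0}, Projectivization.mk' ℝ v = e.1 m :=
      ⟨⟨(e.1 m).rep, (e.1 m).rep_nonzero⟩, (e.1 m).mk_rep⟩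
    let v' : Cone e.1 := ⟨v, by rw [hv]; exact e.1.map_source hm⟩
    have hemb : IsOpenEmbedding fun w : Cone e.1 => w.1.1 :=
      ((isOpen_ne : IsOpen {v : E n | v ≠ 0}).isOpenEmbedding_subtypeVal).comp
        (e.1.open_target.preimage continuous_mk').isOpenEmbedding_subtypeVal
    have : LocallyCompactSpace (Cone e.1) := hemb.locallyCompactSpace
    obtain ⟨N, hN, hvN⟩ := exists_compact_mem_nhds v'
    -- the points of `M` whose line meets the interior of `N`
    have hopen : IsOpen (e.1.source ∩ e.1 ⁻¹' (Projectivization.mk' ℝ ''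
        (Subtype.val '' interior N))) := by
      refine e.1.continuousOn.isOpen_inter_preimage e.1.open_source ?_
      have h1 : IsOpen (Subtype.val '' interior N : Set {v : E n // v ≠ 0}) :=
        (e.1.open_target.preimage continuous_mk').isOpenMap_subtype_val _ isOpen_interior
      have hq : IsQuotientMap (Projectivization.mk' ℝ : {v : E n // v ≠ 0} → RP n) :=
        isQuotientMap_quotient_mk'
      rw [← hq.isOpen_preimage, isOpen_iff_mem_nhds]
      rintro x ⟨y, hy, hyx⟩
      obtain ⟨c, hc⟩ := (mk'_eq_iff _ _).1 hyx
      have hc0 : c ≠ 0 := by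
        rintro rfl
        rw [zero_smul] at hc
        exact y.2 hc.symm
      have hcont : Continuous fun z : {v : E n // v ≠ 0} =>
          (⟨c • z.1, smul_ne_zero hc0 z.2⟩ : {v : E n // v ≠ 0}) :=
        Continuous.subtype_mk (continuous_subtype_val.const_smul c) _
      have hxy : (⟨c • x.1, smul_ne_zero hc0 x.2⟩ : {v : E n // v ≠ 0}) = y := Subtype.ext hc
      have hmem : (⟨c • x.1, smul_ne_zero hc0 x.2⟩ : {v : E n // v ≠ 0}) ∈
          (Subtype.val '' interior N : Set {v : E n // v ≠ 0}) := by rw [hxy]; exact hy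
      filter_upwards [hcont.continuousAt.eventually (h1.mem_nhds hmem)] with z hz
      refine ⟨_, hz, ?_⟩
      rw [mk'_eq_iff]
      exact ⟨c, rfl⟩
    refine ⟨_, hopen.mem_nhds ⟨hm, v, ⟨v', mem_interior_iff_mem_nhds.2 hvN, rfl⟩, hv⟩, ?_⟩
    -- the image of `[1, 2] • N` is compact
    let f : Icc (1 : ℝ) 2 × Cone e.1 → Cone e.1 := fun z =>
      ⟨⟨z.1.1 • z.2.1.1, smul_ne_zero (by linarith [z.1.2.1]) z.2.1.2⟩, by
        have : Projectivization.mk' ℝ (⟨z.1.1 • z.2.1.1, smul_ne_zero (by linarith [z.1.2.1])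
            z.2.1.2⟩ : {v : E n // v ≠ 0}) = Projectivization.mk' ℝ z.2.1 := by
          rw [mk'_eq_iff]
          exact ⟨z.1.1, rfl⟩
        rw [this]
        exact z.2.2⟩
    have hf : Continuous f := by
      refine Continuous.subtype_mk (Continuous.subtype_mk ?_ _) _
      exact (continuous_subtype_val.comp continuous_fst).smul
        ((continuous_subtype_val.comp continuous_subtype_val).comp continuous_snd)
    refine ⟨_, ((isCompact_univ.prod hN).image hf).image (continuous_coneMk e), ?_⟩
    intro b hb
    obtain ⟨q, rfl⟩ := Quotient.exists_rep b
    obtain ⟨hqs, _, ⟨u, hu, rfl⟩, hqu⟩ := hb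
    have hup : PreB.pt (⟨e, u⟩ : PreB n M) = q.pt := by
      change e.1.symm _ = _
      rw [hqu]
      exact e.1.left_inv hqs
    obtain ⟨w, ⟨c, hc⟩, hw⟩ := exists_mk_eq_of_pt_eq ⟨e, u⟩ q hup
    have hc0 : 0 < |c| := by
      rw [abs_pos]
      rintro rfl
      rw [zero_smul] at hc
      exact w.1.2 hc
    obtain ⟨k, hk1, hk2⟩ := exists_mem_Ico_zpow (x := |c|) (y := 2) hc0 one_lt_two
    have h2k : (0 : ℝ) < 2 ^ k := by positivity
    have ht1 : 1 ≤ |c| / 2 ^ k := by rwa [le_div_iff₀ h2k, one_mul]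
    have ht2 : |c| / 2 ^ k ≤ 2 := by
      rw [div_le_iff₀ h2k, mul_comm, ← zpow_add_one₀ two_ne_zero]
      exact hk2.le
    refine ⟨f (⟨|c| / 2 ^ k, ht1, ht2⟩, u), ⟨_, ⟨mem_univ _, interior_subset hu⟩, rfl⟩, ?_⟩
    refine Eq.trans ?_ hw
    have habs : |c / |c| * 2 ^ k| = 2 ^ k := by
      rw [abs_mul, abs_div, abs_abs, div_self hc0.ne', one_mul, abs_of_pos h2k]
    refine mk_eq_of_eq_smul (c := c / |c| * 2 ^ k) (k := k) habs ?_
    change w.1.1 = (c / |c| * 2 ^ k) • ((|c| / 2 ^ k) • u.1.1)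
    rw [smul_smul, hc]
    congr 1
    field_simp
  choose W hW K hK hWK using key
  obtain ⟨t, ht⟩ := finite_cover_nhds hW
  refine ⟨(t.finite_toSet.isCompact_biUnion fun m _ => hK m).of_isClosed_subset isClosed_univ ?_⟩
  intro b _
  have : B.proj b ∈ ⋃ x ∈ t, W x := by rw [ht]; trivial
  simp only [mem_iUnion] at this ⊢
  obtain ⟨m, hm, h⟩ := this
  exact ⟨m, hm, hWK m h⟩

end Construction

end Benzecri

end

/-!
# Automorphisms of a projective manifold and of its Benzécri manifold

Locally, an automorphism of the projective manifold `M` is represented in two charts by a linear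
automorphism of `ℝⁿ⁺¹`, unique up to a scalar (`Rep`). Compactness of `M` enters through the fact
that an automorphism close to the identity is represented, near each point, by a linear map close
to `1` (`exists_nhds_rep`).

**The trivialization.** Averaging with a partition of unity the logarithms of the norms of the
vectors in finitely many charts gives a function on the cones which is invariant under the gluings
of determinant `± 1` and increases by `τ` under the homothety of ratio `exp τ`. Modulo `log 2` it
descends to a circle coordinate on `B(M)` (`exists_circleCoord`), and together with the projection
it is a homeomorphism to `M × S¹` (`exists_homeomorph`).

**`Aut(M)` is a Lie group.** The projective structure provides a flat bundle of traceless
endomorphisms over `M`. Its parallel sections (`parallelFields`) form a space which has finite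
dimension, because a parallel section is determined by its value at one point. A small parallel
section `X` defines an automorphism, represented by `1 + X` in every chart, and every automorphism
close to the identity arises from exactly one such `X`, obtained by normalising the traces of its
representatives. In this parametrization of a neighbourhood of the identity the group operations and
the conjugations are analytic (`localParam_fieldAut`), so that left translations give a Lie group
structure (`LocalParam.isLieGroupOfDim`).

**`Aut(B(M))` is generated by lifts and homotheties.** A projective automorphism `f` lifts to `B(M)`
by its representatives of determinant `± 1`; composing with the homotheties gives a morphism
`liftHom` from `Aut(M) × ℝ` to `Aut(B(M))`. It is surjective (`exists_eq_liftHom`). Indeed an affine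
automorphism `F` is locally an affine map of the cones, and the vector sent to the origin by this
affine map is constant along the rays; as the homothety of ratio `2` acts trivially on `B(M)`, this
vector is equal to its double, hence `F` is locally linear. It follows that `F` commutes with the
homotheties, thus permutes the fibres of the projection and lies over a projective automorphism of
`M` (`projHom`). If the latter is the identity, `F` preserves all lines of the cones, hence is
locally a homothety, and its ratio is constant because `B(M)` is connected.

**Conclusion.** The morphism `projHom` is continuous, and `f ↦ liftHom (f, 1)` is a continuous
section of it, so it restricts to a surjection between the identity components. The morphism
`liftHom` is continuous, locally injective and open, the factor in `ℝ` being read off from the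
circle coordinate; it therefore extends the parametrization of `Aut(M)` to one of `Aut(B(M))` with
one more parameter (`LocalParam.extend`), and `dim Aut(B(M)) = dim Aut(M) + 1`.
-/

open Set Filter Topology Manifold
open scoped LinearAlgebra.Projectivization ContDiff

noncomputable section

namespace Benzecri

/-! ### Projective space -/

section ProjectiveSpace

variable {n : ℕ}

theorem exists_mk'_eq (a : RP n) : ∃ v : {v : E n // v ≠ 0}, Projectivization.mk' ℝ v = a :=
  ⟨⟨a.rep, a.rep_nonzero⟩, a.mk_rep⟩

theorem isOpenMap_mk' : IsOpenMap (Projectivization.mk' ℝ : {v : E n // v ≠ 0} → RP n) := by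
  intro U hU
  have hq : IsQuotientMap (Projectivization.mk' ℝ : {v : E n // v ≠ 0} → RP n) :=
    isQuotientMap_quotient_mk'
  rw [← hq.isOpen_preimage, isOpen_iff_mem_nhds]
  rintro x ⟨y, hy, hyx⟩
  obtain ⟨c, hc⟩ := (mk'_eq_iff _ _).1 hyx
  have hc0 : c ≠ 0 := by
    rintro rfl
    rw [zero_smul] at hc
    exact y.2 hc.symm
  have hcont : Continuous fun z : {v : E n // v ≠ 0} =>
      (⟨c • z.1, smul_ne_zero hc0 z.2⟩ : {v : E n // v ≠ 0}) :=
    Continuous.subtype_mk (continuous_subtype_val.const_smul c) _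
  have hxy : (⟨c • x.1, smul_ne_zero hc0 x.2⟩ : {v : E n // v ≠ 0}) = y := Subtype.ext hc
  filter_upwards [hcont.continuousAt.eventually (hU.mem_nhds (hxy ▸ hy : (⟨c • x.1, _⟩ :
    {v : E n // v ≠ 0}) ∈ U))] with z hz
  refine ⟨_, hz, ?_⟩
  rw [mk'_eq_iff]
  exact ⟨c, rfl⟩

theorem isOpenQuotientMap_mk' :
    IsOpenQuotientMap (Projectivization.mk' ℝ : {v : E n // v ≠ 0} → RP n) :=
  ⟨exists_mk'_eq, continuous_mk', isOpenMap_mk'⟩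

instance : T2Space (RP n) := by
  rw [t2Space_iff_of_isOpenQuotientMap isOpenQuotientMap_mk']
  have : {q : {v : E n // v ≠ 0} × {v : E n // v ≠ 0} |
      Projectivization.mk' ℝ q.1 = Projectivization.mk' ℝ q.2}
      = {q | ‖inner ℝ q.2.1 q.1.1‖ = ‖q.2.1‖ * ‖q.1.1‖} := by
    ext q
    rw [mem_ofPred_eq, mem_ofPred_eq, mk'_eq_iff, norm_inner_eq_norm_iff q.2.2 q.1.2]
    constructor
    · rintro ⟨c, hc⟩
      refine ⟨c, ?_, hc.symm⟩
      rintro rfl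
      rw [zero_smul] at hc
      exact q.1.2 hc.symm
    · rintro ⟨c, -, hc⟩
      exact ⟨c, hc.symm⟩
  rw [this]
  refine isClosed_eq ?_ ?_ <;> fun_prop

/-- The normed algebra of the continuous endomorphisms of a normed space. -/
abbrev Endo (V : Type*) [NormedAddCommGroup V] [NormedSpace ℝ V] : Type _ := V →L[ℝ] V

/-- A linear automorphism viewed as a continuous linear map. -/
def toEnd (A : E n ≃ₗ[ℝ] E n) : Endo (E n) :=
  LinearMap.toContinuousLinearMap (A : E n →ₗ[ℝ] E n)

@[simp] theorem toEnd_apply (A : E n ≃ₗ[ℝ] E n) (v : E n) : toEnd A v = A v := rfl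

theorem toEnd_injective : Function.Injective (toEnd : (E n ≃ₗ[ℝ] E n) → _) := by
  intro A B h
  ext1 v
  exact congrArg (fun S : Endo (E n) => S v) h

theorem continuous_linearEquiv (A : E n ≃ₗ[ℝ] E n) : Continuous A := (toEnd A).continuous

open Classical in
/-- The linear automorphism underlying an invertible endomorphism; the identity is the value at
the other endomorphisms. -/
def toEquiv (S : Endo (E n)) : E n ≃ₗ[ℝ] E n :=
  if h : IsUnit S then (ContinuousLinearEquiv.unitsEquiv ℝ (E n) h.unit).toLinearEquiv
  else LinearEquiv.refl ℝ _

theorem toEquiv_apply {S : Endo (E n)} (h : IsUnit S) (v : E n) : toEquiv S v = S v := by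
  rw [toEquiv, dif_pos h]
  rfl

theorem toEnd_toEquiv {S : Endo (E n)} (h : IsUnit S) : toEnd (toEquiv S) = S := by
  ext1 v
  exact toEquiv_apply h v

theorem isUnit_toEnd (A : E n ≃ₗ[ℝ] E n) : IsUnit (toEnd A) := by
  refine ⟨⟨toEnd A, toEnd A.symm, ?_, ?_⟩, rfl⟩ <;> ext1 v <;> simp

theorem toEquiv_toEnd (A : E n ≃ₗ[ℝ] E n) : toEquiv (toEnd A) = A :=
  toEnd_injective (toEnd_toEquiv (isUnit_toEnd A))

theorem toEquiv_one : toEquiv (1 : Endo (E n)) = 1 := by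
  ext1 v
  exact toEquiv_apply isUnit_one v

theorem eventually_isUnit {S : Endo (E n)} (h : IsUnit S) : ∀ᶠ T in 𝓝 S, IsUnit T :=
  Units.isOpen.mem_nhds h

theorem continuousAt_toEquiv_smul {S : Endo (E n)} (h : IsUnit S) (a : RP n) :
    ContinuousAt (fun p : (Endo (E n)) × RP n => toEquiv p.1 • p.2) (S, a) := by
  let U : Set (Endo (E n)) := {T | IsUnit T}
  have hU : IsOpen U := Units.isOpen
  have hq : IsOpenQuotientMap (Prod.map (id : U → U)
      (Projectivization.mk' ℝ : {v : E n // v ≠ 0} → RP n)) :=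
    IsOpenQuotientMap.id.prodMap isOpenQuotientMap_mk'
  have hc : Continuous fun p : U × RP n => toEquiv p.1.1 • p.2 := by
    rw [hq.isQuotientMap.continuous_iff]
    have : (fun p : U × RP n => toEquiv p.1.1 • p.2) ∘ (Prod.map (id : U → U)
        (Projectivization.mk' ℝ : {v : E n // v ≠ 0} → RP n)) = fun p =>
        Projectivization.mk' ℝ ⟨toEquiv p.1.1 p.2.1,
          (map_ne_zero_iff _ (toEquiv p.1.1).injective).2 p.2.2⟩ := by
      ext1 p
      rfl
    rw [this]
    refine continuous_mk'.comp (Continuous.subtype_mk ?_ _)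
    have h2 : (fun p : U × {v : E n // v ≠ 0} => toEquiv p.1.1 p.2.1)
        = fun p => p.1.1 p.2.1 := by
      ext1 p
      exact toEquiv_apply p.1.2 _
    rw [h2]
    fun_prop
  have hemb : IsOpenEmbedding (Prod.map (Subtype.val : U → _) (id : RP n → RP n)) :=
    hU.isOpenEmbedding_subtypeVal.prodMap IsOpenEmbedding.id
  exact (hemb.continuousAt_iff (x := (⟨S, h⟩, a))).1 hc.continuousAt

theorem continuous_smul_linearEquiv (A : E n ≃ₗ[ℝ] E n) : Continuous fun a : RP n => A • a := by
  refine continuous_iff_continuousAt.2 fun a => ?_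
  have h := (continuousAt_toEquiv_smul (isUnit_toEnd A) a).comp
    (f := fun b => (toEnd A, b)) (x := a) (by fun_prop)
  simpa only [Function.comp_def, toEquiv_toEnd] using h

theorem smul_eq_smul_of_eq_smul {A B : E n ≃ₗ[ℝ] E n} {c : ℝ} (h : ∀ v, B v = c • A v)
    (a : RP n) : B • a = A • a := by
  obtain ⟨v, rfl⟩ := exists_mk'_eq a
  rw [smul_mk', smul_mk', mk'_eq_iff]
  exact ⟨c, (h _).symm⟩

/-- Two linear automorphisms inducing the same projective transformation near a point are
proportional. -/
theorem eq_smul_of_smul_eventuallyEq {A B : E n ≃ₗ[ℝ] E n} {a : RP n}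
    (h : ∀ᶠ b in 𝓝 a, B • b = A • b) : ∃ c : ℝ, c ≠ 0 ∧ ∀ v, B v = c • A v := by
  obtain ⟨v, rfl⟩ := exists_mk'_eq a
  have h3 : ∀ᶠ w : {v : E n // v ≠ 0} in 𝓝 v, ∃ c : ℝ, A.symm (B w.1) = c • w.1 := by
    filter_upwards [(continuous_mk'.tendsto v).eventually h] with w hw
    rw [smul_mk', smul_mk', mk'_eq_iff] at hw
    obtain ⟨c, hc⟩ := hw
    have hc : c • A w.1 = B w.1 := hc
    exact ⟨c, by rw [← hc]; simp⟩
  have h4 : ∀ᶠ w in 𝓝 v.1, ∃ c : ℝ, A.symm (B w) = c • w := by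
    have ho : IsOpen {v : E n | v ≠ 0} := isOpen_ne
    rw [← ho.isOpenEmbedding_subtypeVal.map_nhds_eq v]
    exact h3
  obtain ⟨c, hc⟩ := eq_smul_of_eventually ((A.symm : E n →ₗ[ℝ] E n) ∘ₗ (B : E n →ₗ[ℝ] E n)) v.2 h4
  have hc' : ∀ w, B w = c • A w := fun w => by
    have := congrArg A (hc w)
    simpa using this
  refine ⟨c, ?_, hc'⟩
  rintro rfl
  have := hc' v.1
  rw [zero_smul, LinearEquiv.map_eq_zero_iff] at this
  exact v.2 this

end ProjectiveSpace

/-! ### Local representatives of maps in projective charts -/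

section Rep

variable {n : ℕ} {M : Type*} [TopologicalSpace M]

/-- Near the point `x`, the map `f` read in the charts `e` and `e'` is the projective
transformation induced by the linear automorphism `A`. For `f = id` this says that `A` induces the
change of charts at `x`. -/
def Rep (e e' : OpenPartialHomeomorph M (RP n)) (f : M → M) (x : M) (A : E n ≃ₗ[ℝ] E n) : Prop :=
  ∀ᶠ y in 𝓝 x, e' (f y) = A • e y

variable {e e' e'' : OpenPartialHomeomorph M (RP n)} {f g : M → M} {x : M} {A B : E n ≃ₗ[ℝ] E n}

theorem Rep.eventually (h : Rep e e' f x A) : ∀ᶠ y in 𝓝 x, Rep e e' f y A :=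
  eventually_eventually_nhds.2 h

theorem Rep.eq (h : Rep e e' f x A) : e' (f x) = A • e x := h.self_of_nhds

theorem Rep.id : Rep e e id x (LinearEquiv.refl ℝ (E n)) :=
  Eventually.of_forall fun y => (one_smul (E n ≃ₗ[ℝ] E n) (e y)).symm

theorem Rep.comp (hg : Rep e' e'' g (f x) B) (hf : Rep e e' f x A) (hc : ContinuousAt f x) :
    Rep e e'' (g ∘ f) x (A.trans B) := by
  filter_upwards [hf, hc.eventually hg] with y h1 h2
  rw [Function.comp_apply, h2, h1]
  exact (mul_smul B A (e y)).symm

theorem Rep.inv {f : M ≃ₜ M} (h : Rep e e' f x A) : Rep e' e f.symm (f x) A.symm := by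
  have : Tendsto f.symm (𝓝 (f x)) (𝓝 x) := by
    simpa using f.symm.continuous.tendsto (f x)
  filter_upwards [this.eventually h] with y hy
  rw [f.apply_symm_apply] at hy
  rw [hy]
  exact (inv_smul_smul A _).symm

theorem Rep.of_eq_smul {c : ℝ} (h : Rep e e' f x A) (hc : ∀ v, B v = c • A v) :
    Rep e e' f x B := by
  filter_upwards [h] with y hy
  rw [hy, smul_eq_smul_of_eq_smul hc]

theorem Rep.congr (h : Rep e e' f x A) (hfg : f =ᶠ[𝓝 x] g) : Rep e e' g x A := by
  filter_upwards [h, hfg] with y h1 h2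
  rw [← h2, h1]

/-- The linear representative of a map in charts is unique up to a scalar factor. -/
theorem Rep.unique (hx : x ∈ e.source) (hA : Rep e e' f x A) (hB : Rep e e' f x B) :
    ∃ c : ℝ, c ≠ 0 ∧ ∀ v, B v = c • A v := by
  refine eq_smul_of_smul_eventuallyEq (a := e x) ?_
  have h2 := e.symm.continuousAt (e.map_source hx)
  rw [ContinuousAt, e.left_inv hx] at h2
  filter_upwards [h2.eventually hA, h2.eventually hB,
    e.open_target.mem_nhds (e.map_source hx)] with y h3 h4 h5
  rw [e.right_inv h5] at h3 h4
  rw [← h3, ← h4]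

/-- Representatives of determinant `± 1` are unique up to sign. -/
theorem Rep.unique_of_det (hx : x ∈ e.source) (hA : Rep e e' f x A) (hB : Rep e e' f x B)
    (hdA : |LinearMap.det (A : E n →ₗ[ℝ] E n)| = 1)
    (hdB : |LinearMap.det (B : E n →ₗ[ℝ] E n)| = 1) :
    ∃ c : ℝ, |c| = 1 ∧ ∀ v, B v = c • A v := by
  obtain ⟨c, -, hc⟩ := hA.unique hx hB
  refine ⟨c, ?_, hc⟩
  have h5 : (B : E n →ₗ[ℝ] E n) = c • (A : E n →ₗ[ℝ] E n) := by
    ext1 w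
    exact hc w
  rw [h5, LinearMap.det_smul, abs_mul, hdA, mul_one, abs_pow] at hdB
  simpa using (pow_eq_one_iff_of_nonneg (abs_nonneg c) (by simp)).1 hdB

/-- A linear automorphism can be rescaled to have determinant `± 1`. -/
theorem exists_smul_det (A : E n ≃ₗ[ℝ] E n) : ∃ B : E n ≃ₗ[ℝ] E n,
    |LinearMap.det (B : E n →ₗ[ℝ] E n)| = 1 ∧
    ∀ v, B v = |LinearMap.det (A : E n →ₗ[ℝ] E n)| ^ (-(1 : ℝ) / (n + 1 : ℕ)) • A v := by
  set d : ℝ := |LinearMap.det (A : E n →ₗ[ℝ] E n)| with hd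
  have hd0 : 0 < d := abs_pos.2 A.isUnit_det'.ne_zero
  set s : ℝ := d ^ (-(1 : ℝ) / (n + 1 : ℕ)) with hs
  have hs0 : 0 < s := Real.rpow_pos_of_pos hd0 _
  have hsd : s ^ (n + 1) * d = 1 := by
    rw [hs, ← Real.rpow_natCast, ← Real.rpow_mul hd0.le, div_mul_cancel₀ _ (by positivity),
      Real.rpow_neg hd0.le, Real.rpow_one, inv_mul_cancel₀ hd0.ne']
  refine ⟨A.trans (LinearEquiv.smulOfNeZero ℝ _ _ hs0.ne'), ?_, fun v => rfl⟩
  have : ((A.trans (LinearEquiv.smulOfNeZero ℝ _ _ hs0.ne') : E n ≃ₗ[ℝ] E n) : E n →ₗ[ℝ] E n)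
      = s • (A : E n →ₗ[ℝ] E n) := by
    ext1 w
    rfl
  rw [this, LinearMap.det_smul, abs_mul, abs_pow, abs_of_pos hs0, ← hd]
  simpa using hsd

theorem Rep.exists_det (h : Rep e e' f x A) :
    ∃ B : E n ≃ₗ[ℝ] E n, |LinearMap.det (B : E n →ₗ[ℝ] E n)| = 1 ∧ Rep e e' f x B := by
  obtain ⟨B, hB, hAB⟩ := exists_smul_det A
  exact ⟨B, hB, h.of_eq_smul hAB⟩

variable [ChartedSpace (RP n) M] [HasGroupoid M (projectiveGroupoid n)]

theorem exists_rep_id (he : e ∈ atlas (RP n) M) (he' : e' ∈ atlas (RP n) M)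
    (hx : x ∈ e.source) (hx' : x ∈ e'.source) : ∃ A, Rep e e' id x A := by
  have hg := HasGroupoid.compatible (G := projectiveGroupoid n) he he'
  obtain ⟨_, ⟨A, rfl⟩, hA⟩ := hg (e x) (by
    rw [OpenPartialHomeomorph.trans_source]
    refine ⟨e.map_source hx, ?_⟩
    rw [mem_preimage]
    rwa [e.left_inv hx])
  refine ⟨A, ?_⟩
  filter_upwards [(e.continuousAt hx).eventually hA, e.open_source.mem_nhds hx] with y hy hy'
  have : (e.symm ≫ₕ e') (e y) = e' y := by
    rw [OpenPartialHomeomorph.coe_trans, Function.comp_apply, e.left_inv hy']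
  rw [id_eq, ← this]
  exact hy

variable (n M) in
/-- The group of projective automorphisms of `M`. -/
abbrev ProjAut : Subgroup (M ≃ₜ M) := autGroup (projectiveGroupoid n) M

theorem exists_rep_of_mem {f : M ≃ₜ M} (hf : f ∈ ProjAut n M) (he : e ∈ atlas (RP n) M)
    (he' : e' ∈ atlas (RP n) M) (hx : x ∈ e.source) (hx' : f x ∈ e'.source) :
    ∃ A, Rep e e' f x A := by
  obtain ⟨φ, rfl⟩ := hf
  obtain ⟨_, ⟨A, rfl⟩, hA⟩ := φ.mem_groupoid e e' he he' (e x) (by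
    rw [OpenPartialHomeomorph.trans_source]
    refine ⟨e.map_source hx, ?_⟩
    rw [mem_preimage]
    rw [e.left_inv hx, OpenPartialHomeomorph.trans_source]
    exact ⟨trivial, hx'⟩)
  refine ⟨A, ?_⟩
  filter_upwards [(e.continuousAt hx).eventually hA, e.open_source.mem_nhds hx] with y hy hy'
  have : (e.symm ≫ₕ φ.toHomeomorph.toOpenPartialHomeomorph ≫ₕ e') (e y)
      = e' (φ.toHomeomorph y) := by
    rw [OpenPartialHomeomorph.coe_trans, Function.comp_apply, e.left_inv hy']
    rfl
  rw [← this]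
  exact hy

theorem mem_projAut_of_forall {f : M ≃ₜ M} (h : ∀ x, ∃ e ∈ atlas (RP n) M, ∃ e' ∈ atlas (RP n) M,
    x ∈ e.source ∧ f x ∈ e'.source ∧ ∃ A, Rep e e' f x A) : f ∈ ProjAut n M := by
  refine ⟨⟨f, fun c c' hc hc' y hy => ?_⟩, rfl⟩
  rw [OpenPartialHomeomorph.trans_source, OpenPartialHomeomorph.trans_source] at hy
  obtain ⟨hy1, -, hy2⟩ := hy
  set x : M := c.symm y with hxy
  have hx : x ∈ c.source := c.map_target hy1
  obtain ⟨e, he, e', he', hxe, hxe', A, hA⟩ := h x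
  obtain ⟨B, hB⟩ := exists_rep_id hc he hx hxe
  obtain ⟨B', hB'⟩ := exists_rep_id he' hc' hxe' hy2
  have h1 := (hB'.comp (hA.comp (f := id) hB continuousAt_id) f.continuous.continuousAt)
  refine ⟨_, ⟨(B.trans A).trans B', rfl⟩, ?_⟩
  filter_upwards [(c.symm.continuousAt hy1).eventually h1, c.open_target.mem_nhds hy1] with z hz hz'
  rw [c.right_inv hz'] at hz
  exact hz

end Rep

/-! ### Automorphisms close to the identity -/

section Evaluation

variable {M : Type*} [TopologicalSpace M]

theorem continuous_homeo_eval [CompactSpace M] [T2Space M] :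
    Continuous fun p : (M ≃ₜ M) × M => p.1 p.2 := by
  have h : Continuous fun f : M ≃ₜ M => (f : C(M, M)) := continuous_induced_dom
  exact (continuous_eval (F := C(M, M))).comp ((h.comp continuous_fst).prodMk continuous_snd)

theorem continuous_eval_subgroup [CompactSpace M] [T2Space M] (G : Subgroup (M ≃ₜ M)) :
    Continuous fun p : G × M => p.1.1 p.2 :=
  continuous_homeo_eval.comp
    ((continuous_subtype_val.comp continuous_fst).prodMk continuous_snd)

/-- A map to a group of homeomorphisms is continuous at a point as soon as it is jointly
continuous there. -/
theorem continuousAt_subgroup_of_forall {Y : Type*} [TopologicalSpace Y] {G : Subgroup (M ≃ₜ M)}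
    {F : Y → G} {y : Y}
    (h : ∀ x, ContinuousAt (fun p : Y × M => (F p.1).1 p.2) (y, x)) : ContinuousAt F y := by
  have : IsInducing fun g : G => ((g.1 : M ≃ₜ M) : C(M, M)) :=
    (IsInducing.mk rfl : IsInducing fun f : M ≃ₜ M => (f : C(M, M))).comp IsInducing.subtypeVal
  rw [this.continuousAt_iff, ContinuousAt, ContinuousMap.tendsto_nhds_compactOpen]
  intro K hK U hU hKU
  refine hK.eventually_forall_of_forall_eventually fun x hx => ?_
  exact (h x).eventually (hU.mem_nhds (hKU hx))

end Evaluation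

section Cone

variable {n : ℕ} {M : Type*} [TopologicalSpace M]

theorem isOpenEmbedding_cone (e : OpenPartialHomeomorph M (RP n)) :
    IsOpenEmbedding fun w : Cone e => w.1.1 :=
  ((isOpen_ne : IsOpen {v : E n | v ≠ 0}).isOpenEmbedding_subtypeVal).comp
    (e.open_target.preimage continuous_mk').isOpenEmbedding_subtypeVal

variable [ChartedSpace (RP n) M]

theorem isOpenMap_pt (e : atlas (RP n) M) :
    IsOpenMap fun w : Cone e.1 => PreB.pt (⟨e, w⟩ : PreB n M) := by
  intro U hU
  have h1 : IsOpen ((fun w : Cone e.1 => Projectivization.mk' ℝ w.1) '' U) :=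
    (isOpenMap_mk'.comp (e.1.open_target.preimage continuous_mk').isOpenMap_subtype_val) U hU
  have h2 := e.1.symm.isOpen_image_of_subset_source h1 (by
    rintro _ ⟨w, -, rfl⟩
    exact w.2)
  rwa [image_image] at h2

theorem exists_pt_eq (e : atlas (RP n) M) {m : M} (hm : m ∈ e.1.source) :
    ∃ w : Cone e.1, PreB.pt (⟨e, w⟩ : PreB n M) = m := by
  obtain ⟨v, hv⟩ := exists_mk'_eq (e.1 m)
  refine ⟨⟨v, by rw [hv]; exact e.1.map_source hm⟩, ?_⟩
  change e.1.symm (Projectivization.mk' ℝ v) = m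
  rw [hv, e.1.left_inv hm]

/-- Every point of a chart domain has a connected, relatively compact neighbourhood, which is the
image of a ball of vectors. -/
theorem exists_connected_nhds (e : atlas (RP n) M) {m : M} (hm : m ∈ e.1.source) :
    ∃ W : Set M, IsOpen W ∧ m ∈ W ∧ IsPreconnected W ∧ (∃ K, IsCompact K ∧ W ⊆ K ∧ K ⊆ e.1.source) ∧
      ∃ v : Cone e.1, PreB.pt (⟨e, v⟩ : PreB n M) = m ∧
      ∀ᶠ w in 𝓝 v.1.1, ∃ w' : Cone e.1, w'.1.1 = w ∧ PreB.pt (⟨e, w'⟩ : PreB n M) ∈ W := by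
  obtain ⟨v, hv⟩ := exists_pt_eq e hm
  have hemb := isOpenEmbedding_cone e.1
  obtain ⟨r, hr, hball⟩ := Metric.nhds_basis_closedBall.mem_iff.1
    (hemb.isOpen_range.mem_nhds (mem_range_self v))
  have hball' := Metric.ball_subset_closedBall.trans hball
  have hmem : v ∈ (fun w : Cone e.1 => w.1.1) ⁻¹' Metric.ball v.1.1 r := Metric.mem_ball_self hr
  refine ⟨(fun w : Cone e.1 => PreB.pt (⟨e, w⟩ : PreB n M)) ''
    ((fun w : Cone e.1 => w.1.1) ⁻¹' Metric.ball v.1.1 r), ?_, ⟨v, hmem, hv⟩, ?_,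
    ⟨(fun w : Cone e.1 => PreB.pt (⟨e, w⟩ : PreB n M)) ''
    ((fun w : Cone e.1 => w.1.1) ⁻¹' Metric.closedBall v.1.1 r), ?_, ?_, ?_⟩, v, hv, ?_⟩
  · exact isOpenMap_pt e _ (Metric.isOpen_ball.preimage hemb.continuous)
  · refine IsPreconnected.image ?_ _ (continuous_pt e).continuousOn
    exact (convex_ball v.1.1 r).isPreconnected.preimage_of_isOpenMap hemb.injective hemb.isOpenMap
      hball'
  · refine IsCompact.image ?_ (continuous_pt e)
    exact (hemb.isInducing.isCompact_preimage_iff hball).2 (isCompact_closedBall _ _)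
  · exact image_mono (preimage_mono Metric.ball_subset_closedBall)
  · rintro _ ⟨w, -, rfl⟩
    exact PreB.pt_mem (⟨e, w⟩ : PreB n M)
  · filter_upwards [Metric.ball_mem_nhds v.1.1 hr] with w hw
    obtain ⟨w', rfl⟩ := hball' hw
    exact ⟨w', rfl, w', hw, rfl⟩

end Cone

section NearOne

variable {n : ℕ} {M : Type*} [TopologicalSpace M]

/-- The composition of a linear automorphism with a homothety. -/
def smulEquiv (c : ℝ) (hc : c ≠ 0) (A : E n ≃ₗ[ℝ] E n) : E n ≃ₗ[ℝ] E n :=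
  A.trans (LinearEquiv.smulOfNeZero ℝ _ _ hc)

@[simp] theorem smulEquiv_apply (c : ℝ) (hc : c ≠ 0) (A : E n ≃ₗ[ℝ] E n) (v : E n) :
    smulEquiv c hc A v = c • A v := rfl

theorem toEnd_smulEquiv (c : ℝ) (hc : c ≠ 0) (A : E n ≃ₗ[ℝ] E n) :
    toEnd (smulEquiv c hc A) = c • toEnd A := rfl

/-- The trace of a continuous endomorphism. -/
def tr : (Endo (E n)) →ₗ[ℝ] ℝ := LinearMap.trace ℝ (E n) ∘ₗ ContinuousLinearMap.coeLM ℝ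

theorem continuous_tr : Continuous (tr : (Endo (E n)) → ℝ) :=
  LinearMap.continuous_of_finiteDimensional tr

theorem tr_one : tr (1 : Endo (E n)) = n + 1 := by
  have : ((1 : Endo (E n)) : E n →ₗ[ℝ] E n) = 1 := rfl
  change LinearMap.trace ℝ (E n) ((1 : Endo (E n)) : E n →ₗ[ℝ] E n) = n + 1
  rw [this, LinearMap.trace_one]
  simp

theorem tr_conj (A : E n ≃ₗ[ℝ] E n) (S : Endo (E n)) :
    tr (toEnd A * S * toEnd A.symm) = tr S := by
  change LinearMap.trace ℝ (E n) ((A : E n →ₗ[ℝ] E n) * (S : E n →ₗ[ℝ] E n) *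
    (A.symm : E n →ₗ[ℝ] E n)) = LinearMap.trace ℝ (E n) (S : E n →ₗ[ℝ] E n)
  rw [LinearMap.trace_mul_comm, ← mul_assoc]
  congr 1
  ext1 v
  simp

variable {e e' : OpenPartialHomeomorph M (RP n)} {f : M → M} {m : M} {A : E n ≃ₗ[ℝ] E n}

theorem Rep.smul (h : Rep e e' f m A) {c : ℝ} (hc : c ≠ 0) : Rep e e' f m (smulEquiv c hc A) :=
  h.of_eq_smul fun _ => rfl

theorem Rep.of_isPreconnected {W : Set M} (hW : IsPreconnected W) (hWe : W ⊆ e.source)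
    (h : ∀ x ∈ W, ∃ B, Rep e e' f x B) (hm : m ∈ W) (hA : Rep e e' f m A) :
    ∀ x ∈ W, Rep e e' f x A := by
  intro x hx
  refine (hW.induction₂ (fun y z => Rep e e' f y A ↔ Rep e e' f z A) ?_
    (fun _ _ _ _ _ _ h1 h2 => h1.trans h2) (fun _ _ _ _ h1 => h1.symm) hm hx).1 hA
  intro y hy
  obtain ⟨B, hB⟩ := h y hy
  filter_upwards [mem_nhdsWithin_of_mem_nhds hB.eventually, self_mem_nhdsWithin] with z hz hz'
  constructor
  · intro h1
    obtain ⟨c, hc0, hc⟩ := hB.unique (hWe hy) h1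
    exact hz.of_eq_smul hc
  · intro h1
    obtain ⟨c, hc0, hc⟩ := hz.unique (hWe hz') h1
    exact hB.of_eq_smul hc

variable [ChartedSpace (RP n) M] [HasGroupoid M (projectiveGroupoid n)]
  [CompactSpace M] [T2Space M]

/-- An automorphism close to the identity in the compact-open topology is represented, on a fixed
connected neighbourhood of a given point, by a linear map close to the identity, normalised by its
trace. Indeed, a limit of representatives of norm `1` of automorphisms tending to the identity
preserves all lines of an open cone, hence is a homothety. -/
theorem exists_nhds_rep (e : atlas (RP n) M) (hm : m ∈ e.1.source) :
    ∃ W : Set M, IsOpen W ∧ m ∈ W ∧ IsPreconnected W ∧ W ⊆ e.1.source ∧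
      ∀ N ∈ 𝓝 (1 : Endo (E n)), ∀ᶠ f : ProjAut n M in 𝓝 1, ∃ A : E n ≃ₗ[ℝ] E n,
        toEnd A ∈ N ∧ tr (toEnd A) = n + 1 ∧ ∀ x ∈ W, Rep e.1 e.1 f.1 x A ∧ f.1 x ∈ e.1.source := by
  obtain ⟨W, hWo, hmW, hWc, ⟨K, hK, hWK, hKe⟩, v, hv, hball⟩ := exists_connected_nhds e hm
  refine ⟨W, hWo, hmW, hWc, hWK.trans hKe, fun N hN => ?_⟩
  have hgood : ∀ᶠ f : ProjAut n M in 𝓝 1, ∀ x ∈ K, f.1 x ∈ e.1.source := by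
    refine hK.eventually_forall_of_forall_eventually fun x hx => ?_
    exact (continuous_eval_subgroup (ProjAut n M)).continuousAt.eventually
      (e.1.open_source.mem_nhds (hKe hx))
  have hrep : ∀ f : ProjAut n M, (∀ x ∈ K, f.1 x ∈ e.1.source) →
      ∃ A : E n ≃ₗ[ℝ] E n, ‖toEnd A‖ = 1 ∧ ∀ x ∈ W, Rep e.1 e.1 f.1 x A := by
    intro f hf
    have h1 : ∀ x ∈ W, ∃ B, Rep e.1 e.1 f.1 x B := fun x hx =>
      exists_rep_of_mem f.2 e.2 e.2 (hKe (hWK hx)) (hf x (hWK hx))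
    obtain ⟨A, hA⟩ := h1 m hmW
    have h0 : ‖toEnd A‖ ≠ 0 := by
      rw [norm_ne_zero_iff]
      exact (isUnit_toEnd A).ne_zero
    refine ⟨smulEquiv ‖toEnd A‖⁻¹ (inv_ne_zero h0) A, ?_, fun x hx => ?_⟩
    · rw [toEnd_smulEquiv, norm_smul, norm_inv, norm_norm, inv_mul_cancel₀ h0]
    · exact (Rep.of_isPreconnected hWc (hWK.trans hKe) h1 hmW hA x hx).smul _
  choose! a ha1 ha2 using hrep
  by_contra hcon
  rw [not_eventually] at hcon
  have hne := frequently_mem_iff_neBot.1 hcon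
  set L : Filter (ProjAut n M) := 𝓝 1 ⊓ 𝓟 {f | ¬ ∃ A : E n ≃ₗ[ℝ] E n, toEnd A ∈ N ∧
      tr (toEnd A) = n + 1 ∧ ∀ x ∈ W, Rep e.1 e.1 f.1 x A ∧ f.1 x ∈ e.1.source} with hL
  have hne : L.NeBot := hne
  set U := Ultrafilter.of L with hU
  have hU1 : (U : Filter (ProjAut n M)) ≤ 𝓝 1 := (Ultrafilter.of_le L).trans inf_le_left
  have hU2 := le_principal_iff.1 ((Ultrafilter.of_le L).trans inf_le_right)
  have hlim : ∃ T ∈ Metric.sphere (0 : Endo (E n)) 1,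
      (U.map fun f => toEnd (a f) : Filter (Endo (E n))) ≤ 𝓝 T := by
    refine (isCompact_sphere _ _).ultrafilter_le_nhds _ ?_
    rw [le_principal_iff, Ultrafilter.mem_coe, Ultrafilter.mem_map]
    filter_upwards [hU1 hgood] with f hf
    rw [mem_preimage, mem_sphere_zero_iff_norm]
    exact ha1 f hf
  obtain ⟨T, hT1, hT⟩ := hlim
  replace hT : Tendsto (fun f => toEnd (a f)) U (𝓝 T) := hT
  -- the limit preserves the lines close to that of `v`
  have hTline : ∀ᶠ w in 𝓝 v.1.1, ∃ c : ℝ, (T : E n →ₗ[ℝ] E n) w = c • w := by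
    filter_upwards [hball] with w hw
    obtain ⟨w, rfl, hwW⟩ := hw
    by_cases hTw : T w.1.1 = 0
    · exact ⟨0, by rw [zero_smul]; exact hTw⟩
    have h1 : Tendsto (fun f : ProjAut n M => Projectivization.mk' ℝ
        (⟨a f w.1.1, (map_ne_zero_iff _ (a f).injective).2 w.1.2⟩ : {v : E n // v ≠ 0})) U
        (𝓝 (Projectivization.mk' ℝ ⟨T w.1.1, hTw⟩)) := by
      refine (continuous_mk'.tendsto _).comp ?_
      rw [tendsto_subtype_rng]
      exact ((ContinuousLinearMap.apply ℝ (E n) w.1.1).continuous.tendsto T).comp hT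
    have h2 : Tendsto (fun f : ProjAut n M => e.1 (f.1 (PreB.pt (⟨e, w⟩ : PreB n M)))) U
        (𝓝 (e.1 (PreB.pt (⟨e, w⟩ : PreB n M)))) := by
      have h3 : ContinuousAt
          (fun f : ProjAut n M => e.1 (f.1 (PreB.pt (⟨e, w⟩ : PreB n M)))) 1 := by
        refine ContinuousAt.comp (g := e.1) ?_ ?_
        · exact e.1.continuousAt (hKe (hWK hwW))
        · exact ((continuous_eval_subgroup (ProjAut n M)).comp
            (continuous_id.prodMk continuous_const)).continuousAt
      exact h3.tendsto.mono_left hU1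
    have h4 := tendsto_nhds_unique_of_eventuallyEq h1 h2 (by
      filter_upwards [hU1 hgood] with f hf
      rw [(ha2 f hf _ hwW).eq, PreB.chart_pt (⟨e, w⟩ : PreB n M), smul_mk'])
    rw [PreB.chart_pt (⟨e, w⟩ : PreB n M), mk'_eq_iff] at h4
    obtain ⟨c, hc⟩ := h4
    exact ⟨c, hc.symm⟩
  obtain ⟨c, hc⟩ := eq_smul_of_eventually _ v.1.2 hTline
  have hTc : T = c • 1 := by
    ext1 w
    exact hc w
  have hc0 : c ≠ 0 := by
    rintro rfl
    simp [hTc] at hT1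
  have hn : (n : ℝ) + 1 ≠ 0 := by positivity
  have htr : tr T = c * (n + 1) := by rw [hTc, map_smul, tr_one, smul_eq_mul]
  have h5 : Tendsto (fun f => tr (toEnd (a f))) U (𝓝 (tr T)) :=
    (continuous_tr.tendsto T).comp hT
  have htr0 : tr T ≠ 0 := by rw [htr]; exact mul_ne_zero hc0 hn
  have h6 : Tendsto (fun f => (((n : ℝ) + 1) / tr (toEnd (a f))) • toEnd (a f)) U
      (𝓝 (1 : Endo (E n))) := by
    have h7 := ((tendsto_const_nhds (x := (n : ℝ) + 1)).div h5 htr0).smul hT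
    have h8 : (((n : ℝ) + 1) / tr T) • T = 1 := by
      rw [htr, hTc, smul_smul]
      convert one_smul ℝ _
      field_simp
    rwa [h8] at h7
  have h9 : ∀ᶠ f in (U : Filter (ProjAut n M)), ∀ x ∈ K, f.1 x ∈ e.1.source := hU1 hgood
  obtain ⟨f, ⟨hf1, hf2, hf3⟩, hf4⟩ := ((h9.and ((h5.eventually_ne htr0).and
    (h6.eventually hN))).and hU2).exists
  refine hf4 ⟨smulEquiv _ (div_ne_zero hn hf2) (a f), hf3, ?_, fun x hx =>
    ⟨(ha2 f hf1 x hx).smul _, hf1 x (hWK hx)⟩⟩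
  rw [toEnd_smulEquiv, map_smul, smul_eq_mul, div_mul_cancel₀ _ hf2]

end NearOne

/-! ### Lie groups from local parametrizations -/

section LieGroup

/-- `b : V → G` is a local parametrization of the topological group `G` near `1`, in which the
multiplication, the inversion and the conjugations of `G` are analytic near `0`. -/
structure LocalParam {G V : Type*} [Group G] [TopologicalSpace G] [NormedAddCommGroup V]
    [NormedSpace ℝ V] (b : V → G) : Prop where
  zero : b 0 = 1
  cont : ∀ᶠ x in 𝓝 0, ContinuousAt b x
  inj : ∃ N ∈ 𝓝 0, InjOn b N
  nhds : ∀ N ∈ 𝓝 0, b '' N ∈ 𝓝 1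
  mul : ∃ μ : V × V → V, ContDiffAt ℝ ω μ 0 ∧ μ 0 = 0 ∧ ∀ᶠ p in 𝓝 0, b p.1 * b p.2 = b (μ p)
  inv : ∃ ι : V → V, ContDiffAt ℝ ω ι 0 ∧ ι 0 = 0 ∧ ∀ᶠ x in 𝓝 0, (b x)⁻¹ = b (ι x)
  conj : ∀ g : G, ∃ c : V → V, ContDiffAt ℝ ω c 0 ∧ c 0 = 0 ∧
    ∀ᶠ x in 𝓝 0, g * b x * g⁻¹ = b (c x)

variable {G V : Type*} [Group G] [TopologicalSpace G] [NormedAddCommGroup V] [NormedSpace ℝ V]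
  {b : V → G}

theorem LocalParam.comp_equiv {W : Type*} [NormedAddCommGroup W] [NormedSpace ℝ W]
    (h : LocalParam b) (L : W ≃L[ℝ] V) : LocalParam (b ∘ L) where
  zero := by simp [h.zero]
  cont := by
    have : Tendsto L (𝓝 0) (𝓝 0) := by simpa using L.continuous.tendsto 0
    filter_upwards [this.eventually h.cont] with x hx
    exact hx.comp L.continuous.continuousAt
  inj := by
    obtain ⟨N, hN, hi⟩ := h.inj
    have : Tendsto L (𝓝 0) (𝓝 0) := by simpa using L.continuous.tendsto 0
    exact ⟨L ⁻¹' N, this hN, hi.comp L.injective.injOn (mapsTo_preimage _ _)⟩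
  nhds := by
    intro N hN
    rw [image_comp]
    refine h.nhds _ ?_
    rw [L.image_eq_preimage_symm]
    have : Tendsto L.symm (𝓝 0) (𝓝 0) := by simpa using L.symm.continuous.tendsto 0
    exact this hN
  mul := by
    obtain ⟨μ, h1, h2, h3⟩ := h.mul
    have hL : ContDiffAt ℝ ω (Prod.map L L) 0 :=
      (L.contDiff.prodMap L.contDiff).contDiffAt
    have hL0 : Prod.map L L 0 = 0 := by ext <;> simp
    refine ⟨L.symm ∘ μ ∘ Prod.map L L, L.symm.contDiff.contDiffAt.comp _ ?_, by
      simp [hL0, h2], ?_⟩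
    · exact ContDiffAt.comp _ (by rwa [hL0]) hL
    · have := hL.continuousAt.tendsto
      rw [hL0] at this
      filter_upwards [this.eventually h3] with p hp
      simpa using hp
  inv := by
    obtain ⟨ι, h1, h2, h3⟩ := h.inv
    have : Tendsto L (𝓝 0) (𝓝 0) := by simpa using L.continuous.tendsto 0
    refine ⟨L.symm ∘ ι ∘ L, L.symm.contDiff.contDiffAt.comp _ (ContDiffAt.comp _ (by simpa using h1)
      L.contDiff.contDiffAt), by simp [h2], ?_⟩
    filter_upwards [this.eventually h3] with p hp
    simpa using hp
  conj := by
    intro g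
    obtain ⟨ι, h1, h2, h3⟩ := h.conj g
    have : Tendsto L (𝓝 0) (𝓝 0) := by simpa using L.continuous.tendsto 0
    refine ⟨L.symm ∘ ι ∘ L, L.symm.contDiff.contDiffAt.comp _ (ContDiffAt.comp _ (by simpa using h1)
      L.contDiff.contDiffAt), by simp [h2], ?_⟩
    filter_upwards [this.eventually h3] with p hp
    simpa using hp

/-- A local parametrization is the inverse of a chart. -/
theorem LocalParam.exists_chart [T2Space G] [FiniteDimensional ℝ V] (h : LocalParam b) :
    ∃ φ : OpenPartialHomeomorph G V, 1 ∈ φ.source ∧ φ 1 = 0 ∧ ∀ x, φ.symm x = b x := by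
  obtain ⟨N, hN, hinj⟩ := h.inj
  obtain ⟨r, hr, hD⟩ := Metric.nhds_basis_closedBall.mem_iff.1 (inter_mem hN h.cont)
  have : ProperSpace V := FiniteDimensional.proper_real V
  set D := Metric.closedBall (0 : V) r with hDdef
  have hDc : IsCompact D := isCompact_closedBall _ _
  have hbD : ContinuousOn b D := fun x hx => (hD hx).2.continuousWithinAt
  have hiD : InjOn b D := hinj.mono fun x hx => (hD hx).1
  have h0D : (0 : V) ∈ D := Metric.mem_closedBall_self hr.le
  have hS : IsClosed (b '' Metric.sphere 0 r) :=
    ((isCompact_sphere (0 : V) r).image_of_continuousOn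
      (hbD.mono Metric.sphere_subset_closedBall)).isClosed
  set U : Set G := interior (b '' D) ∩ (b '' Metric.sphere 0 r)ᶜ with hU
  have hUo : IsOpen U := isOpen_interior.inter hS.isOpen_compl
  have hUb : ∀ g ∈ U, ∃ x ∈ Metric.ball (0 : V) r, b x = g := by
    rintro g ⟨hg1, hg2⟩
    obtain ⟨x, hx, rfl⟩ := interior_subset hg1
    refine ⟨x, ?_, rfl⟩
    rcases (Metric.mem_closedBall.1 hx).lt_or_eq with hlt | heq
    · exact hlt
    · exact absurd ⟨x, heq, rfl⟩ hg2
  set a : G → V := Function.invFunOn b D with ha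
  have hab : ∀ x ∈ D, a (b x) = x := fun x hx => hiD.leftInvOn_invFunOn hx
  have h1U : (1 : G) ∈ U := by
    refine ⟨mem_interior_iff_mem_nhds.2 (h.nhds _ (Metric.closedBall_mem_nhds _ hr)), ?_⟩
    rintro ⟨x, hx, hx1⟩
    have : x = 0 := hiD (Metric.sphere_subset_closedBall hx) h0D (hx1.trans h.zero.symm)
    rw [this, mem_sphere_zero_iff_norm, norm_zero] at hx
    exact hr.ne hx
  let φ : OpenPartialHomeomorph G V :=
    { toFun := a
      invFun := b
      source := U
      target := Metric.ball 0 r ∩ b ⁻¹' U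
      map_source' := by
        intro g hg
        obtain ⟨x, hx, rfl⟩ := hUb g hg
        rw [hab x (Metric.ball_subset_closedBall hx)]
        exact ⟨hx, hg⟩
      map_target' := fun x hx => hx.2
      left_inv' := by
        intro g hg
        obtain ⟨x, hx, rfl⟩ := hUb g hg
        rw [hab x (Metric.ball_subset_closedBall hx)]
      right_inv' := fun x hx => hab x (Metric.ball_subset_closedBall hx.1)
      open_source := hUo
      open_target := (hbD.mono Metric.ball_subset_closedBall).isOpen_inter_preimage
        Metric.isOpen_ball hUo
      continuousOn_toFun := by
        rw [continuousOn_iff_isClosed]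
        intro t ht
        refine ⟨b '' (D ∩ t), ((hDc.inter_right ht).image_of_continuousOn
          (hbD.mono inter_subset_left)).isClosed, ?_⟩
        ext g
        constructor
        · rintro ⟨hg1, hg2⟩
          obtain ⟨x, hx, rfl⟩ := hUb g hg2
          have hx' := Metric.ball_subset_closedBall hx
          rw [mem_preimage, hab x hx'] at hg1
          exact ⟨⟨x, ⟨hx', hg1⟩, rfl⟩, hg2⟩
        · rintro ⟨⟨x, ⟨hx1, hx2⟩, rfl⟩, hg2⟩
          refine ⟨?_, hg2⟩
          rw [mem_preimage, hab x hx1]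
          exact hx2
      continuousOn_invFun := hbD.mono fun x hx => Metric.ball_subset_closedBall hx.1 }
  refine ⟨φ, h1U, ?_, fun x => rfl⟩
  have := hab 0 h0D
  rwa [h.zero] at this

/-- A topological group with a local parametrization is a Lie group: the charts are the left
translates of the local one. -/
theorem LocalParam.exists_lieGroup [IsTopologicalGroup G] [T2Space G] [FiniteDimensional ℝ V]
    (h : LocalParam b) : ∃ _ : ChartedSpace V G, LieGroup 𝓘(ℝ, V) ∞ G := by
  obtain ⟨φ, h1, hφ1, hb⟩ := h.exists_chart
  have h0 : (0 : V) ∈ φ.target := hφ1 ▸ φ.map_source h1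
  have hφb : ∀ x ∈ φ.target, φ (b x) = x := fun x hx => by rw [← hb, φ.right_inv hx]
  have hbφ : ∀ g ∈ φ.source, b (φ g) = g := fun g hg => by rw [← hb, φ.left_inv hg]
  have hφc : ContinuousAt φ 1 := φ.continuousAt h1
  have hbc : ∀ x ∈ φ.target, ContinuousAt b x := fun x hx => by
    have := φ.symm.continuousAt hx
    rwa [show (φ.symm : V → G) = b from funext hb] at this
  -- analytic functions which read in the chart as operations of the group
  obtain ⟨μ, hμ1, hμ2, hμ3⟩ := h.mul
  let m : V × V → V := fun p => φ (b p.1 * b p.2)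
  have hm : ContDiffAt ℝ ω m 0 := by
    refine hμ1.congr_of_eventuallyEq ?_
    have : Tendsto μ (𝓝 0) (𝓝 0) := by simpa [ContinuousAt, hμ2] using hμ1.continuousAt
    filter_upwards [hμ3, this.eventually (φ.open_target.mem_nhds h0)] with p hp hp'
    change φ _ = _
    rw [hp, hφb _ hp']
  have hm' := hm.eventually (by decide)
  rw [show (0 : V × V) = (0, 0) from rfl, nhds_prod_eq, eventually_prod_self_iff'] at hm'
  obtain ⟨Q, hQ, hmQ⟩ := hm'
  set S' : Set G := φ.source ∩ φ ⁻¹' (interior Q) with hS'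
  have hS'o : IsOpen S' := φ.isOpen_inter_preimage isOpen_interior
  have h1S' : (1 : G) ∈ S' := ⟨h1, by rw [mem_preimage, hφ1]; exact mem_interior_iff_mem_nhds.2 hQ⟩
  set S : Set G := S' ∩ S'⁻¹ with hS
  have hSo : IsOpen S := hS'o.inter hS'o.inv
  have h1S : (1 : G) ∈ S := ⟨h1S', by rw [Set.mem_inv, inv_one]; exact h1S'⟩
  have hSm : ∀ u ∈ S', ∀ w ∈ S', ContDiffAt ℝ ω m (φ u, φ w) := fun u hu w hw =>
    hmQ _ (interior_subset hu.2) _ (interior_subset hw.2)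
  let χ : G → OpenPartialHomeomorph G V := fun g =>
    (Homeomorph.mulLeft g⁻¹).toOpenPartialHomeomorph ≫ₕ φ.restr S
  have hχ : ∀ g x, χ g x = φ (g⁻¹ * x) := fun g x => rfl
  have hχs : ∀ g x, (χ g).symm x = g * b x := fun g x => by
    rw [← hb]
    change (g⁻¹)⁻¹ * φ.symm x = _
    rw [inv_inv]
  have hχsrc : ∀ g x, x ∈ (χ g).source ↔ g⁻¹ * x ∈ S := by
    intro g x
    rw [OpenPartialHomeomorph.trans_source, φ.restr_source' S hSo]
    constructor
    · rintro ⟨-, hx⟩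
      exact hx.2
    · intro hx
      exact ⟨trivial, hx.1.1, hx⟩
  have hχtgt : ∀ g x, x ∈ (χ g).target → x ∈ φ.target ∧ b x ∈ S := by
    intro g x hx
    have h2 := (χ g).map_target hx
    rw [hχsrc, hχs, inv_mul_cancel_left] at h2
    refine ⟨?_, h2⟩
    have h3 := (χ g).right_inv hx
    rw [hχ, hχs, inv_mul_cancel_left] at h3
    rw [← h3]
    exact φ.map_source h2.1.1
  let cs : ChartedSpace V G :=
    { atlas := range χ
      chartAt := χ
      mem_chart_source := fun g => by rw [hχsrc, inv_mul_cancel]; exact h1S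
      chart_mem_atlas := fun g => mem_range_self g }
  have hchart : ∀ g : G, chartAt V g = χ g := fun g => rfl
  have hman : IsManifold 𝓘(ℝ, V) ∞ G := by
    refine isManifold_of_contDiffOn _ _ _ ?_
    rintro _ _ ⟨g, rfl⟩ ⟨k, rfl⟩
    intro x0 hx0
    simp only [modelWithCornersSelf_coe, modelWithCornersSelf_coe_symm, range_id, inter_univ,
      preimage_id] at hx0
    rw [OpenPartialHomeomorph.trans_source] at hx0
    obtain ⟨hx1, hx2⟩ := hx0
    rw [mem_preimage, hχsrc, hχs] at hx2
    obtain ⟨hx3, hx4⟩ := hχtgt g x0 hx1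
    refine ContDiffAt.contDiffWithinAt ?_
    set u0 := b x0 with hu0
    have hu0' : u0⁻¹ ∈ S' := hx4.2
    have hx0φ : φ u0 = x0 := hφb _ hx3
    set w := k⁻¹ * (g * u0) with hw
    have e1 : m (φ u0⁻¹, x0) = 0 := by
      change φ (b (φ u0⁻¹) * b x0) = 0
      rw [hbφ _ hu0'.1, ← hu0, inv_mul_cancel, hφ1]
    have c1 : ContDiffAt ℝ ω (fun x => m (φ u0⁻¹, x)) x0 := by
      have := hSm _ hu0' _ hx4.1
      rw [hx0φ] at this
      exact this.comp x0 (contDiffAt_const.prodMk contDiffAt_id)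
    have c2 : ContDiffAt ℝ ω (fun x => m (φ w, m (φ u0⁻¹, x))) x0 := by
      have := hSm _ hx2.1 _ h1S'
      rw [hφ1, ← e1] at this
      exact this.comp x0 (f := fun x => (φ w, m (φ u0⁻¹, x))) (contDiffAt_const.prodMk c1)
    refine (c2.of_le le_top).congr_of_eventuallyEq ?_
    have hcb : ContinuousAt (fun x => u0⁻¹ * b x) x0 := continuousAt_const.mul (hbc _ hx3)
    have : (fun x => u0⁻¹ * b x) x0 ∈ φ.source := by
      change u0⁻¹ * u0 ∈ _
      rw [inv_mul_cancel]
      exact h1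
    filter_upwards [hcb.eventually (φ.open_source.mem_nhds this)] with x hx
    change χ k ((χ g).symm x) = φ (b (φ w) * b (φ (b (φ u0⁻¹) * b x)))
    rw [hχ, hχs, hbφ _ hu0'.1, hbφ _ hx, hbφ _ hx2.1.1, hw]
    congr 1
    group
  have hχ0 : ∀ g, χ g g = 0 := fun g => by rw [hχ, inv_mul_cancel, hφ1]
  have hb0 : Tendsto b (𝓝 0) (𝓝 1) := by
    have := hbc 0 h0
    rwa [ContinuousAt, h.zero] at this
  have hmul : ContMDiff (𝓘(ℝ, V).prod 𝓘(ℝ, V)) 𝓘(ℝ, V) ∞ fun p : G × G => p.1 * p.2 := by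
    rintro ⟨g, k⟩
    rw [contMDiffAt_iff]
    refine ⟨continuous_mul.continuousAt, ContDiffAt.contDiffWithinAt ?_⟩
    simp only [mfld_simps, hchart, hχ0]
    obtain ⟨c, hc1, hc2, hc3⟩ := h.conj k⁻¹
    have c1 : ContDiffAt ℝ ω (fun p : V × V => m (c p.1, p.2)) (0, 0) := by
      refine ContDiffAt.comp (g := m) (f := fun p : V × V => (c p.1, p.2)) _ ?_ ?_
      · change ContDiffAt ℝ ω m (c 0, 0)
        rw [hc2]
        exact hm
      · exact (hc1.comp (0, 0) (f := Prod.fst) contDiffAt_fst).prodMk contDiffAt_snd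
    refine (c1.of_le le_top).congr_of_eventuallyEq ?_
    have : Tendsto (Prod.fst : V × V → V) (𝓝 (0, 0)) (𝓝 0) := continuous_fst.tendsto (0, 0)
    filter_upwards [this.eventually hc3] with p hp
    change χ (g * k) ((χ g).symm p.1 * (χ k).symm p.2) = φ (b (c p.1) * b p.2)
    rw [← hp, hχ, hχs, hχs]
    congr 1
    group
  have hinv : ContMDiff 𝓘(ℝ, V) 𝓘(ℝ, V) ∞ fun g : G => g⁻¹ := by
    intro g
    rw [contMDiffAt_iff]
    refine ⟨continuous_inv.continuousAt, ContDiffAt.contDiffWithinAt ?_⟩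
    simp only [mfld_simps, hchart, hχ0]
    obtain ⟨c, hc1, hc2, hc3⟩ := h.conj g
    obtain ⟨ι, hι1, hι2, hι3⟩ := h.inv
    have c1 : ContDiffAt ℝ ω (c ∘ ι) 0 := ContDiffAt.comp _ (by rwa [hι2]) hι1
    refine (c1.of_le le_top).congr_of_eventuallyEq ?_
    have t1 : Tendsto ι (𝓝 0) (𝓝 0) := by simpa [ContinuousAt, hι2] using hι1.continuousAt
    have t2 : Tendsto (c ∘ ι) (𝓝 0) (𝓝 0) := by simpa [ContinuousAt, hι2, hc2] using c1.continuousAt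
    filter_upwards [hι3, t1.eventually hc3, t2.eventually (φ.open_target.mem_nhds h0)]
      with x hx hx1 hx2
    change χ g⁻¹ ((χ g).symm x)⁻¹ = c (ι x)
    have hx3 : φ (b (c (ι x))) = c (ι x) := hφb _ hx2
    rw [hχ, hχs, ← hx3, ← hx1, ← hx]
    congr 1
    group
  have hM : ContMDiffMul 𝓘(ℝ, V) ∞ G := { toIsManifold := hman, contMDiff_mul := hmul }
  exact ⟨cs, { toContMDiffMul := hM, contMDiff_inv := hinv }⟩

theorem LocalParam.isLieGroupOfDim [IsTopologicalGroup G] [T2Space G] [FiniteDimensional ℝ V]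
    (h : LocalParam b) : IsLieGroupOfDim G (Module.finrank ℝ V) := by
  have L : EuclideanSpace ℝ (Fin (Module.finrank ℝ V)) ≃L[ℝ] V :=
    ContinuousLinearEquiv.ofFinrankEq (by simp)
  exact (h.comp_equiv L).exists_lieGroup

/-- If `b` is a local parametrization of `G` and `j : G × ℝ → H` is a surjective morphism which is a
local homeomorphism, then `j` extends `b` to a local parametrization of `H`. -/
theorem LocalParam.extend {H : Type*} [Group H] [TopologicalSpace H] (h : LocalParam b)
    (j : G × Multiplicative ℝ →* H) (hc : Continuous j) (hs : Function.Surjective j)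
    (hi : ∃ N ∈ 𝓝 (1 : G × Multiplicative ℝ), InjOn j N)
    (ho : ∀ N ∈ 𝓝 (1 : G × Multiplicative ℝ), j '' N ∈ 𝓝 1) :
    LocalParam fun x : V × ℝ => j (b x.1, Multiplicative.ofAdd x.2) := by
  have hbc : Tendsto b (𝓝 0) (𝓝 1) := by
    have := h.cont.self_of_nhds
    rwa [ContinuousAt, h.zero] at this
  have t1 : Tendsto (Prod.fst : V × ℝ → V) (𝓝 0) (𝓝 0) := continuous_fst.tendsto 0
  have t2 : Tendsto (fun x : V × ℝ => (b x.1, Multiplicative.ofAdd x.2)) (𝓝 0) (𝓝 1) := by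
    refine Tendsto.prodMk_nhds (hbc.comp t1) ?_
    exact (continuous_ofAdd.comp continuous_snd).tendsto (0 : V × ℝ)
  refine ⟨?_, ?_, ?_, ?_, ?_, ?_, ?_⟩
  · simp only [Prod.fst_zero, h.zero, Prod.snd_zero, ofAdd_zero]
    exact map_one j
  · filter_upwards [t1.eventually h.cont] with x hx
    refine hc.continuousAt.comp (f := fun x : V × ℝ => (b x.1, Multiplicative.ofAdd x.2)) ?_
    exact (hx.comp (f := Prod.fst) continuousAt_fst).prodMk
      (continuous_ofAdd.comp continuous_snd).continuousAt
  · obtain ⟨N, hN, hNi⟩ := hi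
    obtain ⟨N', hN', hNi'⟩ := h.inj
    refine ⟨_, inter_mem (t2 hN) (t1 hN'), ?_⟩
    intro x hx y hy hxy
    have := Prod.ext_iff.1 (hNi hx.1 hy.1 hxy)
    exact Prod.ext (hNi' hx.2 hy.2 this.1) (Multiplicative.ofAdd.injective this.2)
  · intro N hN
    rw [show (0 : V × ℝ) = (0, 0) from rfl, nhds_prod_eq, mem_prod_iff] at hN
    obtain ⟨N1, hN1, N2, hN2, hN⟩ := hN
    have : (b '' N1) ×ˢ (Multiplicative.toAdd ⁻¹' N2) ∈ 𝓝 (1 : G × Multiplicative ℝ) :=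
      prod_mem_nhds (h.nhds _ hN1) ((continuous_toAdd.tendsto (1 : Multiplicative ℝ)) hN2)
    filter_upwards [ho _ this]
    rintro _ ⟨⟨_, t⟩, ⟨⟨x, hx, rfl⟩, ht⟩, rfl⟩
    exact ⟨(x, Multiplicative.toAdd t), hN ⟨hx, ht⟩, rfl⟩
  · obtain ⟨μ, h1, h2, h3⟩ := h.mul
    let q : (V × ℝ) × (V × ℝ) → V × V := fun p => (p.1.1, p.2.1)
    have hq : ContDiffAt ℝ ω q 0 := by
      refine ContDiff.contDiffAt ?_
      fun_prop
    refine ⟨fun p => (μ (q p), p.1.2 + p.2.2), ?_, ?_, ?_⟩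
    · refine (ContDiffAt.comp (0 : (V × ℝ) × (V × ℝ)) (g := μ) (f := q) h1 hq).prodMk ?_
      refine ContDiff.contDiffAt ?_
      fun_prop
    · exact Prod.ext h2 (add_zero _)
    · filter_upwards [(hq.continuousAt.tendsto : Tendsto q (𝓝 0) (𝓝 0)).eventually h3] with p hp
      rw [← map_mul, Prod.mk_mul_mk, ← ofAdd_add, hp]
  · obtain ⟨ι, h1, h2, h3⟩ := h.inv
    refine ⟨fun x => (ι x.1, - x.2), ?_, ?_, ?_⟩
    · refine (ContDiffAt.comp (0 : V × ℝ) (g := ι) (f := Prod.fst) h1 contDiffAt_fst).prodMk ?_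
      exact contDiffAt_snd.neg
    · exact Prod.ext h2 neg_zero
    · filter_upwards [t1.eventually h3] with p hp
      rw [← map_inv, Prod.inv_mk, ← ofAdd_neg, hp]
  · intro k
    obtain ⟨⟨g, t⟩, rfl⟩ := hs k
    obtain ⟨c, h1, h2, h3⟩ := h.conj g
    refine ⟨fun x => (c x.1, x.2), ?_, ?_, ?_⟩
    · exact (ContDiffAt.comp (0 : V × ℝ) (g := c) (f := Prod.fst) h1 contDiffAt_fst).prodMk
        contDiffAt_snd
    · exact Prod.ext h2 rfl
    · filter_upwards [t1.eventually h3] with p hp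
      rw [← map_inv, ← map_mul, ← map_mul, Prod.inv_mk, Prod.mk_mul_mk, Prod.mk_mul_mk, hp,
        mul_inv_cancel_comm]

end LieGroup

/-! ### Lifting maps of the base to the Benzécri manifold -/

section LiftRel

variable {n : ℕ} {M : Type*} [TopologicalSpace M] [ChartedSpace (RP n) M]

/-- The points `p` and `q` of two cones correspond to each other under the lift of the map `f` to
`B(M)`, composed with the homothety of ratio `exp τ`. -/
def LiftRel (f : M → M) (τ : ℝ) (p q : PreB n M) : Prop :=
  q.pt = f p.pt ∧ ∃ A : E n ≃ₗ[ℝ] E n, |LinearMap.det (A : E n →ₗ[ℝ] E n)| = 1 ∧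
    Rep p.chart q.chart f p.pt A ∧ ∃ t : ℝ, |t| = Real.exp τ ∧ q.vec = t • A p.vec

variable {p q r : PreB n M}

theorem det_trans (A B : E n ≃ₗ[ℝ] E n) (hA : |LinearMap.det (A : E n →ₗ[ℝ] E n)| = 1)
    (hB : |LinearMap.det (B : E n →ₗ[ℝ] E n)| = 1) :
    |LinearMap.det ((A.trans B : E n ≃ₗ[ℝ] E n) : E n →ₗ[ℝ] E n)| = 1 := by
  rw [LinearEquiv.coe_trans, LinearMap.det_comp, abs_mul, hA, hB, one_mul]

theorem det_symm (A : E n ≃ₗ[ℝ] E n) (hA : |LinearMap.det (A : E n →ₗ[ℝ] E n)| = 1) :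
    |LinearMap.det (A.symm : E n →ₗ[ℝ] E n)| = 1 := by
  have : LinearMap.det (A : E n →ₗ[ℝ] E n) * LinearMap.det (A.symm : E n →ₗ[ℝ] E n) = 1 := by
    rw [← LinearMap.det_comp]; simp
  have h2 := congrArg abs this
  rw [abs_mul, hA] at h2
  simpa using h2

theorem LiftRel.comp {f g : M → M} {τ σ : ℝ} (hg : LiftRel g σ q r) (hf : LiftRel f τ p q)
    (hc : ContinuousAt f p.pt) : LiftRel (g ∘ f) (σ + τ) p r := by
  obtain ⟨h1, A, hA, hR, t, ht, hv⟩ := hf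
  obtain ⟨h1', A', hA', hR', t', ht', hv'⟩ := hg
  rw [h1] at h1' hR'
  refine ⟨h1', A.trans A', det_trans _ _ hA hA', hR'.comp hR hc, t' * t, ?_, ?_⟩
  · rw [abs_mul, ht, ht', Real.exp_add]
  · rw [hv', hv, map_smul, smul_smul]
    rfl

theorem LiftRel.symm {f : M ≃ₜ M} {τ : ℝ} (h : LiftRel f τ p q) : LiftRel f.symm (-τ) q p := by
  obtain ⟨h1, A, hA, hR, t, ht, hv⟩ := h
  have ht0 : t ≠ 0 := by
    rintro rfl
    rw [abs_zero] at ht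
    exact (Real.exp_pos τ).ne ht
  refine ⟨by rw [h1, f.symm_apply_apply], A.symm, det_symm A hA, ?_, t⁻¹, ?_, ?_⟩
  · rw [h1]
    exact hR.inv
  · rw [abs_inv, ht, Real.exp_neg]
  · rw [hv, map_smul, smul_smul, inv_mul_cancel₀ ht0, one_smul, A.symm_apply_apply]

theorem exp_mul_log_two (k : ℤ) : Real.exp (k * Real.log 2) = 2 ^ k := by
  rw [mul_comm, Real.exp_mul, Real.exp_log two_pos, Real.rpow_intCast]

theorem mk_eq_iff : B.mk p = B.mk q ↔ ∃ k : ℤ, LiftRel id (k * Real.log 2) p q := by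
  constructor
  · intro h
    obtain ⟨h1, A, hA, hR, k, hk⟩ := Quotient.exact h
    exact ⟨k, h1.symm, A, hA, hR, 2 ^ k, by rw [abs_of_pos (by positivity), exp_mul_log_two], hk⟩
  · rintro ⟨k, h1, A, hA, hR, t, ht, hv⟩
    have h2k : (2 : ℝ) ^ k ≠ 0 := by positivity
    rw [exp_mul_log_two] at ht
    have ht0 : t ≠ 0 := by
      rintro rfl
      rw [abs_zero] at ht
      exact h2k ht.symm
    refine Quotient.sound ⟨h1.symm, smulEquiv (t / 2 ^ k) (div_ne_zero ht0 h2k) A, ?_,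
      hR.smul _, k, ?_⟩
    · have : (smulEquiv (t / 2 ^ k) (div_ne_zero ht0 h2k) A : E n →ₗ[ℝ] E n)
          = (t / 2 ^ k) • (A : E n →ₗ[ℝ] E n) := rfl
      rw [this, LinearMap.det_smul, abs_mul, hA, abs_pow, abs_div, ht,
        abs_of_pos (by positivity : (0 : ℝ) < 2 ^ k), div_self h2k, one_pow, one_mul]
    · rw [smulEquiv_apply, smul_smul, mul_div_cancel₀ _ h2k, hv]

variable [HasGroupoid M (projectiveGroupoid n)]

theorem exists_liftRel {f : M ≃ₜ M} (hf : f ∈ ProjAut n M) (h : q.pt = f p.pt) :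
    ∃ τ, LiftRel f τ p q := by
  obtain ⟨A, hA⟩ := exists_rep_of_mem hf p.1.2 q.1.2 p.pt_mem (h ▸ q.pt_mem)
  obtain ⟨B, hB, hBR⟩ := hA.exists_det
  have h1 := hBR.eq
  rw [← h, q.chart_pt, p.chart_pt, smul_mk', mk'_eq_iff] at h1
  obtain ⟨c, hc⟩ := h1
  have hc0 : c ≠ 0 := by
    rintro rfl
    rw [zero_smul] at hc
    exact q.2.1.2 hc.symm
  exact ⟨Real.log |c|, h, B, hB, hBR, c, (Real.exp_log (abs_pos.2 hc0)).symm, hc.symm⟩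

end LiftRel

/-! ### The trivialization of the Benzécri manifold -/

section Trivialization

variable {n : ℕ} {M : Type*} [TopologicalSpace M] [ChartedSpace (RP n) M]

open Classical in
/-- The logarithm of the norm of the vector of `p`, carried to the chart `e` by a linear map of
determinant `± 1` which induces the change of charts. -/
def chartLogNorm (e : atlas (RP n) M) (p : PreB n M) : ℝ :=
  if h : ∃ A : E n ≃ₗ[ℝ] E n, |LinearMap.det (A : E n →ₗ[ℝ] E n)| = 1 ∧
    Rep p.chart e.1 id p.pt A then Real.log ‖h.choose p.vec‖ else 0

theorem chartLogNorm_eq {e : atlas (RP n) M} {p : PreB n M} {A : E n ≃ₗ[ℝ] E n}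
    (hA : |LinearMap.det (A : E n →ₗ[ℝ] E n)| = 1) (hR : Rep p.chart e.1 id p.pt A) :
    chartLogNorm e p = Real.log ‖A p.vec‖ := by
  have h : ∃ A : E n ≃ₗ[ℝ] E n, |LinearMap.det (A : E n →ₗ[ℝ] E n)| = 1 ∧
    Rep p.chart e.1 id p.pt A := ⟨A, hA, hR⟩
  rw [chartLogNorm, dif_pos h]
  obtain ⟨c, hc1, hc⟩ := hR.unique_of_det p.pt_mem h.choose_spec.2 hA h.choose_spec.1
  rw [hc, norm_smul, Real.norm_eq_abs, hc1, one_mul]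

variable [HasGroupoid M (projectiveGroupoid n)]

theorem chartLogNorm_liftRel {e : atlas (RP n) M} {p q : PreB n M} {τ : ℝ}
    (h : LiftRel id τ p q) (hp : p.pt ∈ e.1.source) :
    chartLogNorm e q = chartLogNorm e p + τ := by
  obtain ⟨h1, A, hA, hR, t, ht, hv⟩ := h
  have h1 : q.pt = p.pt := h1
  have hq : q.pt ∈ e.1.source := by rwa [h1]
  obtain ⟨A', hA'⟩ := exists_rep_id q.1.2 e.2 q.pt_mem hq
  obtain ⟨B, hB, hBR⟩ := hA'.exists_det
  have h2 : Rep p.chart e.1 id p.pt (A.trans B) :=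
    Rep.comp (f := id) (g := id) (by rw [id_eq, ← h1]; exact hBR) hR continuousAt_id
  rw [chartLogNorm_eq hB hBR, chartLogNorm_eq (det_trans _ _ hA hB) h2, hv, map_smul, norm_smul,
    Real.norm_eq_abs, ht, Real.log_mul (Real.exp_pos _).ne', Real.log_exp, add_comm]
  · rfl
  · rw [norm_ne_zero_iff, map_ne_zero_iff _ B.injective, map_ne_zero_iff _ A.injective]
    exact p.2.1.2

theorem continuousAt_chartLogNorm {e e' : atlas (RP n) M} {w : Cone e.1}
    (h : PreB.pt (⟨e, w⟩ : PreB n M) ∈ e'.1.source) :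
    ContinuousAt (fun w : Cone e.1 => chartLogNorm e' (⟨e, w⟩ : PreB n M)) w := by
  obtain ⟨A, hA⟩ := exists_rep_id e.2 e'.2 (PreB.pt_mem (⟨e, w⟩ : PreB n M)) h
  obtain ⟨B, hB, hBR⟩ := hA.exists_det
  have h1 : ContinuousAt (fun w : Cone e.1 => Real.log ‖B w.1.1‖) w := by
    refine ContinuousAt.log ?_ ?_
    · exact ((continuous_linearEquiv B).comp
        (isOpenEmbedding_cone e.1).continuous).norm.continuousAt
    · rw [norm_ne_zero_iff, map_ne_zero_iff _ B.injective]
      exact w.1.2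
  refine h1.congr ?_
  filter_upwards [((continuous_pt e).tendsto w).eventually hBR.eventually] with z hz
  rw [chartLogNorm_eq hB hz]

variable [CompactSpace M] [T2Space M]

variable (n M) in
/-- A continuous function on the cones which is invariant under the linear gluings and is
compatible with the homotheties. It is an average of the logarithms of the norms in finitely many
charts, with weights given by a partition of unity. -/
theorem exists_logNorm : ∃ ν : PreB n M → ℝ,
    Continuous ν ∧ ∀ p q τ, LiftRel id τ p q → ν q = ν p + τ := by
  obtain ⟨t, ht⟩ := finite_cover_nhds fun m : M => chart_source_mem_nhds (RP n) m
  let c : t → atlas (RP n) M := fun i => ⟨chartAt (RP n) i.1, chart_mem_atlas _ _⟩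
  obtain ⟨ρ, hρ⟩ := PartitionOfUnity.exists_isSubordinate (isClosed_univ (X := M))
    (fun i : t => (c i).1.source) (fun i => (c i).1.open_source) (by
      intro x _
      have : x ∈ ⋃ m ∈ t, (chartAt (RP n) m).source := by rw [ht]; trivial
      simp only [mem_iUnion] at this ⊢
      obtain ⟨m, hm, hx⟩ := this
      exact ⟨⟨m, hm⟩, hx⟩)
  refine ⟨fun p => ∑ i, ρ i p.pt * chartLogNorm (c i) p, ?_, ?_⟩
  · refine continuous_sigma fun e => continuous_iff_continuousAt.2 fun w => ?_
    refine tendsto_finsetSum _ fun i _ => ?_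
    have hρc : Continuous fun w : Cone e.1 => ρ i (PreB.pt (⟨e, w⟩ : PreB n M)) :=
      (ρ i).continuous.comp (continuous_pt e)
    by_cases h : PreB.pt (⟨e, w⟩ : PreB n M) ∈ tsupport (ρ i)
    · exact hρc.continuousAt.mul (continuousAt_chartLogNorm (hρ i h))
    · have h1 : ∀ᶠ w' : Cone e.1 in 𝓝 w, ρ i (PreB.pt (⟨e, w'⟩ : PreB n M)) = 0 := by
        filter_upwards [(continuous_pt e).continuousAt.eventually
          ((isClosed_tsupport (ρ i)).isOpen_compl.mem_nhds h)] with z hz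
        exact image_eq_zero_of_notMem_tsupport hz
      refine (continuousAt_const (y := (0 : ℝ))).congr ?_
      filter_upwards [h1] with z hz
      rw [hz, zero_mul]
  · intro p q τ h
    have hpq : q.pt = p.pt := h.1
    have hsum : ∑ i, ρ i p.pt = 1 := by
      rw [← finsum_eq_sum_of_fintype]
      exact ρ.sum_eq_one (mem_univ _)
    have : ∀ i, ρ i q.pt * chartLogNorm (c i) q
        = ρ i p.pt * chartLogNorm (c i) p + ρ i p.pt * τ := by
      intro i
      rw [hpq]
      by_cases hi : p.pt ∈ (c i).1.source
      · rw [chartLogNorm_liftRel h hi, mul_add]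
      · rw [image_eq_zero_of_notMem_tsupport (fun h => hi (hρ i h))]
        simp
    simp only [this]
    rw [Finset.sum_add_distrib, ← Finset.sum_mul, hsum, one_mul]

variable (n M) in
/-- The circle coordinate of the trivialization of `B(M)`. -/
theorem exists_circleCoord : ∃ ψ : B n M → Circle, Continuous ψ ∧
    ∀ p q τ, LiftRel id τ p q →
      ψ (B.mk q) = ψ (B.mk p) * Circle.exp (2 * Real.pi * (τ / Real.log 2)) := by
  obtain ⟨ν, hν, hνr⟩ := exists_logNorm n M
  have hl : Real.log 2 ≠ 0 := (Real.log_pos one_lt_two).ne'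
  let ψ : B n M → Circle := Quotient.lift
    (fun p => Circle.exp (2 * Real.pi * (ν p / Real.log 2))) (by
      intro p q h
      obtain ⟨k, hk⟩ := mk_eq_iff.1 (Quotient.sound h : B.mk p = B.mk q)
      rw [hνr _ _ _ hk, add_div, mul_div_cancel_right₀ _ hl, mul_add, Circle.exp_add,
        mul_comm (2 * Real.pi) (k : ℝ), Circle.exp_int_mul_two_pi, mul_one])
  refine ⟨ψ, ?_, fun p q τ h => ?_⟩
  · refine continuous_quot_lift _ ?_
    exact Circle.exp.continuous.comp (by fun_prop)
  · change Circle.exp _ = Circle.exp _ * _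
    rw [hνr _ _ _ h, add_div, mul_add, Circle.exp_add]

/-- The Benzécri manifold is homeomorphic to `M × S¹` over `M`. -/
theorem exists_homeomorph {ψ : B n M → Circle} (hψ : Continuous ψ)
    (h : ∀ p q τ, LiftRel id τ p q →
      ψ (B.mk q) = ψ (B.mk p) * Circle.exp (2 * Real.pi * (τ / Real.log 2))) :
    ∃ Φ : B n M ≃ₜ M × Circle, ∀ b, Φ b = (b.proj, ψ b) := by
  have hl : Real.log 2 ≠ 0 := (Real.log_pos one_lt_two).ne'
  have hpi : (2 * Real.pi) ≠ 0 := by positivity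
  have hinj : Function.Injective fun b : B n M => (b.proj, ψ b) := by
    intro b b' hb
    obtain ⟨p, rfl⟩ := Quotient.exists_rep b
    obtain ⟨q, rfl⟩ := Quotient.exists_rep b'
    obtain ⟨h1, h2⟩ := Prod.ext_iff.1 hb
    obtain ⟨τ, hτ⟩ := exists_liftRel (p := p) (q := q) (one_mem (ProjAut n M)) h1.symm
    have h3 := h p q τ hτ
    rw [show ψ (B.mk q) = ψ (B.mk p) from h2.symm, left_eq_mul, Circle.exp_eq_one] at h3
    obtain ⟨k, hk⟩ := h3
    refine mk_eq_iff.2 ⟨k, ?_⟩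
    have h4 : τ / Real.log 2 = k := by
      rw [mul_comm (k : ℝ)] at hk
      exact mul_left_cancel₀ hpi hk
    rw [div_eq_iff hl] at h4
    rw [← h4]
    exact hτ
  have hsurj : Function.Surjective fun b : B n M => (b.proj, ψ b) := by
    rintro ⟨m, z⟩
    let e : atlas (RP n) M := ⟨chartAt (RP n) m, chart_mem_atlas _ _⟩
    obtain ⟨w, hw⟩ := exists_pt_eq e (mem_chart_source (RP n) m : m ∈ e.1.source)
    set p : PreB n M := ⟨e, w⟩ with hp
    obtain ⟨θ, hθ⟩ : ∃ θ, Circle.exp θ = z / ψ (B.mk p) := ⟨_, Circle.exp_arg _⟩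
    set τ : ℝ := θ / (2 * Real.pi) * Real.log 2 with hτ
    have hne : Real.exp τ • p.vec ≠ 0 := smul_ne_zero (Real.exp_pos τ).ne' p.2.1.2
    have hline : Projectivization.mk' ℝ (⟨Real.exp τ • p.vec, hne⟩ : {v : E n // v ≠ 0})
        = Projectivization.mk' ℝ p.2.1 := by
      rw [mk'_eq_iff]
      exact ⟨_, rfl⟩
    let q : PreB n M := ⟨e, ⟨_, hne⟩, by rw [hline]; exact p.2.2⟩
    have hqp : q.pt = p.pt := by
      change e.1.symm _ = e.1.symm _
      rw [hline]
    have hpq : LiftRel id τ p q := ⟨hqp, LinearEquiv.refl ℝ _, by simp, Rep.id, Real.exp τ,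
      abs_of_pos (Real.exp_pos τ), rfl⟩
    refine ⟨B.mk q, Prod.ext (hqp.trans hw) ?_⟩
    change ψ (B.mk q) = z
    rw [h p q τ hpq, hτ, mul_div_cancel_right₀ _ hl, mul_div_cancel₀ _ hpi, hθ, mul_div_cancel]
  have hcont : Continuous (Equiv.ofBijective (fun b : B n M => (b.proj, ψ b)) ⟨hinj, hsurj⟩) :=
    continuous_proj.prodMk hψ
  exact ⟨hcont.homeoOfEquivCompactToT2, fun b => rfl⟩

end Trivialization

/-! ### Parallel fields of endomorphisms -/

section LocMap

variable {n : ℕ} {M : Type*} [TopologicalSpace M]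

/-- A map whose germ at `x` is a projective transformation in charts is a local homeomorphism. -/
theorem Rep.map_nhds {e e' : OpenPartialHomeomorph M (RP n)} {f : M → M} {x : M}
    {A : E n ≃ₗ[ℝ] E n} (h : Rep e e' f x A) (hx : x ∈ e.source) (hx' : f x ∈ e'.source)
    (hc : ContinuousAt f x) : map f (𝓝 x) = 𝓝 (f x) := by
  have h1 : f =ᶠ[𝓝 x] fun y => e'.symm (A • e y) := by
    filter_upwards [h, hc.eventually (e'.open_source.mem_nhds hx')] with y hy hy'
    rw [← hy, e'.left_inv hy']
  let α : RP n ≃ₜ RP n :=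
    { toEquiv := MulAction.toPerm A
      continuous_toFun := continuous_smul_linearEquiv A
      continuous_invFun := continuous_smul_linearEquiv A⁻¹ }
  have h2 : (fun y => e'.symm (A • e y)) = e'.symm ∘ α ∘ e := rfl
  rw [map_congr h1, h2, ← map_map, ← map_map, e.map_nhds_eq hx, α.map_nhds_eq]
  change map e'.symm (𝓝 (A • e x)) = _
  rw [← h.eq, e'.symm.map_nhds_eq (e'.map_source hx'), e'.left_inv hx']

/-- The action of an endomorphism on the points of the domain of a chart. -/
def locMap (e : OpenPartialHomeomorph M (RP n)) (S : Endo (E n)) (x : M) : M :=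
  e.symm (toEquiv S • e x)

variable {e e' : OpenPartialHomeomorph M (RP n)} {m : M} {S : Endo (E n)} {x : M}

theorem continuousAt_locMap (hS : IsUnit S) (hx : x ∈ e.source)
    (ht : toEquiv S • e x ∈ e.target) :
    ContinuousAt (fun p : (Endo (E n)) × M => locMap e p.1 p.2) (S, x) := by
  refine ContinuousAt.comp (g := e.symm) (e.symm.continuousAt ht) ?_
  refine ContinuousAt.comp (x := ((S, x) : (Endo (E n)) × M))
    (f := fun p : (Endo (E n)) × M => (p.1, e p.2)) (continuousAt_toEquiv_smul hS (e x)) ?_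
  exact continuousAt_fst.prodMk
    (ContinuousAt.comp (f := Prod.snd) (e.continuousAt hx) continuousAt_snd)

theorem locMap_one (hx : x ∈ e.source) : locMap e 1 x = x := by
  rw [locMap, toEquiv_one, one_smul, e.left_inv hx]

theorem eventually_locMap (hm : m ∈ e.source) :
    ∀ᶠ p : (Endo (E n)) × M in 𝓝 (1, m),
      IsUnit p.1 ∧ p.2 ∈ e.source ∧ toEquiv p.1 • e p.2 ∈ e.target := by
  have h1 : Tendsto (fun p : (Endo (E n)) × M => p.2) (𝓝 (1, m)) (𝓝 m) :=
    continuous_snd.tendsto (1, m)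
  have h2 : Tendsto (fun p : (Endo (E n)) × M => p.1) (𝓝 (1, m)) (𝓝 1) :=
    continuous_fst.tendsto (1, m)
  have h3 : ContinuousAt (fun p : (Endo (E n)) × M => toEquiv p.1 • e p.2) (1, m) := by
    refine ContinuousAt.comp (x := ((1, m) : (Endo (E n)) × M))
      (f := fun p : (Endo (E n)) × M => (p.1, e p.2))
      (continuousAt_toEquiv_smul isUnit_one (e m)) ?_
    exact continuousAt_fst.prodMk
      (ContinuousAt.comp (f := Prod.snd) (e.continuousAt hm) continuousAt_snd)
  have h4 : toEquiv (1 : Endo (E n)) • e m ∈ e.target := by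
    rw [toEquiv_one, one_smul]
    exact e.map_source hm
  filter_upwards [h1.eventually (e.open_source.mem_nhds hm),
    h2.eventually (eventually_isUnit isUnit_one),
    h3.eventually (e.open_target.mem_nhds h4)] with p hp1 hp2 hp3
  exact ⟨hp2, hp1, hp3⟩

theorem tendsto_locMap (hm : m ∈ e.source) :
    Tendsto (fun p : (Endo (E n)) × M => locMap e p.1 p.2) (𝓝 (1, m)) (𝓝 m) := by
  obtain ⟨h1, h2, h3⟩ := (eventually_locMap hm).self_of_nhds
  have := continuousAt_locMap h1 h2 h3
  rwa [ContinuousAt, locMap_one hm] at this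

theorem toEquiv_conj (hS : IsUnit S) (A : E n ≃ₗ[ℝ] E n) :
    toEquiv (toEnd A * S * toEnd A.symm) = (A.symm.trans (toEquiv S)).trans A := by
  have h : IsUnit (toEnd A * S * toEnd A.symm) :=
    ((isUnit_toEnd A).mul hS).mul (isUnit_toEnd A.symm)
  ext1 v
  rw [toEquiv_apply h, LinearEquiv.trans_apply, LinearEquiv.trans_apply, toEquiv_apply hS]
  rfl

/-- The action of endomorphisms close to `1` is compatible with the changes of charts. -/
theorem eventually_locMap_eq (hm : m ∈ e.source) (hm' : m ∈ e'.source) {A : E n ≃ₗ[ℝ] E n}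
    (hA : Rep e e' id m A) : ∀ᶠ p : (Endo (E n)) × M in 𝓝 (1, m),
      locMap e p.1 p.2 = locMap e' (toEnd A * p.1 * toEnd A.symm) p.2 := by
  have h1 : Tendsto (fun p : (Endo (E n)) × M => p.2) (𝓝 (1, m)) (𝓝 m) :=
    continuous_snd.tendsto (1, m)
  filter_upwards [eventually_locMap hm, (tendsto_locMap hm).eventually hA, h1.eventually hA,
    (tendsto_locMap hm).eventually (e'.open_source.mem_nhds hm')]
  rintro ⟨S, x⟩ ⟨hS, hx, ht⟩ h2 h3 h4
  have h5 : e (locMap e S x) = toEquiv S • e x := e.right_inv ht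
  simp only [id_eq] at h2 h3
  have h6 : ((A.symm.trans (toEquiv S)).trans A) • e' x = A • toEquiv S • A.symm • e' x := by
    rw [← mul_smul, ← mul_smul]
    rfl
  rw [h5] at h2
  conv_rhs => rw [locMap, toEquiv_conj hS, h6, h3,
    show A.symm • A • e x = e x from inv_smul_smul A _, ← h2, e'.left_inv h4]

end LocMap

section Parallel

variable (n : ℕ) (M : Type*) [TopologicalSpace M] [ChartedSpace (RP n) M]

/-- The pairs of a chart and of a point of its domain. -/
abbrev ChartPt : Type _ := {j : atlas (RP n) M × M // j.2 ∈ j.1.1.source}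

variable {n M}

/-- The point `x` in the domain of the chart `e`. -/
abbrev chartPt (e : atlas (RP n) M) {x : M} (hx : x ∈ e.1.source) : ChartPt n M := ⟨(e, x), hx⟩

variable (n M) in
/-- The parallel sections of the flat bundle of traceless endomorphisms of a projective manifold.
A section is given by its values in all charts: they correspond to each other under the changes of
charts, and they are locally constant in each chart. -/
def parallelFields : Submodule ℝ (ChartPt n M → Endo (E n)) where
  carrier := {X | (∀ j, tr (X j) = 0) ∧
    (∀ (e e' : atlas (RP n) M) (x : M) (hx : x ∈ e.1.source) (hx' : x ∈ e'.1.source)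
      (A : E n ≃ₗ[ℝ] E n), Rep e.1 e'.1 id x A →
      toEnd A * X (chartPt e hx) = X (chartPt e' hx') * toEnd A) ∧
    ∀ (e : atlas (RP n) M) (x : M) (hx : x ∈ e.1.source), ∀ᶠ y in 𝓝 x, ∀ hy : y ∈ e.1.source,
      X (chartPt e hy) = X (chartPt e hx)}
  zero_mem' := ⟨fun j => map_zero tr, by simp, by simp⟩
  add_mem' := by
    rintro X Y ⟨h1, h2, h3⟩ ⟨h1', h2', h3'⟩
    refine ⟨fun j => ?_, fun e e' x hx hx' A hA => ?_, fun e x hx => ?_⟩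
    · rw [Pi.add_apply, map_add, h1, h1', add_zero]
    · rw [Pi.add_apply, Pi.add_apply, mul_add, add_mul, h2 _ _ _ _ _ _ hA, h2' _ _ _ _ _ _ hA]
    · filter_upwards [h3 e x hx, h3' e x hx] with y hy hy' hys
      rw [Pi.add_apply, Pi.add_apply, hy, hy']
  smul_mem' := by
    rintro c X ⟨h1, h2, h3⟩
    refine ⟨fun j => ?_, fun e e' x hx hx' A hA => ?_, fun e x hx => ?_⟩
    · rw [Pi.smul_apply, map_smul, h1, smul_zero]
    · rw [Pi.smul_apply, Pi.smul_apply, mul_smul_comm, smul_mul_assoc, h2 _ _ _ _ _ _ hA]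
    · filter_upwards [h3 e x hx] with y hy hys
      rw [Pi.smul_apply, Pi.smul_apply, hy]

variable {X : ChartPt n M → Endo (E n)}

theorem parallelFields_const (hX : X ∈ parallelFields n M) {e : atlas (RP n) M} {W : Set M}
    (hW : IsPreconnected W) (hWe : W ⊆ e.1.source) {x y : M} (hx : x ∈ W) (hy : y ∈ W) :
    X (chartPt e (hWe hx)) = X (chartPt e (hWe hy)) := by
  refine hW.induction₂ (fun x y => ∀ (hx : x ∈ e.1.source) (hy : y ∈ e.1.source),
    X (chartPt e hx) = X (chartPt e hy)) ?_ ?_ ?_ hx hy (hWe hx) (hWe hy)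
  · intro x hx
    filter_upwards [mem_nhdsWithin_of_mem_nhds (hX.2.2 e x (hWe hx))] with z hz hx' hz'
    exact (hz hz').symm
  · intro x y z hx hy hz h1 h2 hx' hz'
    exact (h1 hx' (hWe hy)).trans (h2 (hWe hy) hz')
  · intro x y hx hy h1 hx' hy'
    exact (h1 hy' hx').symm

/-- The value of a parallel field in another chart. -/
theorem parallelFields_conj (hX : X ∈ parallelFields n M) {e e' : atlas (RP n) M} {x : M}
    (hx : x ∈ e.1.source) (hx' : x ∈ e'.1.source) {A : E n ≃ₗ[ℝ] E n} (hA : Rep e.1 e'.1 id x A) :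
    toEnd A * X (chartPt e hx) * toEnd A.symm = X (chartPt e' hx') := by
  rw [hX.2.1 e e' x hx hx' A hA, mul_assoc]
  have : toEnd A * toEnd A.symm = 1 := by ext1 v; simp
  rw [this, mul_one]

variable [HasGroupoid M (projectiveGroupoid n)]

/-- On a connected manifold, a parallel field which vanishes at a point is zero. -/
theorem parallelFields_eq_zero [ConnectedSpace M] (hX : X ∈ parallelFields n M) {j : ChartPt n M}
    (hj : X j = 0) : X = 0 := by
  have h0 : ∀ (e e' : atlas (RP n) M) (x : M) (hx : x ∈ e.1.source) (hx' : x ∈ e'.1.source),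
      X (chartPt e hx) = 0 → X (chartPt e' hx') = 0 := by
    intro e e' x hx hx' h
    obtain ⟨A, hA⟩ := exists_rep_id e.2 e'.2 hx hx'
    rw [← parallelFields_conj hX hx hx' hA, h, mul_zero, zero_mul]
  have key : ∀ x y : M, (∀ (e : atlas (RP n) M) (hx : x ∈ e.1.source), X (chartPt e hx) = 0) →
      ∀ (e : atlas (RP n) M) (hy : y ∈ e.1.source), X (chartPt e hy) = 0 := by
    intro x y
    refine (isPreconnected_univ.induction₂ (fun x y =>
      (∀ (e : atlas (RP n) M) (hx : x ∈ e.1.source), X (chartPt e hx) = 0) ↔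
      ∀ (e : atlas (RP n) M) (hy : y ∈ e.1.source), X (chartPt e hy) = 0) ?_ ?_ ?_
      (mem_univ x) (mem_univ y)).1
    · intro x _
      let e : atlas (RP n) M := ⟨chartAt (RP n) x, chart_mem_atlas _ _⟩
      have hx : x ∈ e.1.source := mem_chart_source _ _
      filter_upwards [mem_nhdsWithin_of_mem_nhds (hX.2.2 e x hx),
        mem_nhdsWithin_of_mem_nhds (e.1.open_source.mem_nhds hx)] with z hz hz'
      constructor
      · intro h e' hz''
        exact h0 e e' z hz' hz'' ((hz hz').trans (h e hx))
      · intro h e' hx''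
        exact h0 e e' x hx hx'' ((hz hz').symm.trans (h e hz'))
    · exact fun _ _ _ _ _ _ h1 h2 => h1.trans h2
    · exact fun _ _ _ _ h1 => h1.symm
  funext k
  exact key j.1.2 k.1.2 (fun e hx => h0 j.1.1 e j.1.2 j.2 hx hj) k.1.1 k.2

/-- The space of the values of the parallel fields at a given point. -/
def fieldValues (j₀ : ChartPt n M) : Submodule ℝ (Endo (E n)) :=
  (parallelFields n M).map (LinearMap.proj j₀)

/-- The value at `j` of the parallel field with value `v` at `j₀`. -/
def extendField [ConnectedSpace M] (j₀ : ChartPt n M) :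
    fieldValues j₀ →ₗ[ℝ] ChartPt n M → Endo (E n) :=
  (parallelFields n M).subtype ∘ₗ
    ((LinearEquiv.ofInjective ((LinearMap.proj j₀).domRestrict (parallelFields n M)) (by
      rw [injective_iff_map_eq_zero]
      exact fun X hX => Subtype.ext (parallelFields_eq_zero X.2 hX))).symm.toLinearMap ∘ₗ
    (LinearEquiv.ofEq _ _ (LinearMap.range_domRestrict _ _).symm).toLinearMap)

variable [ConnectedSpace M] {j₀ : ChartPt n M}

theorem extendField_mem (v : fieldValues j₀) : extendField j₀ v ∈ parallelFields n M :=
  Subtype.property _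

theorem extendField_self (v : fieldValues j₀) : extendField j₀ v j₀ = v.1 := by
  have h := LinearEquiv.apply_symm_apply (LinearEquiv.ofInjective
    ((LinearMap.proj j₀ : (ChartPt n M → Endo (E n)) →ₗ[ℝ] _).domRestrict
    (parallelFields n M)) (by
      rw [injective_iff_map_eq_zero]
      exact fun X hX => Subtype.ext (parallelFields_eq_zero X.2 hX)))
      (LinearEquiv.ofEq _ _ (LinearMap.range_domRestrict _ _).symm v)
  exact congrArg Subtype.val h

theorem extendField_eq (hX : X ∈ parallelFields n M) :
    extendField j₀ ⟨X j₀, X, hX, rfl⟩ = X := by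
  rw [← sub_eq_zero]
  refine parallelFields_eq_zero (Submodule.sub_mem _ (extendField_mem _) hX) (j := j₀) ?_
  rw [Pi.sub_apply, extendField_self, sub_self]

theorem continuous_extendField (j : ChartPt n M) :
    Continuous fun v : fieldValues j₀ => extendField j₀ v j := by
  let L : fieldValues j₀ →ₗ[ℝ] Endo (E n) := LinearMap.proj j ∘ₗ extendField j₀
  exact L.continuous_of_finiteDimensional

end Parallel

/-! ### The automorphisms defined by parallel fields -/

section FieldMap

variable {n : ℕ} {M : Type*} [TopologicalSpace M] [ChartedSpace (RP n) M]

variable (n M) in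
/-- A choice of a chart around each point, among finitely many charts, such that the limit points
of the set of the points with a given chart are in the domain of this chart. -/
structure ChartChoice where
  /-- The chart chosen at a point. -/
  chart : M → atlas (RP n) M
  finite : (range chart).Finite
  mem_source : ∀ x, x ∈ (chart x).1.source
  eventually_mem : ∀ m, ∀ᶠ x in 𝓝 m, m ∈ (chart x).1.source

variable (n M) in
theorem nonempty_chartChoice [CompactSpace M] [T2Space M] : Nonempty (ChartChoice n M) := by
  have h : ∀ m : M, ∃ C ∈ 𝓝 m, IsClosed C ∧ C ⊆ (chartAt (RP n) m).source := fun m =>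
    exists_mem_nhds_isClosed_subset (chart_source_mem_nhds (RP n) m)
  choose C hC1 hC2 hC3 using h
  obtain ⟨t, ht⟩ := finite_cover_nhds hC1
  have h2 : ∀ x, ∃ i ∈ t, x ∈ C i := by
    intro x
    have : x ∈ ⋃ i ∈ t, C i := by rw [ht]; trivial
    simpa using this
  choose i hi1 hi2 using h2
  refine ⟨⟨fun x => ⟨chartAt (RP n) (i x), chart_mem_atlas _ _⟩, ?_, fun x => hC3 _ (hi2 x), ?_⟩⟩
  · refine (t.finite_toSet.image fun k : M =>
      (⟨chartAt (RP n) k, chart_mem_atlas _ _⟩ : atlas (RP n) M)).subset ?_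
    rintro _ ⟨x, rfl⟩
    exact ⟨i x, hi1 x, rfl⟩
  · intro m
    have : ∀ᶠ x in 𝓝 m, ∀ k ∈ t, x ∈ C k → m ∈ C k := by
      rw [Filter.eventually_all_finset]
      intro k _
      by_cases hm : m ∈ C k
      · exact Eventually.of_forall fun _ _ => hm
      · filter_upwards [(hC2 k).isOpen_compl.mem_nhds hm] with x hx hx'
        exact absurd hx' hx
    filter_upwards [this] with x hx
    exact hC3 _ (hx _ (hi1 x) (hi2 x))

/-- The transformation of `M` whose local expressions are the projective transformations defined
by `1 + X`, computed at each point in the chosen chart. -/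
def fieldMap (r : ChartChoice n M) (X : ChartPt n M → Endo (E n)) (x : M) : M :=
  locMap (r.chart x).1 (1 + X (chartPt (r.chart x) (r.mem_source x))) x

variable [HasGroupoid M (projectiveGroupoid n)] [ConnectedSpace M] {j₀ : ChartPt n M}

theorem tendsto_one_add_extendField (j : ChartPt n M) :
    Tendsto (fun v : fieldValues j₀ => 1 + extendField j₀ v j) (𝓝 0) (𝓝 1) := by
  have := ((continuous_extendField (j₀ := j₀) j).const_add 1).tendsto 0
  simpa using this

variable (r : ChartChoice n M)

/-- Near a given point, the map defined by a small parallel field can be computed in any chart. -/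
theorem eventually_fieldMap_eq (e : atlas (RP n) M) {m : M} (hm : m ∈ e.1.source) :
    ∀ᶠ p : fieldValues j₀ × M in 𝓝 (0, m), fieldMap r (extendField j₀ p.1) p.2
      = locMap e.1 (1 + extendField j₀ p.1 (chartPt e hm)) p.2 := by
  have t1 : Tendsto (fun p : fieldValues j₀ × M => p.2) (𝓝 (0, m)) (𝓝 m) :=
    continuous_snd.tendsto (0, m)
  have t2 : Tendsto (fun p : fieldValues j₀ × M => p.1) (𝓝 (0, m)) (𝓝 0) :=
    continuous_fst.tendsto (0, m)
  have key : ∀ i ∈ range r.chart, ∀ᶠ p : fieldValues j₀ × M in 𝓝 (0, m), r.chart p.2 = i →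
      fieldMap r (extendField j₀ p.1) p.2
        = locMap e.1 (1 + extendField j₀ p.1 (chartPt e hm)) p.2 := by
    intro i _
    by_cases hi : m ∈ i.1.source
    · obtain ⟨A, hA⟩ := exists_rep_id i.2 e.2 hi hm
      obtain ⟨W, hWo, hmW, hWc, ⟨K, -, hWK, hKe⟩, -⟩ := exists_connected_nhds i hi
      have hWe := hWK.trans hKe
      have t3 : Tendsto (fun p : fieldValues j₀ × M =>
          ((1 + extendField j₀ p.1 (chartPt i hi), p.2) : (Endo (E n)) × M))
          (𝓝 (0, m)) (𝓝 (1, m)) :=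
        ((tendsto_one_add_extendField _).comp t2).prodMk_nhds t1
      filter_upwards [t3.eventually (eventually_locMap_eq hi hm hA),
        t1.eventually (hWo.mem_nhds hmW)]
      rintro ⟨v, x⟩ h1 h2 h3
      simp only at h1 h2 h3 ⊢
      have h4 : toEnd A * toEnd A.symm = 1 := by ext1 v; simp
      rw [mul_add, add_mul, mul_one, h4, parallelFields_conj (extendField_mem v) hi hm hA] at h1
      rw [← h1, fieldMap]
      subst h3
      rw [parallelFields_const (extendField_mem v) hWc hWe h2 hmW]
    · filter_upwards [t1.eventually (r.eventually_mem m)] with p hp hpi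
      rw [hpi] at hp
      exact absurd hp hi
  filter_upwards [(Filter.eventually_all_finite r.finite).2 key] with p hp
  exact hp _ (mem_range_self _) rfl

/-- Near a given point, the map defined by a small parallel field is a projective
transformation in any chart. -/
theorem eventually_rep_fieldMap (e : atlas (RP n) M) {m : M} (hm : m ∈ e.1.source) :
    ∀ᶠ p : fieldValues j₀ × M in 𝓝 (0, m),
      ContinuousAt (fun p : fieldValues j₀ × M => fieldMap r (extendField j₀ p.1) p.2) p ∧
      p.2 ∈ e.1.source ∧ fieldMap r (extendField j₀ p.1) p.2 ∈ e.1.source ∧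
      IsUnit (1 + extendField j₀ p.1 (chartPt e hm)) ∧
      Rep e.1 e.1 (fieldMap r (extendField j₀ p.1)) p.2
        (toEquiv (1 + extendField j₀ p.1 (chartPt e hm))) := by
  have t1 : Tendsto (fun p : fieldValues j₀ × M => p.2) (𝓝 (0, m)) (𝓝 m) :=
    continuous_snd.tendsto (0, m)
  have t2 : Tendsto (fun p : fieldValues j₀ × M => p.1) (𝓝 (0, m)) (𝓝 0) :=
    continuous_fst.tendsto (0, m)
  have t3 : Tendsto (fun p : fieldValues j₀ × M =>
      ((1 + extendField j₀ p.1 (chartPt e hm), p.2) : (Endo (E n)) × M))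
      (𝓝 (0, m)) (𝓝 (1, m)) :=
    ((tendsto_one_add_extendField _).comp t2).prodMk_nhds t1
  have h := (eventually_fieldMap_eq r e hm (j₀ := j₀)).and
    (t3.eventually (eventually_locMap hm))
  filter_upwards [h.eventually_nhds]
  rintro ⟨v, x⟩ hp
  obtain ⟨h1, h2, h3, h4⟩ := hp.self_of_nhds
  simp only at h1 h2 h3 h4 ⊢
  refine ⟨?_, h3, ?_, h2, ?_⟩
  · have h5 : ContinuousAt (fun p : fieldValues j₀ × M =>
        locMap e.1 (1 + extendField j₀ p.1 (chartPt e hm)) p.2) (v, x) := by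
      refine ContinuousAt.comp (x := ((v, x) : fieldValues j₀ × M))
        (g := fun p : (Endo (E n)) × M => locMap e.1 p.1 p.2)
        (f := fun p : fieldValues j₀ × M => (1 + extendField j₀ p.1 (chartPt e hm), p.2))
        (continuousAt_locMap h2 h3 h4) ?_
      exact ((((continuous_extendField (j₀ := j₀) _).const_add 1).comp continuous_fst).prodMk
        continuous_snd).continuousAt
    refine h5.congr ?_
    filter_upwards [hp] with q hq
    exact hq.1.symm
  · rw [h1]
    exact e.1.map_target h4
  · have t4 : Tendsto (fun y : M => (v, y)) (𝓝 x) (𝓝 (v, x)) :=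
      (Continuous.prodMk_right v).tendsto x
    filter_upwards [t4.eventually hp] with y hy
    rw [hy.1, locMap, e.1.right_inv hy.2.2.2]

variable [CompactSpace M] [T2Space M]

/-- The map defined by a small parallel field is injective, by compactness of `M × M`. -/
theorem eventually_injective_fieldMap :
    ∀ᶠ v : fieldValues j₀ in 𝓝 0, Function.Injective (fieldMap r (extendField j₀ v)) := by
  have key : ∀ᶠ v : fieldValues j₀ in 𝓝 0, ∀ q ∈ (univ : Set (M × M)),
      fieldMap r (extendField j₀ v) q.1 = fieldMap r (extendField j₀ v) q.2 → q.1 = q.2 := by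
    refine isCompact_univ.eventually_forall_of_forall_eventually ?_
    rintro ⟨m, m'⟩ -
    let e : M → atlas (RP n) M := fun m => ⟨chartAt (RP n) m, chart_mem_atlas _ _⟩
    have he : ∀ m, m ∈ (e m).1.source := fun m => mem_chart_source _ _
    have h0 : ∀ x, fieldMap r (extendField j₀ 0) x = x := by
      intro x
      rw [fieldMap, map_zero, Pi.zero_apply, add_zero, locMap_one (r.mem_source x)]
    have t : ∀ m, Tendsto (fun p : fieldValues j₀ × M => fieldMap r (extendField j₀ p.1) p.2)
        (𝓝 (0, m)) (𝓝 m) := by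
      intro m
      have := (eventually_rep_fieldMap r (e m) (he m) (j₀ := j₀)).self_of_nhds.1
      rwa [ContinuousAt, h0] at this
    have t1 : Tendsto (fun p : fieldValues j₀ × (M × M) => (p.1, p.2.1)) (𝓝 (0, (m, m')))
        (𝓝 (0, m)) := by
      have : Continuous (fun p : fieldValues j₀ × (M × M) => (p.1, p.2.1)) := by fun_prop
      exact this.tendsto _
    have t2 : Tendsto (fun p : fieldValues j₀ × (M × M) => (p.1, p.2.2)) (𝓝 (0, (m, m')))
        (𝓝 (0, m')) := by
      have : Continuous (fun p : fieldValues j₀ × (M × M) => (p.1, p.2.2)) := by fun_prop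
      exact this.tendsto _
    by_cases hmm : m = m'
    · subst hmm
      have h1 := eventually_rep_fieldMap r (e m) (he m) (j₀ := j₀)
      filter_upwards [t1.eventually h1, t2.eventually h1]
      rintro ⟨v, x, y⟩ ⟨-, hx, -, -, hx'⟩ ⟨-, hy, -, -, hy'⟩ hxy
      have h2 := hx'.eq
      have h3 := hy'.eq
      simp only at hxy h2 h3 hx hy ⊢
      rw [hxy, h3] at h2
      have h4 : (e m).1 y = (e m).1 x := MulAction.injective _ h2
      exact ((e m).1.injOn hy hx h4).symm
    · obtain ⟨O, O', hO, hO', hmO, hmO', hd⟩ := t2_separation hmm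
      filter_upwards [((t m).comp t1).eventually (hO.mem_nhds hmO),
        ((t m').comp t2).eventually (hO'.mem_nhds hmO')] with p h1 h2 h3
      simp only [Function.comp_apply] at h1 h2
      rw [h3] at h1
      exact absurd h2 (Set.disjoint_left.1 hd h1)
  filter_upwards [key] with v hv x y hxy
  exact hv (x, y) (mem_univ _) hxy

/-- A continuous injective map which is locally a projective transformation is an
automorphism. -/
theorem exists_projAut {f : M → M} (hc : Continuous f) (hi : Function.Injective f)
    (h : ∀ x, ∃ e ∈ atlas (RP n) M, ∃ e' ∈ atlas (RP n) M, x ∈ e.source ∧ f x ∈ e'.source ∧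
      ∃ A, Rep e e' f x A) : ∃ g : ProjAut n M, ∀ x, g.1 x = f x := by
  have ho : IsOpenMap f := by
    rw [isOpenMap_iff_nhds_le]
    intro x
    obtain ⟨e, -, e', -, hx, hx', A, hA⟩ := h x
    exact (hA.map_nhds hx hx' hc.continuousAt).ge
  have hs : Function.Surjective f := by
    rw [← range_eq_univ]
    exact IsClopen.eq_univ ⟨(isCompact_range hc).isClosed, ho.isOpen_range⟩ (range_nonempty f)
  have hc' : Continuous (Equiv.ofBijective f ⟨hi, hs⟩) := hc
  refine ⟨⟨hc'.homeoOfEquivCompactToT2, mem_projAut_of_forall h⟩, fun x => rfl⟩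

/-- A small parallel field defines an automorphism. -/
theorem eventually_exists_projAut :
    ∀ᶠ v : fieldValues j₀ in 𝓝 0, ∃ g : ProjAut n M,
      ∀ x, g.1 x = fieldMap r (extendField j₀ v) x := by
  have key : ∀ᶠ v : fieldValues j₀ in 𝓝 0, ∀ x ∈ (univ : Set M),
      ContinuousAt (fun p : fieldValues j₀ × M => fieldMap r (extendField j₀ p.1) p.2) (v, x) ∧
      ∃ e ∈ atlas (RP n) M, ∃ e' ∈ atlas (RP n) M, x ∈ e.source ∧
        fieldMap r (extendField j₀ v) x ∈ e'.source ∧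
        ∃ A, Rep e e' (fieldMap r (extendField j₀ v)) x A := by
    refine isCompact_univ.eventually_forall_of_forall_eventually ?_
    intro m _
    filter_upwards [eventually_rep_fieldMap r (j₀ := j₀)
      (⟨chartAt (RP n) m, chart_mem_atlas _ _⟩ : atlas (RP n) M) (mem_chart_source _ m)] with p hp
    exact ⟨hp.1, _, chart_mem_atlas _ _, _, chart_mem_atlas _ _, hp.2.1, hp.2.2.1, _, hp.2.2.2.2⟩
  filter_upwards [key, eventually_injective_fieldMap r] with v hv hvi
  refine exists_projAut ?_ hvi fun x => (hv x (mem_univ x)).2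
  refine continuous_iff_continuousAt.2 fun x => ?_
  exact (hv x (mem_univ x)).1.comp (f := fun y => (v, y)) (Continuous.prodMk_right v).continuousAt

end FieldMap

/-! ### The parallel field of an automorphism close to the identity -/

section RepField

variable {n : ℕ} {M : Type*} [TopologicalSpace M]

theorem toEnd_trans (A B : E n ≃ₗ[ℝ] E n) : toEnd (A.trans B) = toEnd B * toEnd A := rfl

theorem toEnd_mul_symm (A : E n ≃ₗ[ℝ] E n) : toEnd A * toEnd A.symm = 1 := by
  ext1 v
  simp

theorem toEnd_symm_mul (A : E n ≃ₗ[ℝ] E n) : toEnd A.symm * toEnd A = 1 := by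
  ext1 v
  simp

theorem toEnd_conj (A B : E n ≃ₗ[ℝ] E n) :
    toEnd ((B.symm.trans A).trans B) = toEnd B * toEnd A * toEnd B.symm := rfl

/-- Representatives with the same nonzero trace are equal. -/
theorem Rep.unique_of_tr {e e' : OpenPartialHomeomorph M (RP n)} {f : M → M} {x : M}
    {A B : E n ≃ₗ[ℝ] E n} (hx : x ∈ e.source) (hA : Rep e e' f x A) (hB : Rep e e' f x B)
    (htA : tr (toEnd A) = n + 1) (htB : tr (toEnd B) = n + 1) : A = B := by
  obtain ⟨c, -, hc⟩ := hA.unique hx hB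
  have h1 : toEnd B = c • toEnd A := by
    ext1 v
    exact hc v
  rw [h1, map_smul, htA, smul_eq_mul] at htB
  have h2 : c = 1 := by
    have : (n : ℝ) + 1 ≠ 0 := by positivity
    exact mul_right_cancel₀ this (htB.trans (one_mul _).symm)
  rw [h2, one_smul] at h1
  exact (toEnd_injective h1).symm

theorem conj_eq_of_eq_smul {A B : E n ≃ₗ[ℝ] E n} {c : ℝ} (hc0 : c ≠ 0) (hc : ∀ v, B v = c • A v)
    (S : Endo (E n)) : toEnd B * S * toEnd B.symm = toEnd A * S * toEnd A.symm := by
  have h1 : toEnd B = c • toEnd A := by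
    ext1 v
    exact hc v
  have h2 : toEnd B.symm = c⁻¹ • toEnd A.symm := by
    ext1 v
    refine B.injective ?_
    change B (B.symm v) = B (c⁻¹ • A.symm v)
    rw [B.apply_symm_apply, hc, map_smul, A.apply_symm_apply, smul_smul, mul_inv_cancel₀ hc0,
      one_smul]
  rw [h1, h2, smul_mul_assoc, smul_mul_assoc, mul_smul_comm, smul_smul, mul_inv_cancel₀ hc0,
    one_smul]

variable [ChartedSpace (RP n) M] (r : ChartChoice n M)

open Classical in
/-- The field `X` such that `1 + X` represents the map `f`: the representatives in the charts chosen
by `r`, normalised by their traces, are carried to the other charts. -/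
def repField (f : M → M) (j : ChartPt n M) : Endo (E n) :=
  if h : ∃ S : Endo (E n), ∃ A C : E n ≃ₗ[ℝ] E n, tr (toEnd A) = n + 1 ∧
      Rep (r.chart j.1.2).1 (r.chart j.1.2).1 f j.1.2 A ∧
      Rep (r.chart j.1.2).1 j.1.1.1 id j.1.2 C ∧ S = toEnd C * toEnd A * toEnd C.symm
  then h.choose - 1 else 0

theorem repField_eq {f : M → M} {j : ChartPt n M} {A C : E n ≃ₗ[ℝ] E n}
    (ht : tr (toEnd A) = n + 1) (hA : Rep (r.chart j.1.2).1 (r.chart j.1.2).1 f j.1.2 A)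
    (hC : Rep (r.chart j.1.2).1 j.1.1.1 id j.1.2 C) :
    repField r f j = toEnd C * toEnd A * toEnd C.symm - 1 := by
  have h : ∃ S : Endo (E n), ∃ A C : E n ≃ₗ[ℝ] E n, tr (toEnd A) = n + 1 ∧
      Rep (r.chart j.1.2).1 (r.chart j.1.2).1 f j.1.2 A ∧
      Rep (r.chart j.1.2).1 j.1.1.1 id j.1.2 C ∧ S = toEnd C * toEnd A * toEnd C.symm :=
    ⟨_, A, C, ht, hA, hC, rfl⟩
  rw [repField, dif_pos h]
  obtain ⟨A', C', ht', hA', hC', hS⟩ := h.choose_spec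
  rw [hS, hA'.unique_of_tr (r.mem_source _) hA ht' ht]
  obtain ⟨c, hc0, hc⟩ := hC.unique (r.mem_source _) hC'
  rw [conj_eq_of_eq_smul hc0 hc]

/-- An automorphism is recovered from its field. -/
theorem fieldMap_repField {f : M → M} {x : M} {A : E n ≃ₗ[ℝ] E n} (ht : tr (toEnd A) = n + 1)
    (hA : Rep (r.chart x).1 (r.chart x).1 f x A) (hx : f x ∈ (r.chart x).1.source) :
    fieldMap r (repField r f) x = f x := by
  rw [fieldMap, repField_eq r (j := chartPt (r.chart x) (r.mem_source x)) ht hA Rep.id]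
  have : toEnd (LinearEquiv.refl ℝ (E n)) * toEnd A * toEnd (LinearEquiv.refl ℝ (E n)).symm
    = toEnd A := rfl
  rw [this, add_sub_cancel, locMap, toEquiv_toEnd, ← hA.eq, OpenPartialHomeomorph.left_inv _ hx]

variable [HasGroupoid M (projectiveGroupoid n)] [CompactSpace M] [T2Space M]

/-- In a given chart, the field of an automorphism close to the identity is constant near a given
point, with a value close to `0`. -/
theorem eventually_repField (e : atlas (RP n) M) {m : M} (hm : m ∈ e.1.source)
    {N : Set (Endo (E n))} (hN : N ∈ 𝓝 1) :
    ∃ W ∈ 𝓝 m, ∀ᶠ f : ProjAut n M in 𝓝 1, ∃ S ∈ N, ∀ x ∈ W,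
      (∀ hx : x ∈ e.1.source, repField r f.1 (chartPt e hx) = S - 1) ∧
      ∃ A : E n ≃ₗ[ℝ] E n, tr (toEnd A) = n + 1 ∧ Rep (r.chart x).1 (r.chart x).1 f.1 x A ∧
        f.1 x ∈ (r.chart x).1.source := by
  obtain ⟨W, hWo, hmW, -, -, hW⟩ := exists_nhds_rep e hm
  have key : ∀ i ∈ range r.chart, ∃ W' ∈ 𝓝 m, ∀ᶠ f : ProjAut n M in 𝓝 1, ∀ S : E n ≃ₗ[ℝ] E n,
      tr (toEnd S) = n + 1 → (∀ x ∈ W, Rep e.1 e.1 f.1 x S ∧ f.1 x ∈ e.1.source) →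
      ∀ x ∈ W' ∩ W, r.chart x = i →
      (∀ hx : x ∈ e.1.source, repField r f.1 (chartPt e hx) = toEnd S - 1) ∧
      ∃ A : E n ≃ₗ[ℝ] E n, tr (toEnd A) = n + 1 ∧ Rep (r.chart x).1 (r.chart x).1 f.1 x A ∧
        f.1 x ∈ (r.chart x).1.source := by
    intro i _
    by_cases hi : m ∈ i.1.source
    · obtain ⟨W₁, hW₁o, hmW₁, -, -, hW₁⟩ := exists_nhds_rep i hi
      obtain ⟨C, hC⟩ := exists_rep_id i.2 e.2 hi hm
      have hev : ∀ᶠ p : ProjAut n M × M in 𝓝 (1, m), Rep i.1 e.1 id (p.1.1 p.2) C :=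
        ((continuous_eval_subgroup (ProjAut n M)).tendsto (1, m)).eventually hC.eventually
      rw [nhds_prod_eq, eventually_prod_iff] at hev
      obtain ⟨P, hP, Q, hQ, hPQ⟩ := hev
      refine ⟨_, inter_mem (inter_mem hQ hC.eventually) (hW₁o.mem_nhds hmW₁), ?_⟩
      filter_upwards [hP, hW₁ univ univ_mem]
      rintro f hf ⟨A, -, htA, hA⟩ S htS hS x ⟨⟨⟨hxQ, hxC⟩, hxW₁⟩, hxW⟩ rfl
      have hxC : Rep (r.chart x).1 e.1 id x C := hxC
      refine ⟨fun hx => ?_, A, htA, hA x hxW₁⟩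
      rw [repField_eq r (j := chartPt e hx) htA (hA x hxW₁).1 hxC, ← toEnd_conj]
      congr 2
      refine Rep.unique_of_tr hx (f := f.1) ?_ (hS x hxW).1 ?_ htS
      · have h1 : Rep e.1 (r.chart x).1 id x C.symm := Rep.inv (f := Homeomorph.refl M) hxC
        have h2 : Rep e.1 (r.chart x).1 f.1 x (C.symm.trans A) :=
          Rep.comp (f := id) (g := f.1) (hA x hxW₁).1 h1 continuousAt_id
        exact Rep.comp (f := f.1) (g := id) (hPQ hf hxQ) h2 f.1.continuous.continuousAt
      · rw [toEnd_conj, tr_conj, htA]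
    · refine ⟨_, r.eventually_mem m, Eventually.of_forall fun f S _ _ x hx hxi => ?_⟩
      have : m ∈ (r.chart x).1.source := hx.1
      rw [hxi] at this
      exact absurd this hi
  choose! W' hW' hWf using key
  refine ⟨_, inter_mem ((biInter_mem r.finite).2 hW') (hWo.mem_nhds hmW), ?_⟩
  filter_upwards [hW N hN, (Filter.eventually_all_finite r.finite).2 hWf]
  rintro f ⟨S, hSN, htS, hS⟩ hf
  refine ⟨_, hSN, fun x hx => ?_⟩
  exact hf _ (mem_range_self x) S htS hS x ⟨mem_iInter₂.1 hx.1 _ (mem_range_self x), hx.2⟩ rfl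

theorem eventually_exists_rep : ∀ᶠ f : ProjAut n M in 𝓝 1, ∀ x,
    ∃ A : E n ≃ₗ[ℝ] E n, tr (toEnd A) = n + 1 ∧ Rep (r.chart x).1 (r.chart x).1 f.1 x A ∧
        f.1 x ∈ (r.chart x).1.source := by
  have : ∀ᶠ f : ProjAut n M in 𝓝 1, ∀ x ∈ (univ : Set M),
    ∃ A : E n ≃ₗ[ℝ] E n, tr (toEnd A) = n + 1 ∧ Rep (r.chart x).1 (r.chart x).1 f.1 x A ∧
        f.1 x ∈ (r.chart x).1.source := by
    refine isCompact_univ.eventually_forall_of_forall_eventually fun m _ => ?_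
    obtain ⟨W, hW, h⟩ := eventually_repField r (r.chart m) (r.mem_source m)
      (univ_mem : univ ∈ 𝓝 (1 : Endo (E n)))
    rw [nhds_prod_eq]
    filter_upwards [prod_mem_prod h hW]
    rintro ⟨f, x⟩ ⟨⟨S, -, hS⟩, hx⟩
    exact (hS x hx).2
  filter_upwards [this] with f hf x
  exact hf x (mem_univ x)

theorem eventually_repField_mem :
    ∀ᶠ f : ProjAut n M in 𝓝 1, repField r f.1 ∈ parallelFields n M := by
  have h : ∀ᶠ f : ProjAut n M in 𝓝 1, ∀ x ∈ (univ : Set M), ∃ e : atlas (RP n) M,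
      x ∈ e.1.source ∧ ∃ S, ∀ᶠ y in 𝓝 x, ∀ hy : y ∈ e.1.source,
        repField r f.1 (chartPt e hy) = S := by
    refine isCompact_univ.eventually_forall_of_forall_eventually fun m _ => ?_
    obtain ⟨W, hW, h⟩ := eventually_repField r (r.chart m) (r.mem_source m)
      (univ_mem : univ ∈ 𝓝 (1 : Endo (E n)))
    rw [nhds_prod_eq]
    filter_upwards [prod_mem_prod h (inter_mem (interior_mem_nhds.2 hW)
      ((r.chart m).1.open_source.mem_nhds (r.mem_source m)))]
    rintro ⟨f, x⟩ ⟨⟨S, -, hS⟩, hx, hxs⟩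
    refine ⟨r.chart m, hxs, S - 1, ?_⟩
    filter_upwards [isOpen_interior.mem_nhds hx] with y hy
    exact (hS y (interior_subset hy)).1
  filter_upwards [h, eventually_exists_rep r] with f hf hf'
  have hconj : ∀ (e e' : atlas (RP n) M) (x : M) (hx : x ∈ e.1.source) (hx' : x ∈ e'.1.source)
      (A : E n ≃ₗ[ℝ] E n), Rep e.1 e'.1 id x A →
      toEnd A * repField r f.1 (chartPt e hx) = repField r f.1 (chartPt e' hx') * toEnd A := by
    intro e e' x hx hx' A hA
    obtain ⟨S, htS, hS, -⟩ := hf' x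
    obtain ⟨C, hC⟩ := exists_rep_id (r.chart x).2 e.2 (r.mem_source x) hx
    have hCA : Rep (r.chart x).1 e'.1 id x (C.trans A) :=
      Rep.comp (f := id) (g := id) hA hC continuousAt_id
    rw [repField_eq r (j := chartPt e hx) htS hS hC, repField_eq r (j := chartPt e' hx') htS hS hCA]
    have h1 : toEnd (C.trans A).symm = toEnd C.symm * toEnd A.symm := rfl
    rw [toEnd_trans, h1, mul_sub, sub_mul, mul_one, one_mul]
    simp only [mul_assoc, toEnd_symm_mul, mul_one]
  refine ⟨fun j => ?_, hconj, fun e x hx => ?_⟩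
  · obtain ⟨S, htS, hS, -⟩ := hf' j.1.2
    obtain ⟨C, hC⟩ := exists_rep_id (r.chart j.1.2).2 j.1.1.2 (r.mem_source j.1.2) j.2
    rw [repField_eq r htS hS hC, map_sub, tr_conj, htS, tr_one, sub_self]
  · obtain ⟨e', hx', S, hS⟩ := hf x (mem_univ x)
    obtain ⟨A, hA⟩ := exists_rep_id e'.2 e.2 hx' hx
    have key : ∀ᶠ y in 𝓝 x, ∀ hy : y ∈ e.1.source,
        repField r f.1 (chartPt e hy) = toEnd A * S * toEnd A.symm := by
      filter_upwards [hS, hA.eventually, e'.1.open_source.mem_nhds hx'] with y hy hAy hy' hye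
      have h1 := hconj e' e y hy' hye A hAy
      rw [hy hy'] at h1
      rw [h1, mul_assoc, toEnd_mul_symm, mul_one]
    filter_upwards [key] with y hy hye
    rw [hy hye, key.self_of_nhds hx]

variable [ConnectedSpace M] (j₀ : ChartPt n M)

/-- Every automorphism close to the identity is defined by a small parallel field. -/
theorem eventually_exists_field {N : Set (fieldValues j₀)} (hN : N ∈ 𝓝 0) :
    ∀ᶠ f : ProjAut n M in 𝓝 1, ∃ v ∈ N, ∀ x, f.1 x = fieldMap r (extendField j₀ v) x := by
  obtain ⟨N', hN', hNN⟩ := mem_nhds_subtype _ _ _ |>.1 hN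
  have hN1 : (fun S : Endo (E n) => S - 1) ⁻¹' N' ∈ 𝓝 (1 : Endo (E n)) := by
    have : Continuous fun S : Endo (E n) => S - 1 := by fun_prop
    refine this.continuousAt.preimage_mem_nhds ?_
    rw [sub_self]
    exact hN'
  obtain ⟨W, hW, h⟩ := eventually_repField r j₀.1.1 j₀.2 hN1
  filter_upwards [h, eventually_repField_mem r, eventually_exists_rep r]
  rintro f ⟨S, hSN, hS⟩ hmem hrep
  refine ⟨⟨repField r f.1 j₀, _, hmem, rfl⟩, hNN ?_, fun x => ?_⟩
  · have h1 : repField r f.1 j₀ = S - 1 := (hS _ (mem_of_mem_nhds hW)).1 j₀.2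
    change repField r f.1 j₀ ∈ N'
    rw [h1]
    exact hSN
  · rw [extendField_eq hmem]
    obtain ⟨A, htA, hA, hx⟩ := hrep x
    rw [fieldMap_repField r htA hA hx]

end RepField

/-! ### The Lie group of projective automorphisms -/

section Submodule

variable {V : Type*} [NormedAddCommGroup V] [NormedSpace ℝ V] (F : Submodule ℝ V)

/-- A subspace is the image of a smooth retraction fixing the origin, namely of a linear one. -/
theorem exists_contDiff_retraction [FiniteDimensional ℝ V] :
    ∃ π : V → F, ContDiff ℝ ω π ∧ π 0 = 0 ∧ ∀ v : F, π v.1 = v := by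
  obtain ⟨g, hg⟩ := LinearMap.exists_leftInverse_of_injective F.subtype (Submodule.ker_subtype _)
  exact ⟨g, (LinearMap.toContinuousLinearMap g).contDiff, map_zero g,
    fun v => LinearMap.congr_fun hg v⟩

theorem contDiff_linearMap_submodule [FiniteDimensional ℝ V] {W : Type*} [NormedAddCommGroup W]
    [NormedSpace ℝ W] (L : F →ₗ[ℝ] W) : ContDiff ℝ ω L :=
  (LinearMap.toContinuousLinearMap L).contDiff

theorem contDiff_submodule_val : ContDiff ℝ ω (Subtype.val : F → V) := F.subtypeL.contDiff

end Submodule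

section NormTr

variable {n : ℕ}

/-- The endomorphism proportional to `S` with the trace of the identity. -/
def normTr (S : Endo (E n)) : Endo (E n) := (((n : ℝ) + 1) / tr S) • S

theorem normTr_smul {S : Endo (E n)} {c : ℝ} (hc : c ≠ 0) : normTr (c • S) = normTr S := by
  rw [normTr, normTr, map_smul, smul_smul, smul_eq_mul]
  congr 1
  field_simp

theorem normTr_eq {S : Endo (E n)} (h : tr S = n + 1) : normTr S = S := by
  have : (n : ℝ) + 1 ≠ 0 := by positivity
  rw [normTr, h, div_self this, one_smul]

theorem contDiffAt_normTr {S : Endo (E n)} (h : tr S ≠ 0) : ContDiffAt ℝ ω normTr S := by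
  have h1 : ContDiffAt ℝ ω (fun S : Endo (E n) => tr S) S :=
    (LinearMap.toContinuousLinearMap (tr : Endo (E n) →ₗ[ℝ] ℝ)).contDiff.contDiffAt
  exact (contDiffAt_const.div h1 h).smul contDiffAt_id

theorem contDiffAt_retraction_normTr {W : Submodule ℝ (Endo (E n))} {π : Endo (E n) → W}
    (hπ : ContDiff ℝ ω π)
    {F : Type*} [NormedAddCommGroup F] [NormedSpace ℝ F] {S : F → Endo (E n)}
    (hS : ContDiffAt ℝ ω S 0) (h0 : S 0 = 1) :
    ContDiffAt ℝ ω (fun y => π (normTr (S y) - 1)) 0 := by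
  have hn : (n : ℝ) + 1 ≠ 0 := by positivity
  refine hπ.contDiffAt.comp (0 : F) (f := fun y => normTr (S y) - 1) ?_
  refine (ContDiffAt.comp (0 : F) (g := normTr) ?_ hS).sub contDiffAt_const
  rw [h0]
  exact contDiffAt_normTr (by rw [tr_one]; exact hn)

theorem retraction_normTr_one {W : Submodule ℝ (Endo (E n))} {π : Endo (E n) → W} (h0 : π 0 = 0) :
    π (normTr 1 - 1) = 0 := by rw [normTr_eq tr_one, sub_self, h0]

end NormTr

theorem tendsto_base {n : ℕ} {M : Type*} [TopologicalSpace M] [ChartedSpace (RP n) M]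
    (j₀ : ChartPt n M) :
    Tendsto (fun v : fieldValues j₀ => (v, j₀.1.2)) (𝓝 0) (𝓝 (0, j₀.1.2)) :=
  (Continuous.prodMk_left j₀.1.2).tendsto 0

theorem tendsto_eval {M : Type*} [TopologicalSpace M] [CompactSpace M] [T2Space M]
    (G : Subgroup (M ≃ₜ M)) (m : M) : Tendsto (fun p : G × M => p.1.1 p.2) (𝓝 (1, m)) (𝓝 m) :=
  (continuous_eval_subgroup G).tendsto (1, m)

section ProjLie

variable {n : ℕ} {M : Type*} [TopologicalSpace M] [ChartedSpace (RP n) M]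
  [HasGroupoid M (projectiveGroupoid n)] [ConnectedSpace M] (r : ChartChoice n M)
  (j₀ : ChartPt n M)

theorem tr_one_add (v : fieldValues j₀) (j : ChartPt n M) :
    tr (1 + extendField j₀ v j) = n + 1 := by
  rw [map_add, tr_one, (extendField_mem v).1, add_zero]

open Classical in
/-- The automorphism defined by the parallel field with value `v` at `j₀`, when there is one. -/
def fieldAut (v : fieldValues j₀) : ProjAut n M :=
  if h : ∃ g : ProjAut n M, ∀ x, g.1 x = fieldMap r (extendField j₀ v) x then h.choose else 1

theorem fieldAut_eq {v : fieldValues j₀} {g : ProjAut n M}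
    (hg : ∀ x, g.1 x = fieldMap r (extendField j₀ v) x) : fieldAut r j₀ v = g := by
  have h : ∃ g : ProjAut n M, ∀ x, g.1 x = fieldMap r (extendField j₀ v) x := ⟨g, hg⟩
  rw [fieldAut, dif_pos h]
  refine Subtype.ext (Homeomorph.ext fun x => ?_)
  rw [h.choose_spec, hg]

theorem fieldAut_zero : fieldAut r j₀ 0 = 1 := by
  refine fieldAut_eq r j₀ fun x => ?_
  rw [fieldMap, map_zero, Pi.zero_apply, add_zero, locMap_one (r.mem_source x)]
  rfl

variable [CompactSpace M] [T2Space M]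

theorem eventually_fieldAut : ∀ᶠ v in 𝓝 0, ∀ x,
    (fieldAut r j₀ v).1 x = fieldMap r (extendField j₀ v) x := by
  filter_upwards [eventually_exists_projAut r (j₀ := j₀)] with v hv x
  obtain ⟨g, hg⟩ := hv
  rw [fieldAut_eq r j₀ hg, hg]

theorem eventually_continuousAt_fieldAut : ∀ᶠ v in 𝓝 0, ContinuousAt (fieldAut r j₀) v := by
  have key : ∀ᶠ v : fieldValues j₀ in 𝓝 0, ∀ x ∈ (univ : Set M),
      ContinuousAt (fun p : fieldValues j₀ × M => fieldMap r (extendField j₀ p.1) p.2) (v, x) := by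
    refine isCompact_univ.eventually_forall_of_forall_eventually fun m _ => ?_
    filter_upwards [eventually_rep_fieldMap r (r.chart m) (r.mem_source m) (j₀ := j₀)] with p hp
    exact hp.1
  filter_upwards [key, (eventually_fieldAut r j₀).eventually_nhds] with v hv hv'
  refine continuousAt_subgroup_of_forall fun x => (hv x (mem_univ x)).congr ?_
  have : Tendsto (Prod.fst : fieldValues j₀ × M → _) (𝓝 (v, x)) (𝓝 v) :=
    continuous_fst.tendsto (v, x)
  filter_upwards [this.eventually hv'] with p hp
  exact (hp p.2).symm

theorem tendsto_fieldAut : Tendsto (fieldAut r j₀) (𝓝 0) (𝓝 1) := by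
  have := (eventually_continuousAt_fieldAut r j₀).self_of_nhds
  rwa [ContinuousAt, fieldAut_zero] at this

theorem eventually_rep_fieldAut (e : atlas (RP n) M) {m : M} (hm : m ∈ e.1.source) :
    ∀ᶠ p : fieldValues j₀ × M in 𝓝 (0, m), p.2 ∈ e.1.source ∧ ∃ A : E n ≃ₗ[ℝ] E n,
      toEnd A = 1 + extendField j₀ p.1 (chartPt e hm) ∧
      Rep e.1 e.1 (fieldAut r j₀ p.1).1 p.2 A := by
  have : Tendsto (Prod.fst : fieldValues j₀ × M → _) (𝓝 (0, m)) (𝓝 0) :=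
    continuous_fst.tendsto (0, m)
  filter_upwards [eventually_rep_fieldMap r e hm (j₀ := j₀), this.eventually
    (eventually_fieldAut r j₀)] with p hp hp'
  refine ⟨hp.2.1, _, toEnd_toEquiv hp.2.2.2.1, hp.2.2.2.2.congr ?_⟩
  exact Eventually.of_forall fun x => (hp' x).symm

/-- An automorphism close to the identity is determined by its representative at the base
point. -/
theorem eventually_eq_fieldAut {π : Endo (E n) → fieldValues j₀}
    (hπ : ∀ v : fieldValues j₀, π v.1 = v) {Y : Type*} {l : Filter Y} {h : Y → ProjAut n M}
    (hl : Tendsto h l (𝓝 1)) {S : Y → Endo (E n)}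
    (hS : ∀ᶠ y in l, ∃ A : E n ≃ₗ[ℝ] E n, toEnd A = S y ∧
      Rep j₀.1.1.1 j₀.1.1.1 (h y).1 j₀.1.2 A) :
    ∀ᶠ y in l, h y = fieldAut r j₀ (π (normTr (S y) - 1)) := by
  have h1 : Tendsto (fun v : fieldValues j₀ => (v, j₀.1.2)) (𝓝 0) (𝓝 (0, j₀.1.2)) :=
    (Continuous.prodMk_left j₀.1.2).tendsto 0
  filter_upwards [hS, hl.eventually (eventually_exists_field r j₀
    (h1.eventually (eventually_rep_fieldAut r j₀ j₀.1.1 j₀.2)))]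
  rintro y ⟨A, hAS, hA⟩ ⟨v, ⟨-, C, hCS, hC⟩, hv⟩
  have h2 := fieldAut_eq r j₀ hv
  have hCS : toEnd C = 1 + v.1 := by rw [hCS]; congr 1; exact extendField_self v
  rw [← h2]
  rw [← h2] at hA
  obtain ⟨c, hc0, hc⟩ := Rep.unique j₀.2 hC hA
  have h3 : S y = c • (1 + v.1) := by
    rw [← hCS, ← hAS]
    ext1 w
    exact hc w
  have h4 : tr (1 + v.1) = n + 1 := by
    have := tr_one_add j₀ v j₀
    rwa [extendField_self] at this
  rw [h3, normTr_smul hc0, normTr_eq h4, add_sub_cancel_left, hπ]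

/-- Near the base point, `1 + v` represents the automorphism of the field with value `v`. -/
theorem eventually_rep_fieldAut_base :
    ∀ᶠ p : fieldValues j₀ × M in 𝓝 (0, j₀.1.2), p.2 ∈ j₀.1.1.1.source ∧
      ∃ A : E n ≃ₗ[ℝ] E n, toEnd A = 1 + p.1.1 ∧
      Rep j₀.1.1.1 j₀.1.1.1 (fieldAut r j₀ p.1).1 p.2 A := by
  filter_upwards [eventually_rep_fieldAut r j₀ j₀.1.1 j₀.2] with p hp
  obtain ⟨h0, A, hA, hA'⟩ := hp
  refine ⟨h0, A, hA.trans ?_, hA'⟩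
  congr 1
  exact extendField_self p.1

/-- The representatives at the base point separate the automorphisms of small fields. -/
theorem exists_injOn_fieldAut : ∃ N ∈ 𝓝 0, InjOn (fieldAut r j₀) N := by
  refine ⟨_, (tendsto_base j₀).eventually (eventually_rep_fieldAut_base r j₀), ?_⟩
  rintro v ⟨-, A, hAv, hA⟩ w ⟨-, C, hCw, hC⟩ hvw
  simp only at hAv hCw
  rw [hvw] at hA
  have htv := tr_one_add j₀ v j₀
  have htw := tr_one_add j₀ w j₀
  rw [extendField_self] at htv htw
  have := Rep.unique_of_tr j₀.2 hA hC (by rw [hAv, htv]) (by rw [hCw, htw])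
  rw [this, hCw] at hAv
  exact (Subtype.ext (add_left_cancel hAv)).symm

/-- The product of the automorphisms of two small fields is the automorphism of the field obtained
by normalising the trace of the product of their representatives. -/
theorem fieldAut_mul : ∃ μ : fieldValues j₀ × fieldValues j₀ → fieldValues j₀,
    ContDiffAt ℝ ω μ 0 ∧ μ 0 = 0 ∧
    ∀ᶠ p in 𝓝 0, fieldAut r j₀ p.1 * fieldAut r j₀ p.2 = fieldAut r j₀ (μ p) := by
  obtain ⟨π, hπc, hπ0, hπ⟩ := exists_contDiff_retraction (fieldValues j₀)
  refine ⟨fun p => π (normTr ((1 + p.1.1) * (1 + p.2.1)) - 1), ?_, ?_, ?_⟩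
  · refine contDiffAt_retraction_normTr hπc
      (S := fun p : fieldValues j₀ × fieldValues j₀ => (1 + p.1.1) * (1 + p.2.1)) ?_ ?_
    · refine ContDiff.contDiffAt ?_
      exact (contDiff_const.add ((contDiff_submodule_val (fieldValues j₀)).comp contDiff_fst)).mul
        (contDiff_const.add ((contDiff_submodule_val (fieldValues j₀)).comp contDiff_snd))
    · simp
  · simpa using retraction_normTr_one hπ0
  · have t1 : Tendsto (fun p : fieldValues j₀ × fieldValues j₀ => fieldAut r j₀ p.1)
        (𝓝 0) (𝓝 1) := (tendsto_fieldAut r j₀).comp (continuous_fst.tendsto 0)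
    have t2 : Tendsto (fun p : fieldValues j₀ × fieldValues j₀ => fieldAut r j₀ p.2)
        (𝓝 0) (𝓝 1) := (tendsto_fieldAut r j₀).comp (continuous_snd.tendsto 0)
    refine eventually_eq_fieldAut r j₀ hπ (by simpa using t1.mul t2) ?_
    have t3 : Tendsto (fun p : fieldValues j₀ × fieldValues j₀ =>
        (p.1, (fieldAut r j₀ p.2).1 j₀.1.2)) (𝓝 0) (𝓝 (0, j₀.1.2)) :=
      (continuous_fst.tendsto (0 : fieldValues j₀ × fieldValues j₀)).prodMk_nhds
        ((tendsto_eval (ProjAut n M) j₀.1.2).comp (t2.prodMk_nhds tendsto_const_nhds))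
    filter_upwards [t3.eventually (eventually_rep_fieldAut_base r j₀),
      ((continuous_snd.tendsto (0 : fieldValues j₀ × fieldValues j₀))).eventually
        ((tendsto_base j₀).eventually (eventually_rep_fieldAut_base r j₀))]
    rintro ⟨v, w⟩ ⟨-, A, hAv, hA⟩ ⟨-, C, hCw, hC⟩
    refine ⟨C.trans A, ?_, hA.comp hC (fieldAut r j₀ w).1.continuous.continuousAt⟩
    rw [toEnd_trans, hAv, hCw]

theorem fieldAut_inv : ∃ ι : fieldValues j₀ → fieldValues j₀,
    ContDiffAt ℝ ω ι 0 ∧ ι 0 = 0 ∧ ∀ᶠ v in 𝓝 0, (fieldAut r j₀ v)⁻¹ = fieldAut r j₀ (ι v) := by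
  obtain ⟨π, hπc, hπ0, hπ⟩ := exists_contDiff_retraction (fieldValues j₀)
  refine ⟨fun v => π (normTr (Ring.inverse (1 + v.1)) - 1), ?_, ?_, ?_⟩
  · refine contDiffAt_retraction_normTr hπc
      (S := fun v : fieldValues j₀ => Ring.inverse (1 + v.1)) ?_ ?_
    · refine ContDiffAt.comp (0 : fieldValues j₀) (g := Ring.inverse)
        (f := fun v : fieldValues j₀ => 1 + v.1) ?_
        (contDiff_const.add (contDiff_submodule_val (fieldValues j₀))).contDiffAt
      have := contDiffAt_ringInverse ℝ (n := ω) (1 : (Endo (E n))ˣ)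
      simpa using this
    · simp
  · simpa using retraction_normTr_one hπ0
  · have t1 : Tendsto (fun v : fieldValues j₀ => (fieldAut r j₀ v)⁻¹) (𝓝 0) (𝓝 1) := by
      simpa using (tendsto_fieldAut r j₀).inv
    refine eventually_eq_fieldAut r j₀ hπ t1 ?_
    have t3 : Tendsto (fun v : fieldValues j₀ => (v, ((fieldAut r j₀ v)⁻¹).1 j₀.1.2)) (𝓝 0)
        (𝓝 (0, j₀.1.2)) :=
      tendsto_id.prodMk_nhds 
        ((tendsto_eval (ProjAut n M) j₀.1.2).comp (t1.prodMk_nhds tendsto_const_nhds))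
    filter_upwards [t3.eventually (eventually_rep_fieldAut_base r j₀)]
    rintro v ⟨-, A, hAv, hA⟩
    have h1 : (fieldAut r j₀ v).1 (((fieldAut r j₀ v)⁻¹).1 j₀.1.2) = j₀.1.2 :=
      (fieldAut r j₀ v).1.apply_symm_apply _
    have h2 := hA.inv
    rw [h1] at h2
    refine ⟨A.symm, ?_, h2⟩
    rw [← hAv]
    symm
    exact left_inv_eq_right_inv (Ring.inverse_mul_cancel _ (isUnit_toEnd A)) (toEnd_mul_symm A)

theorem fieldAut_conj (g : ProjAut n M) : ∃ c : fieldValues j₀ → fieldValues j₀,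
    ContDiffAt ℝ ω c 0 ∧ c 0 = 0 ∧
    ∀ᶠ v in 𝓝 0, g * fieldAut r j₀ v * g⁻¹ = fieldAut r j₀ (c v) := by
  obtain ⟨π, hπc, hπ0, hπ⟩ := exists_contDiff_retraction (fieldValues j₀)
  let m : M := g⁻¹.1 j₀.1.2
  let e := r.chart m
  have hm : m ∈ e.1.source := r.mem_source m
  have hgm : g.1 m = j₀.1.2 := g.1.apply_symm_apply _
  obtain ⟨G, hG⟩ := exists_rep_of_mem g.2 e.2 j₀.1.1.2 hm (by rw [hgm]; exact j₀.2)
  let S : fieldValues j₀ → Endo (E n) := fun v =>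
    toEnd G * (1 + extendField j₀ v (chartPt e hm)) * toEnd G.symm
  have hS0 : S 0 = 1 := by
    simp only [S, map_zero, Pi.zero_apply, add_zero, mul_one, toEnd_mul_symm]
  refine ⟨fun v => π (normTr (S v) - 1), contDiffAt_retraction_normTr hπc (S := S) ?_ hS0, by
    simp only [hS0]
    exact retraction_normTr_one hπ0, ?_⟩
  · let L : fieldValues j₀ →ₗ[ℝ] Endo (E n) := LinearMap.proj (chartPt e hm) ∘ₗ extendField j₀
    have hL : ContDiff ℝ ω L := contDiff_linearMap_submodule _ L
    exact ((contDiff_const.mul (contDiff_const.add hL)).mul contDiff_const).contDiffAt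
  · have t1 : Tendsto (fun v => g * fieldAut r j₀ v * g⁻¹) (𝓝 0) (𝓝 1) := by
      simpa using ((tendsto_fieldAut r j₀).const_mul g).mul_const g⁻¹
    refine eventually_eq_fieldAut r j₀ hπ t1 ?_
    have t2 : Tendsto (fun v : fieldValues j₀ => (v, m)) (𝓝 0) (𝓝 (0, m)) :=
      (Continuous.prodMk_left m).tendsto 0
    have t3 : Tendsto (fun v : fieldValues j₀ => (fieldAut r j₀ v).1 m) (𝓝 0) (𝓝 m) :=
      ((continuous_eval_subgroup (ProjAut n M)).tendsto (1, m)).comp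
        ((tendsto_fieldAut r j₀).prodMk_nhds tendsto_const_nhds)
    filter_upwards [t2.eventually (eventually_rep_fieldAut r j₀ e hm),
      t3.eventually hG.eventually]
    rintro v ⟨-, A, hAv, hA⟩ hGv
    have h1 := hG.inv
    rw [hgm] at h1
    refine ⟨(G.symm.trans A).trans G, ?_, ?_⟩
    · rw [toEnd_conj, hAv]
    · have h2 : g.1.symm j₀.1.2 = m := rfl
      have h3 : Rep j₀.1.1.1 e.1 ((fieldAut r j₀ v).1 ∘ g.1.symm) j₀.1.2 (G.symm.trans A) :=
        Rep.comp (f := g.1.symm) (by rw [h2]; exact hA) h1 g.1.symm.continuous.continuousAt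
      exact Rep.comp (f := (fieldAut r j₀ v).1 ∘ g.1.symm) (g := g.1)
        (by rw [Function.comp_apply, h2]; exact hGv) h3
        ((fieldAut r j₀ v).1.continuous.comp g.1.symm.continuous).continuousAt

/-- The parametrization of the group of projective automorphisms by the parallel fields. -/
theorem localParam_fieldAut : LocalParam (fieldAut r j₀) := by
  refine ⟨fieldAut_zero r j₀, eventually_continuousAt_fieldAut r j₀, exists_injOn_fieldAut r j₀,
    fun N hN => ?_, fieldAut_mul r j₀, fieldAut_inv r j₀, fieldAut_conj r j₀⟩
  filter_upwards [eventually_exists_field r j₀ hN]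
  rintro f ⟨v, hv, hf⟩
  exact ⟨v, hv, fieldAut_eq r j₀ hf⟩

end ProjLie

/-! ### Maps of the Benzécri manifold read in the cones -/

section ConeRep

variable {n : ℕ} {M : Type*} [TopologicalSpace M] [ChartedSpace (RP n) M]

/-- The map `F` of `B(M)` sends the point of `p` to the point of `q`, and near `p`, read in the
cones of `p` and `q`, it coincides with the map `a`. -/
def ConeRep (F : B n M → B n M) (p q : PreB n M) (a : E n → E n) : Prop :=
  q.vec = a p.vec ∧ ∀ᶠ w : Cone p.chart in 𝓝 p.2, ∃ w' : Cone q.chart, w'.1.1 = a w.1.1 ∧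
    F (B.mk ⟨p.1, w⟩) = B.mk ⟨q.1, w'⟩

variable {F G : B n M → B n M} {p q r : PreB n M} {a b : E n → E n}

theorem ConeRep.eq (h : ConeRep F p q a) : F (B.mk p) = B.mk q := by
  obtain ⟨w', hw, hF⟩ := h.2.self_of_nhds
  have : w' = q.2 := Subtype.ext (Subtype.ext (hw.trans h.1.symm))
  rw [this] at hF
  exact hF

theorem continuous_vec (e : atlas (RP n) M) : Continuous fun w : Cone e.1 => w.1.1 :=
  continuous_subtype_val.comp continuous_subtype_val

theorem ConeRep.eventually (h : ConeRep F p q a) : ∀ᶠ w : Cone p.chart in 𝓝 p.2,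
    ∃ w' : Cone q.chart, w'.1.1 = a w.1.1 ∧ ConeRep F ⟨p.1, w⟩ ⟨q.1, w'⟩ a := by
  filter_upwards [h.2.eventually_nhds] with w hw
  obtain ⟨w', hw', -⟩ := hw.self_of_nhds
  exact ⟨w', hw', hw', hw⟩

theorem ConeRep.comp (hG : ConeRep G q r b) (hF : ConeRep F p q a) (ha : ContinuousAt a p.vec) :
    ConeRep (G ∘ F) p r (b ∘ a) := by
  refine ⟨by rw [hG.1, hF.1]; rfl, ?_⟩
  have h1 : ∀ᶠ w : Cone p.chart in 𝓝 p.2, ∀ w' : Cone q.chart, w'.1.1 = a w.1.1 →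
      ∃ w'' : Cone r.chart, w''.1.1 = b w'.1.1 ∧ G (B.mk ⟨q.1, w'⟩) = B.mk ⟨r.1, w''⟩ := by
    have hemb := isOpenEmbedding_cone (n := n) q.chart
    have h2 := hG.2
    have h3 : ∀ᶠ v in 𝓝 q.vec, ∀ w' : Cone q.chart, w'.1.1 = v →
        ∃ w'' : Cone r.chart, w''.1.1 = b w'.1.1 ∧ G (B.mk ⟨q.1, w'⟩) = B.mk ⟨r.1, w''⟩ := by
      rw [show q.vec = (fun w : Cone q.chart => w.1.1) q.2 from rfl, ← hemb.map_nhds_eq,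
        eventually_map]
      filter_upwards [h2] with w hw w' hww'
      rwa [show w' = w from hemb.injective hww']
    rw [hF.1] at h3
    exact (ha.comp (f := fun w : Cone p.chart => w.1.1) (x := p.2)
      (continuous_vec p.1).continuousAt).eventually h3
  filter_upwards [h1, hF.2] with w hw hw'
  obtain ⟨w', hw1, hw2⟩ := hw'
  obtain ⟨w'', hw3, hw4⟩ := hw w' hw1
  exact ⟨w'', by rw [hw3, hw1]; rfl, by rw [Function.comp_apply, hw2, hw4]⟩

theorem exists_coneRep_id (h : B.mk p = B.mk q) : ∃ A : E n ≃ₗ[ℝ] E n, ConeRep id p q A :=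
  eventually_gluing h

/-- The local expression of a map between two given cones is unique, since `B(M)` contains a copy of
a neighbourhood of each point of a cone. -/
theorem ConeRep.eventuallyEq (ha : ConeRep F p q a) (hb : ConeRep F p q b)
    (hca : ContinuousAt a p.vec) (hcb : ContinuousAt b p.vec) : a =ᶠ[𝓝 p.vec] b := by
  have hemb := isOpenEmbedding_cone (n := n) p.chart
  have hq := norm_pos_iff.2 q.2.1.2
  have hball : ∀ c : E n → E n, ContinuousAt c p.vec → q.vec = c p.vec →
      ∀ᶠ w : Cone p.chart in 𝓝 p.2, ‖c w.1.1 - q.vec‖ < ‖q.vec‖ / 4 := by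
    intro c hc hcp
    have h1 : ContinuousAt (fun v => ‖c v - q.vec‖) p.vec := (hc.sub continuousAt_const).norm
    refine (h1.comp (f := fun w : Cone p.chart => w.1.1) (x := p.2)
      (continuous_vec p.1).continuousAt).eventually (gt_mem_nhds ?_)
    rw [Function.comp_apply, ← hcp, sub_self, norm_zero]
    positivity
  rw [show p.vec = (fun w : Cone p.chart => w.1.1) p.2 from rfl, ← hemb.map_nhds_eq]
  change ∀ᶠ v in map _ _, a v = b v
  rw [eventually_map]
  filter_upwards [ha.2, hb.2, hball a hca ha.1, hball b hcb hb.1] with w h1 h2 h3 h4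
  obtain ⟨w₁, e1, e2⟩ := h1
  obtain ⟨w₂, e3, e4⟩ := h2
  obtain ⟨c, k, hc, hw⟩ := exists_of_mk_eq (e2.symm.trans e4)
  rw [← e1, ← e3]
  rw [← e1] at h3
  rw [← e3] at h4
  exact (eq_of_close h3 h4 hc hw).symm

theorem map_coneMk_nhds (p : PreB n M) :
    map (fun w : Cone p.chart => B.mk (⟨p.1, w⟩ : PreB n M)) (𝓝 p.2) = 𝓝 (B.mk p) :=
  (isOpenMap_coneMk p.1).map_nhds_eq (continuous_coneMk p.1).continuousAt

theorem ConeRep.continuousAt (h : ConeRep F p q a) (ha : ContinuousAt a p.vec) :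
    ContinuousAt F (B.mk p) := by
  rw [ContinuousAt, ← map_coneMk_nhds, tendsto_map'_iff, h.eq, ← map_coneMk_nhds]
  have hemb := isOpenEmbedding_cone (n := n) q.chart
  have h1 : Tendsto (fun w : Cone p.chart => a w.1.1) (𝓝 p.2)
      (map (fun w : Cone q.chart => w.1.1) (𝓝 q.2)) := by
    have h0 : q.2.1.1 = a p.vec := h.1
    rw [hemb.map_nhds_eq, h0]
    exact ha.comp (f := fun w : Cone p.chart => w.1.1) (x := p.2)
      (continuous_vec p.1).continuousAt
  intro U hU
  have h2 := h1 (image_mem_map (mem_map.1 hU))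
  rw [mem_map]
  filter_upwards [h2, h.2] with w hw hw'
  obtain ⟨w₁, e1, e2⟩ := hw'
  obtain ⟨w₂, e3, e4⟩ := hw
  rw [hemb.injective (a₁ := w₂) (a₂ := w₁) (by simpa only [e1] using e4)] at e3
  rw [mem_preimage, Function.comp_apply, e2]
  exact e3

variable (n M) in
/-- The group of affine automorphisms of the Benzécri manifold. -/
abbrev AffAut : Subgroup (B n M ≃ₜ B n M) := autGroup (affineGroupoid n) (B n M)

theorem affineChart_mk {p : PreB n M} {w : Cone p.chart} (hw : ‖w.1.1 - p.vec‖ < ‖p.vec‖ / 4) :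
    affineChart p (B.mk ⟨p.1, w⟩) = w.1.1 := affineChart_ballToB p ⟨w, hw⟩

theorem mk_mem_affineChart {p : PreB n M} {w : Cone p.chart}
    (hw : ‖w.1.1 - p.vec‖ < ‖p.vec‖ / 4) : B.mk ⟨p.1, w⟩ ∈ (affineChart p).source := by
  rw [affineChart_source]
  exact ⟨⟨w, hw⟩, rfl⟩

theorem affineChart_symm {p : PreB n M} {w : Cone p.chart}
    (hw : ‖w.1.1 - p.vec‖ < ‖p.vec‖ / 4) : (affineChart p).symm w.1.1 = B.mk ⟨p.1, w⟩ := by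
  conv_lhs => rw [← affineChart_mk hw]
  exact (affineChart p).left_inv (mk_mem_affineChart hw)

theorem vec_close (p : PreB n M) : ‖p.2.1.1 - p.vec‖ < ‖p.vec‖ / 4 := by
  rw [sub_self, norm_zero]
  have := norm_pos_iff.2 p.2.1.2
  positivity

/-- In the cones, affine automorphisms are locally affine maps. -/
theorem exists_coneRep_of_mem {F : B n M ≃ₜ B n M} (hF : F ∈ AffAut n M)
    (h : F (B.mk p) = B.mk q) : ∃ a : E n ≃ᵃ[ℝ] E n, ConeRep F p q a := by
  obtain ⟨φ, rfl⟩ := hF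
  have hp := vec_close p
  obtain ⟨_, ⟨a, rfl⟩, ha⟩ := φ.mem_groupoid (affineChart p) (affineChart q) ⟨p, rfl⟩ ⟨q, rfl⟩
    p.vec (by
      rw [OpenPartialHomeomorph.trans_source, OpenPartialHomeomorph.trans_source]
      refine ⟨?_, trivial, ?_⟩
      · have := (affineChart p).map_source (mk_mem_affineChart hp)
        rwa [affineChart_mk hp] at this
      · change φ.toHomeomorph ((affineChart p).symm p.vec) ∈ (affineChart q).source
        rw [affineChart_symm hp]
        change φ.toHomeomorph (B.mk p) ∈ _
        rw [h]
        exact mk_mem_affineChart (vec_close q))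
  have ha' : ∀ᶠ v in 𝓝 p.vec, affineChart q (φ.toHomeomorph ((affineChart p).symm v)) = a v := ha
  refine ⟨a, ?_, ?_⟩
  · have h1 := ha'.self_of_nhds
    rw [affineChart_symm hp] at h1
    rw [← h1]
    change _ = affineChart q (φ.toHomeomorph (B.mk p))
    rw [h]
    exact (affineChart_mk (vec_close q)).symm
  · have h1 : ∀ᶠ w : Cone p.chart in 𝓝 p.2, φ.toHomeomorph (B.mk ⟨p.1, w⟩) ∈
        (affineChart q).source := by
      have hc : Continuous fun w : Cone p.chart =>
          φ.toHomeomorph (B.mk (⟨p.1, w⟩ : PreB n M)) :=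
        φ.toHomeomorph.continuous.comp (continuous_coneMk p.1)
      refine hc.continuousAt.eventually ((affineChart q).open_source.mem_nhds ?_)
      change φ.toHomeomorph (B.mk p) ∈ _
      rw [h]
      exact mk_mem_affineChart (vec_close q)
    filter_upwards [(continuous_vec p.1).continuousAt.eventually ha', h1,
      (isOpen_coneBall p).mem_nhds hp] with w hw1 hw2 hw3
    rw [affineChart_source] at hw2
    obtain ⟨v, hv⟩ := hw2
    refine ⟨v.1, ?_, hv.symm⟩
    rw [affineChart_symm hw3, ← hv, affineChart_ballToB] at hw1
    exact hw1

/-- The local expression of a map in the charts of `B(M)`. -/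
theorem ConeRep.eventually_affineChart {p q : PreB n M} {v : Cone p.chart} {v' : Cone q.chart}
    (h : ConeRep F ⟨p.1, v⟩ ⟨q.1, v'⟩ a) (ha : Continuous a)
    (hv : ‖v.1.1 - p.vec‖ < ‖p.vec‖ / 4) (hv' : ‖v'.1.1 - q.vec‖ < ‖q.vec‖ / 4) :
    ∀ᶠ y in 𝓝 v.1.1, affineChart q (F ((affineChart p).symm y)) = a y := by
  have hcont : Continuous fun w : Cone p.chart => ‖a w.1.1 - q.vec‖ :=
    ((ha.comp (continuous_vec p.1)).sub continuous_const).norm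
  have h0 : ‖a v.1.1 - q.vec‖ < ‖q.vec‖ / 4 := by
    have : v'.1.1 = a v.1.1 := h.1
    rwa [← this]
  have h1 : ∀ᶠ w : Cone p.chart in 𝓝 v, ‖a w.1.1 - q.vec‖ < ‖q.vec‖ / 4 :=
    (isOpen_lt hcont continuous_const).mem_nhds h0
  have h2 : ∀ᶠ w : Cone p.chart in 𝓝 v, ‖w.1.1 - p.vec‖ < ‖p.vec‖ / 4 :=
    (isOpen_coneBall p).mem_nhds hv
  have h4 : ∀ᶠ w : Cone p.chart in 𝓝 v, ∃ w' : Cone q.chart, w'.1.1 = a w.1.1 ∧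
      F (B.mk ⟨p.1, w⟩) = B.mk ⟨q.1, w'⟩ := h.2
  have h3 : ∀ᶠ w : Cone p.chart in 𝓝 v,
      affineChart q (F ((affineChart p).symm w.1.1)) = a w.1.1 := by
    refine ((h4.and h1).and h2).mono ?_
    rintro w ⟨⟨⟨w', e1, e2⟩, hw2⟩, hw1⟩
    rw [affineChart_symm hw1, e2, ← e1]
    rw [← e1] at hw2
    exact affineChart_mk hw2
  rw [← (isOpenEmbedding_cone (n := n) p.chart).map_nhds_eq v]
  exact h3

/-- Conversely, homeomorphisms which are locally affine maps in the cones are affine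
automorphisms. -/
theorem mem_affAut_of_forall {F : B n M ≃ₜ B n M}
    (h : ∀ p, ∃ q, ∃ a : E n ≃ᵃ[ℝ] E n, ConeRep F p q a) : F ∈ AffAut n M := by
  refine ⟨⟨F, ?_⟩, rfl⟩
  rintro _ _ ⟨p, rfl⟩ ⟨q, rfl⟩ x hx
  rw [OpenPartialHomeomorph.trans_source, OpenPartialHomeomorph.trans_source] at hx
  obtain ⟨hx1, -, hx2⟩ := hx
  have hx2 : F ((affineChart p).symm x) ∈ (affineChart q).source := hx2
  have hx3 := (affineChart p).map_target hx1
  have hx4 := (affineChart p).right_inv hx1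
  rw [affineChart_source] at hx2 hx3
  obtain ⟨v, hv⟩ := hx3
  obtain ⟨v', hv'⟩ := hx2
  rw [← hv] at hx4 hv'
  rw [affineChart_ballToB] at hx4
  obtain ⟨r, a, ha⟩ := h ⟨p.1, v.1⟩
  obtain ⟨A, hA⟩ := exists_coneRep_id (p := r) (q := ⟨q.1, v'.1⟩) (ha.eq.symm.trans hv'.symm)
  have hac : Continuous a := a.continuous_of_finiteDimensional
  have h1 : ConeRep F ⟨p.1, v.1⟩ ⟨q.1, v'.1⟩ (A ∘ a) := hA.comp ha hac.continuousAt
  have h2 := h1.eventually_affineChart ((continuous_linearEquiv A).comp hac) v.2 v'.2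
  rw [hx4] at h2
  exact ⟨_, ⟨a.trans A.toAffineEquiv, rfl⟩, h2⟩

end ConeRep

/-! ### The lifts of the projective automorphisms -/

section Lift

variable {n : ℕ} {M : Type*} [TopologicalSpace M] [ChartedSpace (RP n) M] {f : M → M} {τ σ : ℝ}
  {p q r : PreB n M}

theorem exists_liftRel_of_rep {p : PreB n M} {e' : atlas (RP n) M} (hf : f p.pt ∈ e'.1.source)
    {A : E n ≃ₗ[ℝ] E n} (hA : |LinearMap.det (A : E n →ₗ[ℝ] E n)| = 1)
    (hR : Rep p.chart e'.1 f p.pt A) {t : ℝ} (ht : |t| = Real.exp τ) :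
    ∃ w' : Cone e'.1, w'.1.1 = t • A p.vec ∧ LiftRel f τ p ⟨e', w'⟩ := by
  have ht0 : t ≠ 0 := by
    rintro rfl
    rw [abs_zero] at ht
    exact (Real.exp_pos τ).ne ht
  have hne : t • A p.vec ≠ 0 :=
    smul_ne_zero ht0 ((map_ne_zero_iff A A.injective).2 p.2.1.2)
  have hline : Projectivization.mk' ℝ (⟨t • A p.vec, hne⟩ : {v : E n // v ≠ 0})
      = e'.1 (f p.pt) := by
    rw [hR.eq, p.chart_pt, smul_mk', mk'_eq_iff]
    exact ⟨t, rfl⟩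
  refine ⟨⟨⟨_, hne⟩, by rw [hline]; exact e'.1.map_source hf⟩, rfl, ?_, A, hA, hR, t, ht, rfl⟩
  change e'.1.symm _ = _
  rw [hline, e'.1.left_inv hf]

/-- Points corresponding to each other under a lift have neighbourhoods which correspond to each
other under a linear map. -/
theorem LiftRel.eventually (h : LiftRel f τ p q) (hc : ContinuousAt f p.pt) :
    ∃ L : E n ≃ₗ[ℝ] E n, q.vec = L p.vec ∧ ∀ᶠ w : Cone p.chart in 𝓝 p.2, ∃ w' : Cone q.chart,
      w'.1.1 = L w.1.1 ∧ LiftRel f τ ⟨p.1, w⟩ ⟨q.1, w'⟩ := by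
  obtain ⟨h1, A, hA, hR, t, ht, hv⟩ := h
  have ht0 : t ≠ 0 := by
    rintro rfl
    rw [abs_zero] at ht
    exact (Real.exp_pos τ).ne ht
  have hev : ∀ᶠ x in 𝓝 p.pt, Rep p.chart q.chart f x A ∧ f x ∈ q.chart.source :=
    hR.eventually.and (hc.eventually (q.chart.open_source.mem_nhds (by rw [← h1]; exact q.pt_mem)))
  refine ⟨smulEquiv t ht0 A, hv, ?_⟩
  filter_upwards [(continuous_pt p.1).continuousAt.eventually hev] with w hw
  exact exists_liftRel_of_rep (p := ⟨p.1, w⟩) (e' := q.1) hw.2 hA hw.1 ht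

theorem LiftRel.refl (p : PreB n M) : LiftRel id 0 p p :=
  ⟨rfl, LinearEquiv.refl ℝ _, by simp, Rep.id, 1, by simp, by simp⟩

theorem LiftRel.eq_zero (h : LiftRel id τ p p) : τ = 0 := by
  obtain ⟨-, A, hA, hR, t, ht, hv⟩ := h
  obtain ⟨c, hc, h2⟩ := eq_or_neg_of_eventually p.pt_mem hA hR
  have h3 := congrArg norm hv
  rw [h2, smul_smul, norm_smul, norm_mul, Real.norm_eq_abs, Real.norm_eq_abs, hc, mul_one, ht,
    right_eq_mul₀ (norm_ne_zero_iff.2 p.2.1.2), Real.exp_eq_one_iff] at h3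
  exact h3

/-- The relation `LiftRel f τ` induces a map of `B(M)`, which depends on `τ` only modulo `log 2`. -/
theorem mk_eq_of_liftRel {f : M ≃ₜ M} {p' q' : PreB n M} (hp : B.mk p = B.mk p')
    (h : LiftRel f τ p q) (h' : LiftRel f σ p' q') {k : ℤ} (hk : σ = τ + k * Real.log 2) :
    B.mk q = B.mk q' := by
  obtain ⟨l, hl⟩ := mk_eq_iff.1 hp
  have h1 := (h'.comp hl continuousAt_id).comp h.symm f.symm.continuous.continuousAt
  rw [Function.comp_id, f.self_comp_symm] at h1
  refine mk_eq_iff.2 ⟨k + l, ?_⟩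
  convert h1 using 1
  rw [hk]
  push_cast
  ring

variable [HasGroupoid M (projectiveGroupoid n)]

theorem exists_liftRel_right {f : M ≃ₜ M} (hf : f ∈ ProjAut n M) (τ : ℝ) (p : PreB n M)
    (e' : atlas (RP n) M) (he : f p.pt ∈ e'.1.source) :
    ∃ w' : Cone e'.1, LiftRel f τ p ⟨e', w'⟩ := by
  obtain ⟨A, hA⟩ := exists_rep_of_mem hf p.1.2 e'.2 p.pt_mem he
  obtain ⟨C, hC, hCR⟩ := hA.exists_det
  obtain ⟨w', -, hw'⟩ := exists_liftRel_of_rep he hC hCR (abs_of_pos (Real.exp_pos τ))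
  exact ⟨w', hw'⟩

theorem exists_liftRel_mk (f : ProjAut n M) (τ : ℝ) (b : B n M) :
    ∃ p q : PreB n M, B.mk p = b ∧ LiftRel f.1 τ p q := by
  obtain ⟨p, rfl⟩ := Quotient.exists_rep b
  obtain ⟨w, hw⟩ := exists_liftRel_right f.2 τ p ⟨chartAt (RP n) (f.1 p.pt), chart_mem_atlas _ _⟩
    (mem_chart_source _ _)
  exact ⟨p, _, rfl, hw⟩

/-- The lift to `B(M)` of a projective automorphism of `M`, composed with the homothety of ratio
`exp τ`. -/
def liftFun (f : ProjAut n M) (τ : ℝ) (b : B n M) : B n M :=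
  B.mk (exists_liftRel_mk f τ b).choose_spec.choose

theorem liftFun_mk {f : ProjAut n M} (h : LiftRel f.1 τ p q) :
    liftFun f τ (B.mk p) = B.mk q := by
  obtain ⟨h1, h2⟩ := (exists_liftRel_mk f τ (B.mk p)).choose_spec.choose_spec
  exact mk_eq_of_liftRel h1 h2 h (k := 0) (by simp)

theorem exists_liftFun_mk (f : ProjAut n M) (τ : ℝ) (b : B n M) :
    ∃ p q : PreB n M, B.mk p = b ∧ LiftRel f.1 τ p q ∧ liftFun f τ b = B.mk q := by
  obtain ⟨p, q, rfl, h⟩ := exists_liftRel_mk f τ b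
  exact ⟨p, q, rfl, h, liftFun_mk h⟩

theorem proj_liftFun (f : ProjAut n M) (τ : ℝ) (b : B n M) :
    (liftFun f τ b).proj = f.1 b.proj := by
  obtain ⟨p, q, rfl, h, hq⟩ := exists_liftFun_mk f τ b
  rw [hq]
  exact h.1

theorem liftFun_mul (f g : ProjAut n M) (σ τ : ℝ) (b : B n M) :
    liftFun (f * g) (σ + τ) b = liftFun f σ (liftFun g τ b) := by
  obtain ⟨p, q, rfl, h, hq⟩ := exists_liftFun_mk g τ b
  obtain ⟨w, hw⟩ := exists_liftRel_right f.2 σ q ⟨chartAt (RP n) (f.1 q.pt), chart_mem_atlas _ _⟩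
    (mem_chart_source _ _)
  rw [hq, liftFun_mk hw]
  exact liftFun_mk (hw.comp h g.1.continuous.continuousAt)

theorem liftFun_one (b : B n M) : liftFun (1 : ProjAut n M) 0 b = b := by
  obtain ⟨p, rfl⟩ := Quotient.exists_rep b
  exact liftFun_mk (LiftRel.refl p)

theorem liftFun_add_int_mul (f : ProjAut n M) (τ : ℝ) (k : ℤ) (b : B n M) :
    liftFun f (τ + k * Real.log 2) b = liftFun f τ b := by
  obtain ⟨p, q, hp, h, hq⟩ := exists_liftFun_mk f τ b
  obtain ⟨p', q', hp', h', hq'⟩ := exists_liftFun_mk f (τ + k * Real.log 2) b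
  rw [hq, hq']
  exact (mk_eq_of_liftRel (hp.trans hp'.symm) h h' rfl).symm

theorem exists_eq_add_of_liftFun_eq {b : B n M}
    (h : liftFun (1 : ProjAut n M) τ b = liftFun 1 σ b) : ∃ k : ℤ, σ = τ + k * Real.log 2 := by
  obtain ⟨p, q, rfl, h1, hq⟩ := exists_liftFun_mk (1 : ProjAut n M) τ b
  obtain ⟨p', q', hp', h2, hq'⟩ := exists_liftFun_mk (1 : ProjAut n M) σ (B.mk p)
  obtain ⟨k, hk⟩ := mk_eq_iff.1 hp'.symm
  rw [hq, hq'] at h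
  obtain ⟨l, hl⟩ := mk_eq_iff.1 h
  have h3 : LiftRel id (l * Real.log 2 + τ) p q' := hl.comp h1 continuousAt_id
  have h4 : LiftRel id (σ + k * Real.log 2) p q' := h2.comp hk continuousAt_id
  have h5 := (h4.comp (LiftRel.symm (f := Homeomorph.refl M) h3) continuousAt_id).eq_zero
  refine ⟨l - k, ?_⟩
  push_cast
  linarith

theorem exists_coneRep_liftFun {f : ProjAut n M} (h : LiftRel f.1 τ p q) :
    ∃ L : E n ≃ₗ[ℝ] E n, ConeRep (liftFun f τ) p q L := by
  obtain ⟨L, hL, hev⟩ := h.eventually f.1.continuous.continuousAt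
  refine ⟨L, hL, ?_⟩
  filter_upwards [hev] with w hw
  obtain ⟨w', h1, h2⟩ := hw
  exact ⟨w', h1, liftFun_mk h2⟩

theorem continuous_liftFun (f : ProjAut n M) (τ : ℝ) : Continuous (liftFun f τ) := by
  refine continuous_iff_continuousAt.2 fun b => ?_
  obtain ⟨p, q, rfl, h⟩ := exists_liftRel_mk f τ b
  obtain ⟨L, hL⟩ := exists_coneRep_liftFun h
  exact hL.continuousAt (continuous_linearEquiv L).continuousAt

theorem liftFun_inv_apply (f : ProjAut n M) (τ : ℝ) (b : B n M) :
    liftFun f⁻¹ (-τ) (liftFun f τ b) = b := by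
  rw [← liftFun_mul, inv_mul_cancel, neg_add_cancel, liftFun_one]

/-- The lift of a projective automorphism as a homeomorphism of `B(M)`. -/
def liftHomeo (f : ProjAut n M) (τ : ℝ) : B n M ≃ₜ B n M where
  toFun := liftFun f τ
  invFun := liftFun f⁻¹ (-τ)
  left_inv := liftFun_inv_apply f τ
  right_inv b := by
    have := liftFun_inv_apply f⁻¹ (-τ) b
    rwa [inv_inv, neg_neg] at this
  continuous_toFun := continuous_liftFun f τ
  continuous_invFun := continuous_liftFun f⁻¹ (-τ)

theorem liftHomeo_mem (f : ProjAut n M) (τ : ℝ) : liftHomeo f τ ∈ AffAut n M := by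
  refine mem_affAut_of_forall fun p => ?_
  obtain ⟨w, hw⟩ := exists_liftRel_right f.2 τ p ⟨chartAt (RP n) (f.1 p.pt), chart_mem_atlas _ _⟩
    (mem_chart_source _ _)
  obtain ⟨L, hL⟩ := exists_coneRep_liftFun hw
  exact ⟨_, L.toAffineEquiv, hL⟩

variable (n M) in
/-- The group morphism which lifts a projective automorphism of `M` to `B(M)` and composes it with
a homothety. -/
def liftHom : ProjAut n M × Multiplicative ℝ →* AffAut n M where
  toFun x := ⟨liftHomeo x.1 x.2.toAdd, liftHomeo_mem _ _⟩
  map_one' := Subtype.ext (Homeomorph.ext liftFun_one)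
  map_mul' x y := Subtype.ext (Homeomorph.ext fun b => liftFun_mul x.1 y.1 _ _ b)

theorem liftHom_apply (x : ProjAut n M × Multiplicative ℝ) (b : B n M) :
    (liftHom n M x).1 b = liftFun x.1 x.2.toAdd b := rfl

end Lift

/-! ### The affine automorphisms are lifts -/

section Linear

variable {n : ℕ} {M : Type*} [TopologicalSpace M] [ChartedSpace (RP n) M]

/-- The multiplication of the vectors of a cone by `exp s`. -/
def coneScale (e : atlas (RP n) M) (s : ℝ) (w : Cone e.1) : Cone e.1 :=
  ⟨⟨Real.exp s • w.1.1, smul_ne_zero (Real.exp_pos s).ne' w.1.2⟩, by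
    have : Projectivization.mk' ℝ (⟨Real.exp s • w.1.1, smul_ne_zero (Real.exp_pos s).ne' w.1.2⟩ :
        {v : E n // v ≠ 0}) = Projectivization.mk' ℝ w.1 := (mk'_eq_iff _ _).2 ⟨_, rfl⟩
    rw [this]
    exact w.2⟩

/-- The multiplication of the vector of `p` by `exp s`. -/
def PreB.scale (s : ℝ) (p : PreB n M) : PreB n M := ⟨p.1, coneScale p.1 s p.2⟩

theorem continuous_coneScale (e : atlas (RP n) M) (w : Cone e.1) :
    Continuous fun s => coneScale e s w := by
  refine Continuous.subtype_mk (Continuous.subtype_mk ?_ _) _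
  exact Real.continuous_exp.smul continuous_const

theorem liftRel_scale (s : ℝ) (p : PreB n M) : LiftRel id s p (p.scale s) := by
  obtain ⟨w, hw, h⟩ := exists_liftRel_of_rep (p := p) (f := id) (e' := p.1) p.pt_mem
    (A := LinearEquiv.refl ℝ _) (by simp) Rep.id (abs_of_pos (Real.exp_pos s))
  have : w = (p.scale s).2 := Subtype.ext (Subtype.ext hw)
  rwa [this] at h

theorem scale_vec (s : ℝ) (p : PreB n M) : (p.scale s).vec = Real.exp s • p.vec := rfl

theorem scale_zero (p : PreB n M) : p.scale 0 = p := by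
  refine Sigma.ext rfl (heq_of_eq (Subtype.ext (Subtype.ext ?_)))
  change Real.exp 0 • p.vec = p.vec
  rw [Real.exp_zero, one_smul]

variable {F : B n M ≃ₜ B n M}

theorem affineEquiv_eq_of_eventuallyEq {a a' : E n ≃ᵃ[ℝ] E n} {v : E n} (h : a =ᶠ[𝓝 v] a') :
    a = a' := by
  have h0 := h.self_of_nhds
  ext1 x
  have hc : Tendsto (fun ε : ℝ => AffineMap.lineMap v x ε) (𝓝 0) (𝓝 v) := by
    have h1 : Continuous fun ε : ℝ => AffineMap.lineMap v x ε := AffineMap.lineMap_continuous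
    have := h1.tendsto 0
    rwa [AffineMap.lineMap_apply_zero] at this
  have h1 : ∀ᶠ ε in 𝓝[≠] (0 : ℝ), a (AffineMap.lineMap v x ε) = a' (AffineMap.lineMap v x ε) :=
    (hc.eventually h).filter_mono nhdsWithin_le_nhds
  obtain ⟨ε, hε, hε0⟩ := (h1.and self_mem_nhdsWithin).exists
  have h2 : ∀ a : E n ≃ᵃ[ℝ] E n, a (AffineMap.lineMap v x ε) = AffineMap.lineMap (a v) (a x) ε :=
    fun a => a.toAffineMap.apply_lineMap v x ε
  rw [h2, h2, h0, AffineMap.lineMap_apply_module, AffineMap.lineMap_apply_module,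
    add_right_inj] at hε
  exact smul_right_injective _ hε0 hε

/-- A locally constant property holds everywhere on a connected space as soon as it holds
somewhere. -/
theorem iff_of_eventually {X : Type*} [TopologicalSpace X] [PreconnectedSpace X] {P : X → Prop}
    (h : ∀ x, ∀ᶠ y in 𝓝 x, (P y ↔ P x)) (x y : X) : P x ↔ P y := by
  have : IsLocallyConstant P := by
    rw [IsLocallyConstant.iff_eventually_eq]
    intro x
    filter_upwards [h x] with y hy
    exact propext hy
  exact (this.apply_eq_of_preconnectedSpace x y).to_iff

/-- The vector `z` is sent to the origin by the affine extension of the local expression of `F`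
near `p`. -/
def IsCenter (F : B n M → B n M) (p : PreB n M) (z : E n) : Prop :=
  ∃ q, ∃ a : E n ≃ᵃ[ℝ] E n, ConeRep F p q a ∧ a z = 0

theorem continuous_affineEquiv (a : E n ≃ᵃ[ℝ] E n) : Continuous a :=
  a.continuous_of_finiteDimensional

theorem IsCenter.unique {F : B n M → B n M} {p : PreB n M} {z z' : E n} (h : IsCenter F p z)
    (h' : IsCenter F p z') : z = z' := by
  obtain ⟨q, a, ha, hz⟩ := h
  obtain ⟨q', a', ha', hz'⟩ := h'
  obtain ⟨A, hA⟩ := exists_coneRep_id (ha.eq.symm.trans ha'.eq)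
  have h1 : ConeRep F p q' (a.trans A.toAffineEquiv) :=
    hA.comp ha (continuous_affineEquiv a).continuousAt
  have h2 := affineEquiv_eq_of_eventuallyEq (h1.eventuallyEq ha'
    (continuous_affineEquiv _).continuousAt (continuous_affineEquiv _).continuousAt)
  refine a'.injective ?_
  rw [hz', ← h2]
  change A (a z) = 0
  rw [hz, map_zero]

/-- The center is constant along the rays, where it is locally constant by uniqueness. -/
theorem IsCenter.scale {F : B n M → B n M} {p : PreB n M} {z : E n}
    (h : ∀ p : PreB n M, ∃ z, IsCenter F p z) (hz : IsCenter F p z) (s : ℝ) :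
    IsCenter F (p.scale s) z := by
  have key : ∀ s, ∀ᶠ t in 𝓝 s, (IsCenter F (p.scale t) z ↔ IsCenter F (p.scale s) z) := by
    intro s
    obtain ⟨z', q, a, ha, hz'⟩ := h (p.scale s)
    filter_upwards [(continuous_coneScale p.1 p.2).continuousAt.eventually ha.eventually]
    rintro t ⟨w', -, hw⟩
    have h1 : IsCenter F (p.scale s) z' := ⟨q, a, ha, hz'⟩
    have h2 : IsCenter F (p.scale t) z' := ⟨_, a, hw, hz'⟩
    constructor
    · intro h3
      rwa [h3.unique h2]
    · intro h3
      rwa [h3.unique h1]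
  rw [iff_of_eventually key s 0, scale_zero]
  exact hz

/-- The local expressions of a locally affine map are linear: the vector which they send to the
origin is constant along the rays, and it is doubled by the homothety of ratio `2`, which is the
identity of `B(M)`. -/
theorem isCenter_zero {F : B n M → B n M} (h : ∀ p : PreB n M, ∃ z, IsCenter F p z)
    (p : PreB n M) : IsCenter F p 0 := by
  obtain ⟨z, hz⟩ := h p
  have h1 := hz.scale h (Real.log 2)
  obtain ⟨q, a, ha, haz⟩ := hz
  have h2 : IsCenter F (p.scale (Real.log 2)) ((2 : ℝ) • z) := by
    let D : E n ≃ₗ[ℝ] E n := LinearEquiv.smulOfNeZero ℝ (E n) (2⁻¹ : ℝ) (by norm_num)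
    have hD : ConeRep id (p.scale (Real.log 2)) p D := by
      refine ⟨?_, Eventually.of_forall fun w => ?_⟩
      · change p.vec = (2⁻¹ : ℝ) • Real.exp (Real.log 2) • p.vec
        rw [Real.exp_log two_pos, smul_smul, inv_mul_cancel₀ two_ne_zero, one_smul]
      · have h2 : Real.exp (-Real.log 2) = 2⁻¹ := by rw [Real.exp_neg, Real.exp_log two_pos]
        refine ⟨coneScale p.1 (-Real.log 2) w, ?_, mk_eq_of_eq_smul (c := 2⁻¹) (k := -1) ?_ ?_⟩
        · exact congrArg (· • w.1.1) h2
        · rw [abs_of_pos (by norm_num), zpow_neg_one]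
        · exact congrArg (· • w.1.1) h2
    refine ⟨q, D.toAffineEquiv.trans a, ha.comp hD (continuous_linearEquiv D).continuousAt, ?_⟩
    change a ((2⁻¹ : ℝ) • (2 : ℝ) • z) = 0
    rw [smul_smul, inv_mul_cancel₀ two_ne_zero, one_smul, haz]
  have h3 := h1.unique h2
  have h4 : z = 0 := by
    rw [two_smul] at h3
    exact left_eq_add.1 h3
  rw [← h4]
  exact ⟨q, a, ha, haz⟩

theorem exists_isCenter {F : B n M ≃ₜ B n M} (hF : F ∈ AffAut n M) (p : PreB n M) :
    ∃ z, IsCenter F p z := by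
  obtain ⟨q, hq⟩ := Quotient.exists_rep (F (B.mk p))
  obtain ⟨a, ha⟩ := exists_coneRep_of_mem hF hq.symm
  exact ⟨a.symm 0, q, a, ha, a.apply_symm_apply 0⟩

theorem exists_linear_coneRep {F : B n M ≃ₜ B n M} (hF : F ∈ AffAut n M) {p q : PreB n M}
    (h : F (B.mk p) = B.mk q) : ∃ L : E n ≃ₗ[ℝ] E n, ConeRep F p q L := by
  obtain ⟨a, ha⟩ := exists_coneRep_of_mem hF h
  have h1 : IsCenter F p (a.symm 0) := ⟨q, a, ha, a.apply_symm_apply 0⟩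
  have h2 := h1.unique (isCenter_zero (exists_isCenter hF) p)
  have h3 : a 0 = 0 := by
    have := a.apply_symm_apply 0
    rwa [h2] at this
  have h4 : (a : E n → E n) = a.linear := by
    funext v
    have := a.toAffineMap.decomp
    have := congrFun this v
    simpa [h3] using this
  rw [h4] at ha
  exact ⟨a.linear, ha⟩

end Linear

/-! ### The projection of an affine automorphism -/

section Projection

variable {n : ℕ} {M : Type*} [TopologicalSpace M] [ChartedSpace (RP n) M]

theorem surjective_proj : Function.Surjective (B.proj : B n M → M) := by
  intro m
  obtain ⟨w, hw⟩ := exists_pt_eq (n := n) ⟨chartAt (RP n) m, chart_mem_atlas _ _⟩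
    (mem_chart_source (RP n) m)
  exact ⟨B.mk ⟨_, w⟩, hw⟩

theorem isOpenQuotientMap_proj : IsOpenQuotientMap (B.proj : B n M → M) := by
  refine ⟨surjective_proj, continuous_proj, fun U hU => ?_⟩
  have h1 : IsOpenMap (PreB.pt : PreB n M → M) := isOpenMap_sigma.2 isOpenMap_pt
  have h2 := h1 _ (hU.preimage continuous_mk)
  convert h2 using 1
  ext m
  constructor
  · rintro ⟨b, hb, rfl⟩
    obtain ⟨p, rfl⟩ := Quotient.exists_rep b
    exact ⟨p, hb, rfl⟩
  · rintro ⟨p, hp, rfl⟩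
    exact ⟨B.mk p, hp, rfl⟩

variable [HasGroupoid M (projectiveGroupoid n)] {F : B n M ≃ₜ B n M}

theorem liftFun_one_mk (s : ℝ) (p : PreB n M) :
    liftFun (1 : ProjAut n M) s (B.mk p) = B.mk (p.scale s) :=
  liftFun_mk (liftRel_scale s p)

theorem liftFun_one_add (s t : ℝ) (b : B n M) :
    liftFun (1 : ProjAut n M) (s + t) b = liftFun 1 s (liftFun 1 t b) := by
  rw [← liftFun_mul, one_mul]

theorem liftFun_one_injective (s : ℝ) :
    Function.Injective (liftFun (1 : ProjAut n M) s) := (liftHomeo 1 s).injective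

theorem eventually_apply_liftFun_one (hF : F ∈ AffAut n M) (b : B n M) :
    ∀ᶠ u in 𝓝 0, F (liftFun 1 u b) = liftFun 1 u (F b) := by
  obtain ⟨p, rfl⟩ := Quotient.exists_rep b
  obtain ⟨q, hq⟩ := Quotient.exists_rep (F (B.mk p))
  obtain ⟨L, hL⟩ := exists_linear_coneRep hF hq.symm
  have h0 : coneScale p.1 0 p.2 = p.2 := by
    refine Subtype.ext (Subtype.ext ?_)
    change Real.exp 0 • p.vec = p.vec
    rw [Real.exp_zero, one_smul]
  have h1 : Tendsto (fun s => coneScale p.1 s p.2) (𝓝 0) (𝓝 p.2) := by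
    have := (continuous_coneScale p.1 p.2).tendsto 0
    rwa [h0] at this
  filter_upwards [h1.eventually hL.2] with u hu
  obtain ⟨w', hw, hw'⟩ := hu
  have h2 : w' = coneScale q.1 u q.2 := by
    refine Subtype.ext (Subtype.ext ?_)
    change w'.1.1 = Real.exp u • q.vec
    rw [hw, hL.1, ← map_smul]
    rfl
  change F (liftFun 1 u (B.mk p)) = liftFun 1 u (F (B.mk p))
  rw [liftFun_one_mk, ← hq]
  change _ = liftFun 1 u (B.mk q)
  rw [liftFun_one_mk]
  rw [h2] at hw'
  exact hw'

/-- Affine automorphisms of `B(M)` commute with the homotheties. -/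
theorem apply_liftFun_one (hF : F ∈ AffAut n M) (s : ℝ) (b : B n M) :
    F (liftFun 1 s b) = liftFun 1 s (F b) := by
  have key : ∀ s : ℝ, ∀ᶠ t in 𝓝 s,
      (F (liftFun 1 t b) = liftFun 1 t (F b) ↔ F (liftFun 1 s b) = liftFun 1 s (F b)) := by
    intro s
    have h1 : Tendsto (fun t : ℝ => t - s) (𝓝 s) (𝓝 0) := by
      have : Continuous fun t : ℝ => t - s := by fun_prop
      simpa using this.tendsto s
    filter_upwards [h1.eventually (eventually_apply_liftFun_one hF (liftFun 1 s b))] with t ht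
    have h2 : ∀ b : B n M, liftFun 1 t b = liftFun 1 (t - s) (liftFun 1 s b) := by
      intro b
      rw [← liftFun_one_add, sub_add_cancel]
    rw [h2, h2, ht, (liftFun_one_injective _).eq_iff]
  rw [iff_of_eventually key s 0, liftFun_one, liftFun_one]

theorem exists_liftFun_one_eq {b b' : B n M} (h : b.proj = b'.proj) :
    ∃ τ, b' = liftFun 1 τ b := by
  obtain ⟨p, rfl⟩ := Quotient.exists_rep b
  obtain ⟨q, rfl⟩ := Quotient.exists_rep b'
  obtain ⟨τ, hτ⟩ := exists_liftRel (p := p) (q := q) (one_mem (ProjAut n M)) h.symm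
  exact ⟨τ, (liftFun_mk (f := 1) hτ).symm⟩

theorem proj_liftFun_one (s : ℝ) (b : B n M) : (liftFun 1 s b).proj = b.proj :=
  proj_liftFun 1 s b

/-- Affine automorphisms of `B(M)` preserve the fibres of the projection. -/
theorem proj_apply_eq (hF : F ∈ AffAut n M) {b b' : B n M} (h : b.proj = b'.proj) :
    (F b).proj = (F b').proj := by
  obtain ⟨τ, rfl⟩ := exists_liftFun_one_eq h
  rw [apply_liftFun_one hF, proj_liftFun_one]

/-- The map of `M` under an affine automorphism of `B(M)`. The choice of a point in each fibre is
irrelevant for affine automorphisms, which preserve the fibres. -/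
def projMap (F : B n M ≃ₜ B n M) (x : M) : M := (F (Function.surjInv surjective_proj x)).proj

theorem projMap_proj (hF : F ∈ AffAut n M) (b : B n M) : projMap F b.proj = (F b).proj :=
  proj_apply_eq hF (Function.surjInv_eq _ _)

theorem projMap_projMap {G : B n M ≃ₜ B n M} (hF : F ∈ AffAut n M) (hG : G ∈ AffAut n M) (x : M) :
    projMap G (projMap F x) = projMap (G * F) x := by
  obtain ⟨b, rfl⟩ := surjective_proj (n := n) x
  rw [projMap_proj hF, projMap_proj hG, projMap_proj (mul_mem hG hF)]
  rfl

theorem projMap_one (x : M) : projMap (1 : B n M ≃ₜ B n M) x = x := by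
  obtain ⟨b, rfl⟩ := surjective_proj (n := n) x
  exact projMap_proj (one_mem _) b

theorem continuous_projMap (hF : F ∈ AffAut n M) : Continuous (projMap F) := by
  rw [(isOpenQuotientMap_proj (n := n)).isQuotientMap.continuous_iff]
  have : projMap F ∘ B.proj = fun b : B n M => (F b).proj := funext (projMap_proj hF)
  rw [this]
  exact continuous_proj.comp F.continuous

/-- The homeomorphism of `M` under an affine automorphism of `B(M)`. -/
def projHomeo (F : AffAut n M) : M ≃ₜ M where
  toFun := projMap F.1
  invFun := projMap F.1⁻¹
  left_inv x := by rw [projMap_projMap F.2 (inv_mem F.2), inv_mul_cancel, projMap_one]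
  right_inv x := by rw [projMap_projMap (inv_mem F.2) F.2, mul_inv_cancel, projMap_one]
  continuous_toFun := continuous_projMap F.2
  continuous_invFun := continuous_projMap (inv_mem F.2)

theorem ConeRep.rep_projMap (hF : F ∈ AffAut n M) {p q : PreB n M} {L : E n ≃ₗ[ℝ] E n}
    (h : ConeRep F p q L) : Rep p.chart q.chart (projMap F) p.pt L := by
  have h1 : 𝓝 p.pt ≤ map (fun w : Cone p.chart => PreB.pt (⟨p.1, w⟩ : PreB n M)) (𝓝 p.2) :=
    (isOpenMap_pt p.1).nhds_le p.2
  refine h1 ?_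
  rw [mem_map]
  filter_upwards [h.2] with w hw
  obtain ⟨w', hw', hww⟩ := hw
  have h2 : projMap F (PreB.pt ⟨p.1, w⟩) = PreB.pt ⟨q.1, w'⟩ := by
    have := projMap_proj hF (B.mk ⟨p.1, w⟩)
    rw [hww] at this
    exact this
  change q.chart (projMap F (PreB.pt ⟨p.1, w⟩)) = L • p.chart (PreB.pt ⟨p.1, w⟩)
  rw [h2, PreB.chart_pt ⟨q.1, w'⟩, PreB.chart_pt ⟨p.1, w⟩, smul_mk', mk'_eq_iff]
  exact ⟨1, by rw [one_smul]; exact hw'.symm⟩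

theorem projHomeo_mem (F : AffAut n M) : projHomeo F ∈ ProjAut n M := by
  refine mem_projAut_of_forall fun x => ?_
  obtain ⟨b, rfl⟩ := surjective_proj (n := n) x
  obtain ⟨p, rfl⟩ := Quotient.exists_rep b
  obtain ⟨q, hq⟩ := Quotient.exists_rep (F.1 (B.mk p))
  obtain ⟨L, hL⟩ := exists_linear_coneRep F.2 hq.symm
  refine ⟨p.chart, p.1.2, q.chart, q.1.2, p.pt_mem, ?_, L, hL.rep_projMap F.2⟩
  have : projMap F.1 (B.mk p).proj = q.pt := by
    rw [projMap_proj F.2, ← hq]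
    rfl
  change projMap F.1 (B.mk p).proj ∈ _
  rw [this]
  exact q.pt_mem

variable (n M) in
/-- The group morphism which sends an affine automorphism of `B(M)` to the projective automorphism
of `M` under it. -/
def projHom : AffAut n M →* ProjAut n M where
  toFun F := ⟨projHomeo F, projHomeo_mem F⟩
  map_one' := Subtype.ext (Homeomorph.ext projMap_one)
  map_mul' F G := Subtype.ext (Homeomorph.ext fun x => (projMap_projMap G.2 F.2 x).symm)

theorem projHom_proj (F : AffAut n M) (b : B n M) : (projHom n M F).1 b.proj = (F.1 b).proj :=
  projMap_proj F.2 b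

theorem projHom_liftHom (x : ProjAut n M × Multiplicative ℝ) :
    projHom n M (liftHom n M x) = x.1 := by
  refine Subtype.ext (Homeomorph.ext fun m => ?_)
  obtain ⟨b, rfl⟩ := surjective_proj (n := n) m
  rw [projHom_proj, liftHom_apply, proj_liftFun]

/-- An affine automorphism of `B(M)` over the identity of `M` is a homothety near every point. -/
theorem eventually_eq_liftFun_one {G : AffAut n M} (hG : projHom n M G = 1) (b : B n M) :
    ∃ τ, ∀ᶠ b' in 𝓝 b, G.1 b' = liftFun 1 τ b' := by
  obtain ⟨p, rfl⟩ := Quotient.exists_rep b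
  have h1 : (G.1 (B.mk p)).proj = (B.mk p).proj := by rw [← projHom_proj, hG]; rfl
  obtain ⟨τ, hτ⟩ := exists_liftFun_one_eq h1.symm
  rw [liftFun_one_mk] at hτ
  obtain ⟨L, hL⟩ := exists_linear_coneRep G.2 hτ
  have h2 : Rep p.chart p.chart id p.pt L := by
    refine (hL.rep_projMap G.2).congr (Eventually.of_forall fun x => ?_)
    exact congrArg (fun f : ProjAut n M => f.1 x) hG
  obtain ⟨c, -, hc⟩ := Rep.unique p.pt_mem Rep.id h2
  have hc : ∀ v, L v = c • v := hc
  have h3 : c = Real.exp τ := by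
    have h4 := hL.1
    rw [hc, scale_vec] at h4
    exact (smul_left_injective ℝ p.2.1.2 h4).symm
  refine ⟨τ, ?_⟩
  change ∀ᶠ b' in 𝓝 (B.mk p), _
  rw [← map_coneMk_nhds, eventually_map]
  filter_upwards [hL.2] with w hw
  obtain ⟨w', hw', hww⟩ := hw
  rw [hww, liftFun_one_mk]
  refine congrArg B.mk (Sigma.ext rfl (heq_of_eq (Subtype.ext (Subtype.ext ?_))))
  rw [hw', hc, h3]
  rfl

/-- An affine automorphism of `B(M)` over the identity of `M` is a homothety. -/
theorem exists_eq_liftFun_one [PreconnectedSpace (B n M)] {G : AffAut n M}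
    (hG : projHom n M G = 1) : ∃ τ, ∀ b, G.1 b = liftFun 1 τ b := by
  rcases isEmpty_or_nonempty (B n M) with h | ⟨⟨b₀⟩⟩
  · exact ⟨0, fun b => h.elim b⟩
  obtain ⟨τ, hτ⟩ := eventually_eq_liftFun_one hG b₀
  refine ⟨τ, fun b => ?_⟩
  refine (iff_of_eventually (P := fun b => G.1 b = liftFun 1 τ b) (fun b => ?_) b₀ b).1
    hτ.self_of_nhds
  obtain ⟨σ, hσ⟩ := eventually_eq_liftFun_one hG b
  have h1 : ∀ b b' : B n M, liftFun 1 σ b = liftFun 1 τ b → liftFun 1 σ b' = liftFun 1 τ b' := by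
    intro b b' h
    obtain ⟨k, rfl⟩ := exists_eq_add_of_liftFun_eq h
    exact (liftFun_add_int_mul 1 σ k b').symm
  filter_upwards [hσ] with b' hb'
  rw [hb', hσ.self_of_nhds]
  exact ⟨h1 _ _, h1 _ _⟩

/-- Every affine automorphism of `B(M)` is the composition of a homothety and of the lift of a
projective automorphism of `M`. -/
theorem exists_eq_liftHom [PreconnectedSpace (B n M)] (F : AffAut n M) :
    ∃ τ : ℝ, F = liftHom n M (projHom n M F, Multiplicative.ofAdd τ) := by
  set f := projHom n M F with hf
  have h1 : projHom n M ((liftHom n M (f, 1))⁻¹ * F) = 1 := by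
    rw [map_mul, map_inv, projHom_liftHom, ← hf, inv_mul_cancel]
  obtain ⟨τ, hτ⟩ := exists_eq_liftFun_one h1
  refine ⟨τ, ?_⟩
  have h2 : (liftHom n M (f, 1))⁻¹ * F = liftHom n M (1, Multiplicative.ofAdd τ) :=
    Subtype.ext (Homeomorph.ext hτ)
  rw [inv_mul_eq_iff_eq_mul, ← map_mul, Prod.mk_mul_mk, mul_one, one_mul] at h2
  exact h2

end Projection

/-! ### The topology of the group of affine automorphisms -/

section AffTopology

variable {n : ℕ} {M : Type*} [TopologicalSpace M] [ChartedSpace (RP n) M]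
  [HasGroupoid M (projectiveGroupoid n)]

/-- The lifting morphism is injective near the identity: its kernel is generated by the homothety of
ratio `2`. -/
theorem exists_injOn_liftHom [Nonempty M] :
    ∃ N ∈ 𝓝 (1 : ProjAut n M × Multiplicative ℝ), InjOn (liftHom n M) N := by
  have hl : 0 < Real.log 2 := Real.log_pos one_lt_two
  refine ⟨{x | |x.2.toAdd| < Real.log 2 / 2}, ?_, ?_⟩
  · have hc : Continuous fun x : ProjAut n M × Multiplicative ℝ => |x.2.toAdd| :=
      (continuous_toAdd.comp continuous_snd).abs
    refine (isOpen_lt hc continuous_const).mem_nhds ?_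
    change |(0 : ℝ)| < _
    rw [abs_zero]
    positivity
  · rintro ⟨f, τ⟩ hτ ⟨g, σ⟩ hσ h
    have hfg : f = g := by
      have := congrArg (projHom n M) h
      rwa [projHom_liftHom, projHom_liftHom] at this
    subst hfg
    refine Prod.ext rfl ?_
    have h1 : liftHom n M (1, τ) = liftHom n M (1, σ) := by
      have h2 : ∀ t, liftHom n M (f, t) = liftHom n M (f, 1) * liftHom n M (1, t) := by
        intro t
        rw [← map_mul, Prod.mk_mul_mk, mul_one, one_mul]
      rw [h2 τ, h2 σ] at h
      exact mul_left_cancel h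
    obtain ⟨b, -⟩ := surjective_proj (n := n) (Classical.arbitrary M)
    obtain ⟨k, hk⟩ := exists_eq_add_of_liftFun_eq (τ := τ.toAdd) (σ := σ.toAdd) (b := b)
      (congrArg (fun F : AffAut n M => F.1 b) h1)
    have hτ : |τ.toAdd| < Real.log 2 / 2 := hτ
    have hσ : |σ.toAdd| < Real.log 2 / 2 := hσ
    rw [abs_lt] at hτ hσ
    have hk1 : (k : ℝ) < 1 := by
      by_contra hc
      nlinarith
    have hk2 : (-1 : ℝ) < k := by
      by_contra hc
      nlinarith
    have hk0 : k = 0 := by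
      have a1 : k < 1 := by exact_mod_cast hk1
      have a2 : -1 < k := by exact_mod_cast hk2
      omega
    rw [hk0, Int.cast_zero, zero_mul, add_zero] at hk
    exact hk.symm

variable [CompactSpace M] [T2Space M]

theorem preconnectedSpace_benzecri [PreconnectedSpace M] : PreconnectedSpace (B n M) := by
  obtain ⟨ψ, hψ, h⟩ := exists_circleCoord n M
  obtain ⟨Φ, -⟩ := exists_homeomorph hψ h
  exact Φ.symm.surjective.denseRange.preconnectedSpace Φ.symm.continuous

instance : T2Space (M ≃ₜ M) := by
  refine T2Space.of_injective_continuous (f := fun f : M ≃ₜ M => (f : C(M, M))) ?_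
    continuous_induced_dom
  intro f g h
  exact Homeomorph.ext fun x => congrArg (fun k : C(M, M) => k x) h

theorem continuous_projHom : Continuous (projHom n M) := by
  refine continuous_iff_continuousAt.2 fun F => continuousAt_subgroup_of_forall fun x => ?_
  have hq : IsOpenQuotientMap (Prod.map (id : AffAut n M → _) (B.proj : B n M → M)) :=
    IsOpenQuotientMap.id.prodMap isOpenQuotientMap_proj
  have hc : Continuous fun p : AffAut n M × M => (projHom n M p.1).1 p.2 := by
    rw [hq.isQuotientMap.continuous_iff]
    have : (fun p : AffAut n M × M => (projHom n M p.1).1 p.2) ∘ Prod.map id B.proj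
        = fun p : AffAut n M × B n M => (p.1.1 p.2).proj :=
      funext fun p => projHom_proj p.1 p.2
    rw [this]
    exact continuous_proj.comp (continuous_eval_subgroup (AffAut n M))
  exact hc.continuousAt

/-- The local expression of the lift of the automorphism represented by an endomorphism `S`. -/
def liftExpr (x : Endo (E n) × (ℝ × E n)) : E n :=
  Real.exp x.2.1 • (|LinearMap.det (x.1 : E n →ₗ[ℝ] E n)| ^ (-(1 : ℝ) / (n + 1 : ℕ)) • x.1 x.2.2)

theorem liftExpr_one (v : E n) : liftExpr (1, 0, v) = v := by
  have : LinearMap.det ((1 : Endo (E n)) : E n →ₗ[ℝ] E n) = 1 := LinearMap.det_id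
  simp only [liftExpr, this, abs_one, Real.one_rpow, Real.exp_zero, one_smul]
  rfl

theorem continuousAt_liftExpr (v : E n) : ContinuousAt liftExpr ((1 : Endo (E n)), (0 : ℝ), v) := by
  have h1 : Continuous fun x : Endo (E n) × (ℝ × E n) =>
      |LinearMap.det (x.1 : E n →ₗ[ℝ] E n)| :=
    (ContinuousLinearMap.continuous_det.comp continuous_fst).abs
  have h2 : |LinearMap.det ((1 : Endo (E n)) : E n →ₗ[ℝ] E n)| ≠ 0 := by
    have : LinearMap.det ((1 : Endo (E n)) : E n →ₗ[ℝ] E n) = 1 := LinearMap.det_id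
    rw [this, abs_one]
    exact one_ne_zero
  have h3 : Continuous fun x : Endo (E n) × (ℝ × E n) => x.1 x.2.2 := by fun_prop
  have h4 : Continuous fun x : Endo (E n) × (ℝ × E n) => Real.exp x.2.1 := by fun_prop
  exact h4.continuousAt.smul ((h1.continuousAt.rpow_const (Or.inl h2)).smul h3.continuousAt)

/-- Near the identity, the lifts have the jointly continuous local expressions `liftExpr`, since an
automorphism close to the identity is represented by an endomorphism close to `1`. -/
theorem continuous_liftHom : Continuous (liftHom n M) := by
  refine continuous_of_continuousAt_one _ (continuousAt_subgroup_of_forall fun b => ?_)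
  obtain ⟨p, rfl⟩ := Quotient.exists_rep b
  have h0 : (liftHom n M 1).1 (B.mk p) = B.mk p := by rw [map_one]; rfl
  change ContinuousAt (fun x : (ProjAut n M × Multiplicative ℝ) × B n M =>
    (liftHom n M x.1).1 x.2) (1, B.mk p)
  rw [ContinuousAt, h0, nhds_prod_eq, ← map_coneMk_nhds, prod_map_right, tendsto_map'_iff,
    map_coneMk_nhds]
  intro U hU
  have hemb := isOpenEmbedding_cone (n := n) p.chart
  obtain ⟨W, hWo, hmW, -, -, hW⟩ := exists_nhds_rep p.1 p.pt_mem
  have hV : ((fun w : Cone p.chart => w.1.1) '' {w | B.mk ⟨p.1, w⟩ ∈ U}) ∈ 𝓝 p.vec := by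
    have h1 : {w : Cone p.chart | B.mk ⟨p.1, w⟩ ∈ U} ∈ 𝓝 p.2 :=
      (continuous_coneMk p.1).continuousAt hU
    have h2 := image_mem_map (m := fun w : Cone p.chart => w.1.1) h1
    rwa [hemb.map_nhds_eq] at h2
  have hexpr := (continuousAt_liftExpr p.vec)
  rw [ContinuousAt, liftExpr_one] at hexpr
  have hev := hexpr.eventually hV
  rw [nhds_prod_eq, eventually_prod_iff] at hev
  obtain ⟨P, hP, Q, hQ, hPQ⟩ := hev
  have e1 : ∀ᶠ x : (ProjAut n M × Multiplicative ℝ) × Cone p.chart in 𝓝 1 ×ˢ 𝓝 p.2,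
      Q (x.1.2.toAdd, x.2.1.1) := by
    have hc : Continuous fun x : (ProjAut n M × Multiplicative ℝ) × Cone p.chart =>
        (x.1.2.toAdd, x.2.1.1) :=
      (continuous_toAdd.comp (continuous_snd.comp continuous_fst)).prodMk
        ((continuous_vec p.1).comp continuous_snd)
    rw [← nhds_prod_eq]
    exact (hc.tendsto (1, p.2)).eventually hQ
  have e2 : ∀ᶠ x : (ProjAut n M × Multiplicative ℝ) × Cone p.chart in 𝓝 1 ×ˢ 𝓝 p.2,
      ∃ A : E n ≃ₗ[ℝ] E n, toEnd A ∈ {S | P S} ∧ tr (toEnd A) = n + 1 ∧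
      ∀ y ∈ W, Rep p.chart p.chart x.1.1.1 y A ∧ x.1.1.1 y ∈ p.chart.source := by
    have h1 : Tendsto (fun x : (ProjAut n M × Multiplicative ℝ) × Cone p.chart => x.1.1)
        (𝓝 1 ×ˢ 𝓝 p.2) (𝓝 1) := (continuous_fst.tendsto 1).comp tendsto_fst
    exact h1.eventually (hW _ hP)
  have e3 : ∀ᶠ x : (ProjAut n M × Multiplicative ℝ) × Cone p.chart in 𝓝 1 ×ˢ 𝓝 p.2,
      PreB.pt (⟨p.1, x.2⟩ : PreB n M) ∈ W :=
    tendsto_snd.eventually ((continuous_pt p.1).continuousAt.eventually (hWo.mem_nhds hmW))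
  rw [mem_map]
  filter_upwards [e1, e2, e3]
  rintro ⟨⟨f, τ⟩, w⟩ hxQ ⟨A, hAP, -, hA⟩ hwW
  obtain ⟨C, hC, hCA⟩ := exists_smul_det A
  obtain ⟨hR, hs⟩ := hA _ hwW
  obtain ⟨w', hw', hlift⟩ := exists_liftRel_of_rep (p := ⟨p.1, w⟩) (e' := p.1) hs hC
    (hR.of_eq_smul hCA) (abs_of_pos (Real.exp_pos τ.toAdd))
  obtain ⟨w₂, hw₂, h3⟩ := hPQ hAP hxQ
  have h4 : w₂ = w' := by
    refine hemb.injective (h3.trans ?_)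
    change _ = w'.1.1
    rw [hw', hCA]
    rfl
  rw [mem_preimage]
  change (liftHom n M (f, τ)).1 (B.mk ⟨p.1, w⟩) ∈ U
  rw [liftHom_apply, liftFun_mk hlift, ← h4]
  exact hw₂

variable [ConnectedSpace M]

/-- The lifting morphism is open: the homothety factor of an affine automorphism close to the
identity is read off from the circle coordinate. -/
theorem image_liftHom_mem_nhds {N : Set (ProjAut n M × Multiplicative ℝ)} (hN : N ∈ 𝓝 1) :
    liftHom n M '' N ∈ 𝓝 1 := by
  have := preconnectedSpace_benzecri (n := n) (M := M)
  obtain ⟨ψ, hψ, hψr⟩ := exists_circleCoord n M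
  have hl : Real.log 2 ≠ 0 := (Real.log_pos one_lt_two).ne'
  have hpi : (2 * Real.pi) ≠ 0 := by positivity
  obtain ⟨b, -⟩ := surjective_proj (n := n) (Classical.arbitrary M)
  let u : AffAut n M → Circle := fun F => ψ (F.1 b) / ψ ((liftHom n M (projHom n M F, 1)).1 b)
  let θ : AffAut n M → ℝ := fun F => Complex.arg (u F) / (2 * Real.pi) * Real.log 2
  have hu : Continuous u := by
    have h1 : Continuous fun F : AffAut n M => F.1 b :=
      (continuous_eval_subgroup (AffAut n M)).comp (Continuous.prodMk_left b)
    have h2 : Continuous fun F : AffAut n M => liftHom n M (projHom n M F, 1) :=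
      continuous_liftHom.comp (continuous_projHom.prodMk continuous_const)
    exact (hψ.comp h1).div' (hψ.comp (h1.comp h2))
  have hu1 : u 1 = 1 := by
    have : liftHom n M (projHom n M 1, 1) = 1 := by
      rw [map_one]
      exact map_one _
    simp only [u, this, div_self']
  have hθ : Tendsto θ (𝓝 1) (𝓝 0) := by
    have h1 : ContinuousAt (fun F => Complex.arg (u F)) 1 := by
      refine ContinuousAt.comp (f := fun F => (u F : ℂ)) (g := Complex.arg)
        (Complex.continuousAt_arg ?_) (continuous_subtype_val.comp hu).continuousAt
      rw [hu1]
      exact Complex.one_mem_slitPlane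
    have h2 : ContinuousAt θ 1 := (h1.div_const _).mul_const _
    have h3 : θ 1 = 0 := by simp [θ, hu1]
    rwa [ContinuousAt, h3] at h2
  have hlift : ∀ F, liftHom n M (projHom n M F, Multiplicative.ofAdd (θ F)) = F := by
    intro F
    obtain ⟨τ, hτ⟩ := exists_eq_liftHom F
    obtain ⟨r, hr⟩ := Quotient.exists_rep ((liftHom n M (projHom n M F, 1)).1 b)
    have hFb : F.1 b = B.mk (r.scale τ) := by
      rw [hτ, liftHom_apply, ← liftFun_one_mk]
      change _ = liftFun 1 τ (Quotient.mk _ r)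
      rw [hr, liftHom_apply]
      have := liftFun_mul 1 (projHom n M F) τ 0 b
      rw [one_mul, add_zero] at this
      exact this
    have hr : B.mk r = (liftHom n M (projHom n M F, 1)).1 b := hr
    have huF : Circle.exp (Complex.arg (u F)) = Circle.exp (2 * Real.pi * (τ / Real.log 2)) := by
      rw [Circle.exp_arg]
      simp only [u]
      rw [hFb, ← hr, hψr _ _ _ (liftRel_scale τ r), mul_div_cancel_left]
    obtain ⟨m, hm⟩ := Circle.exp_eq_exp.1 huF
    have hθm : θ F = τ + m * Real.log 2 := by
      simp only [θ]
      rw [hm]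
      field_simp
    conv_rhs => rw [hτ]
    refine Subtype.ext (Homeomorph.ext fun b' => ?_)
    rw [liftHom_apply, liftHom_apply, toAdd_ofAdd, toAdd_ofAdd, hθm, liftFun_add_int_mul]
  have ht : Tendsto (fun F => (projHom n M F, Multiplicative.ofAdd (θ F))) (𝓝 1) (𝓝 1) := by
    refine Tendsto.prodMk_nhds ?_ ?_
    · have := (continuous_projHom (n := n) (M := M)).tendsto 1
      rwa [map_one] at this
    · exact (continuous_ofAdd.tendsto 0).comp hθ
  filter_upwards [ht hN] with F hF
  exact ⟨_, hF, hlift F⟩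

end AffTopology

/-! ### The automorphism groups -/

section Main

variable (n : ℕ) (M : Type*) [TopologicalSpace M] [T2Space M] [CompactSpace M]
  [ChartedSpace (RP n) M] [HasGroupoid M (projectiveGroupoid n)]

/-- The projection morphism restricts to a surjection of the identity components, because it is
continuous and has the continuous section `f ↦ liftHom n M (f, 1)`. -/
theorem exists_surjective_connectedComponent :
    ∃ P : Subgroup.connectedComponentOfOne (autGroup (affineGroupoid n) (B n M)) →*
        Subgroup.connectedComponentOfOne (autGroup (projectiveGroupoid n) M),
      Function.Surjective P ∧ ∀ F (b : B n M), (F.1.1 b).proj = (P F).1.1 b.proj := by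
  have h1 : ∀ F : Subgroup.connectedComponentOfOne (AffAut n M),
      projHom n M F.1 ∈ Subgroup.connectedComponentOfOne (ProjAut n M) := by
    intro F
    have := (continuous_projHom (n := n) (M := M)).image_connectedComponent_subset 1
      ⟨F.1, F.2, rfl⟩
    rwa [map_one] at this
  refine ⟨((projHom n M).comp (Subgroup.subtype _)).codRestrict _ h1, ?_,
    fun F b => (projHom_proj F.1 b).symm⟩
  rintro ⟨f, hf⟩
  have hc : Continuous fun f : ProjAut n M => liftHom n M (f, 1) :=
    continuous_liftHom.comp (Continuous.prodMk_left 1)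
  have h2 := hc.image_connectedComponent_subset 1 ⟨f, hf, rfl⟩
  rw [show ((1 : ProjAut n M), (1 : Multiplicative ℝ)) = 1 from rfl, map_one] at h2
  exact ⟨⟨_, h2⟩, Subtype.ext (projHom_liftHom (f, 1))⟩

theorem exists_isLieGroupOfDim [ConnectedSpace M] : ∃ d : ℕ,
    IsLieGroupOfDim (autGroup (projectiveGroupoid n) M) d ∧
    IsLieGroupOfDim (autGroup (affineGroupoid n) (B n M)) (d + 1) := by
  have := preconnectedSpace_benzecri (n := n) (M := M)
  obtain ⟨r⟩ := nonempty_chartChoice n M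
  let m : M := Classical.arbitrary M
  let j₀ : ChartPt n M := chartPt (r.chart m) (r.mem_source m)
  have h1 := localParam_fieldAut r j₀
  have h2 := h1.extend (liftHom n M) continuous_liftHom
    (fun F => by
      obtain ⟨τ, hτ⟩ := exists_eq_liftHom F
      exact ⟨_, hτ.symm⟩)
    exists_injOn_liftHom fun N hN => image_liftHom_mem_nhds hN
  refine ⟨Module.finrank ℝ (fieldValues j₀), h1.isLieGroupOfDim, ?_⟩
  have h3 := h2.isLieGroupOfDim
  rwa [Module.finrank_prod, Module.finrank_self] at h3

end Main

end Benzecri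

end

theorem proposition3p2 (n : ℕ) (M : Type*) [TopologicalSpace M] [T2Space M] [CompactSpace M]
    [ConnectedSpace M] [ChartedSpace (Benzecri.RP n) M]
    [HasGroupoid M (Benzecri.projectiveGroupoid n)] :
    (∃ Φ : Benzecri.B n M ≃ₜ M × Circle, ∀ b, (Φ b).1 = b.proj) ∧
    (∃ P : Subgroup.connectedComponentOfOne
          (Benzecri.autGroup (Benzecri.affineGroupoid n) (Benzecri.B n M)) →*
        Subgroup.connectedComponentOfOne
          (Benzecri.autGroup (Benzecri.projectiveGroupoid n) M),
      Function.Surjective P ∧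
      ∀ F (b : Benzecri.B n M), (F.1.1 b).proj = (P F).1.1 b.proj) ∧
    (∃ d d' : ℕ,
      Benzecri.IsLieGroupOfDim (Benzecri.autGroup (Benzecri.projectiveGroupoid n) M) d ∧
      Benzecri.IsLieGroupOfDim
        (Benzecri.autGroup (Benzecri.affineGroupoid n) (Benzecri.B n M)) d' ∧
      d + 1 ≤ d') := by
  obtain ⟨ψ, hψ, h⟩ := Benzecri.exists_circleCoord n M
  obtain ⟨Φ, hΦ⟩ := Benzecri.exists_homeomorph hψ h
  obtain ⟨d, hd, hd'⟩ := Benzecri.exists_isLieGroupOfDim n M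
  exact ⟨⟨Φ, fun b => by rw [hΦ]⟩, Benzecri.exists_surjective_connectedComponent n M,
    d, d + 1, hd, hd', le_rfl⟩
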